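/- Let $q$ be a power of a prime, $n\ge 7$, and let $U=U_n(q)$ be the group of upper triangular $n\times n$ matrices over $\mathbb F_q$ with all diagonal entries $1$. For $1\le i\le j<n$ let $\alpha_{i,j}$ be the corresponding positive root, with root subgroup $X_{\alpha_{i,j}}=\{1+c\,e_{i,j+1}: c\in\mathbb F_q\}$, and let $V_{\alpha_{i,j}}$ be the subgroup of $U$ generated by all $X_\beta$ with $\beta\notin\{\alpha_{i,l}: i\le l<j\}$. An elementary character at $\alpha$ is an induced character $\lambda^U$, where $\lambda$ is a linear character of $V_\alpha$ that is nontrivial on $X_\alpha$ and trivial on every other $X_\beta\subseteq V_\alpha$. Let $D=\{\alpha_{1,n-3},\alpha_{2,n-2},\alpha_{3,n-1}\}$; a basic character at $D$ is a product $\xi_{D,\phi}=\prod_{\alpha\in D}\lambda_\alpha^U$, where $\phi=(\lambda_\alpha)_{\alpha\in D}$ and each $\lambda_\alpha$ is as above. Put $\mu(2m)=m(m-1)$ and $\mu(2m+1)=m^2$, and let $N_{m,e}(q)$ be the number of irreducible complex characters of $U_m(q)$ of degree $q^e$. (a) Every basic character $\xi_{D,\phi}$ at $D$ decomposes into exactly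 $q^2$ distinct irreducible constituents of degree $q^{3n-15}$, each of multiplicity $1$, and exactly $q-1$ distinct irreducible constituents of degree $q^{3n-14}$, each of multiplicity $q$; there are no other constituents. (b) Let $\chi$ be a constituent of degree $q^{3n-14}$ of some basic character at $D$, let $\eta$ be an irreducible character of $U_{n-6}(q)$ of highest degree, and let $\eta_U$ be its inflation to $U$ along the surjection $U\to U_{n-6}(q)$ that reads off the diagonal block of rows and columns $4,\dots,n-3$. Then $\chi\cdot\eta_U$ is an irreducible character of $U$ of degree $q^{\mu(n)-2}$, and this is the third highest degree among the irreducible characters of $U$. (c) The number of distinct characters $\chi\cdot\eta_U$ obtained in (b), over all $\phi$, $\chi$ and $\eta$, is $(q-1)^4\,N_{n-6,\mu(n-6)}(q)$. -/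

import Mathlib

noncomputable section

/-! ### Complex characters of finite groups -/

/-- `χ` is the character of an irreducible complex representation of `G`. -/
def IsIrrChar {G : Type*} [Group G] (χ : G → ℂ) : Prop :=
  ∃ (d : ℕ) (ρ : Representation ℂ G (Fin d → ℂ)), ρ.IsIrreducible ∧ ρ.character = χ

/-- The scalar product `|G|⁻¹ ∑ ξ(g) χ(g⁻¹)` of characters; for an irreducible character `χ`
this is the multiplicity of `χ` in `ξ`. -/
def multiplicity_in {G : Type*} [Group G] (χ ξ : G → ℂ) : ℂ :=
  (Nat.card G : ℂ)⁻¹ * ∑ᶠ g : G, ξ g * χ g⁻¹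

/-- The irreducible constituents of `ξ`. -/
def irrConstituents {G : Type*} [Group G] (ξ : G → ℂ) : Set (G → ℂ) :=
  {χ | IsIrrChar χ ∧ multiplicity_in χ ξ ≠ 0}

open Classical in
/-- The induced class function `f^G`, for `f` on a subgroup `H` of the finite group `G`. -/
def inducedChar {G : Type*} [Group G] (H : Subgroup G) (f : H → ℂ) : G → ℂ := fun g =>
  (Nat.card H : ℂ)⁻¹ * ∑ᶠ x : G, if h : x⁻¹ * g * x ∈ H then f ⟨x⁻¹ * g * x, h⟩ else 0

/-- The set of degrees of the irreducible complex characters of `G`. -/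
def charDegrees (G : Type*) [Group G] : Set ℕ :=
  {d | ∃ χ : G → ℂ, IsIrrChar χ ∧ χ 1 = d}

/-- `χ` is an irreducible character whose degree is the largest one of `G`. -/
def IsHighestDegree {G : Type*} [Group G] (χ : G → ℂ) : Prop :=
  IsIrrChar χ ∧ ∃ d : ℕ, χ 1 = d ∧ ∀ e ∈ charDegrees G, e ≤ d

/-- `χ` is an irreducible character whose degree is the third largest one of `G`: exactly two
character degrees of `G` are larger. -/
def IsThirdHighestDegree {G : Type*} [Group G] (χ : G → ℂ) : Prop :=
  IsIrrChar χ ∧ ∃ d : ℕ, χ 1 = d ∧ {e ∈ charDegrees G | d < e}.ncard = 2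

/-! ### The group `U_n(F)` -/

/-- The group of upper triangular `n × n` matrices over `F` with all diagonal entries `1`. -/
def U (n : ℕ) (F : Type*) [Field F] : Subgroup (GL (Fin n) F) where
  carrier := {g | g.val.IsUpperTriangular ∧ ∀ i, g.val i i = 1}
  one_mem' := ⟨by simpa using Matrix.blockTriangular_one, by simp⟩
  mul_mem' := by
    rintro a b ⟨ha, ha'⟩ ⟨hb, hb'⟩
    refine ⟨by simpa using ha.mul hb, fun i => ?_⟩
    rw [Units.val_mul, Matrix.mul_apply, Finset.sum_eq_single i]
    · rw [ha', hb', one_mul]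
    · intro j _ hj
      rcases lt_or_gt_of_ne hj with h | h
      · rw [ha h, zero_mul]
      · rw [hb h, mul_zero]
    · simp
  inv_mem' := by
    rintro a ⟨ha, ha'⟩
    have hinv : (a⁻¹).val.IsUpperTriangular := by
      have : Invertible a.val := a.invertible
      rw [Matrix.coe_units_inv]
      exact Matrix.blockTriangular_inv_of_blockTriangular ha
    refine ⟨hinv, fun i => ?_⟩
    have h1 : (a.val * (a⁻¹).val) i i = 1 := by simp
    rw [Matrix.mul_apply, Finset.sum_eq_single i] at h1
    · rwa [ha', one_mul] at h1
    · intro j _ hj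
      rcases lt_or_gt_of_ne hj with h | h
      · rw [ha h, zero_mul]
      · rw [hinv h, mul_zero]
    · simp

theorem diagBlock_mul {n : ℕ} {F : Type*} [Field F] (k m : ℕ) (h : k + m ≤ n)
    (a b : Matrix (Fin n) (Fin n) F) (ha : a.IsUpperTriangular) (hb : b.IsUpperTriangular) :
    (a * b).submatrix (fun i : Fin m => (⟨k + i, by omega⟩ : Fin n))
        (fun i : Fin m => (⟨k + i, by omega⟩ : Fin n)) =
      a.submatrix (fun i : Fin m => (⟨k + i, by omega⟩ : Fin n))
        (fun i : Fin m => (⟨k + i, by omega⟩ : Fin n)) *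
      b.submatrix (fun i : Fin m => (⟨k + i, by omega⟩ : Fin n))
        (fun i : Fin m => (⟨k + i, by omega⟩ : Fin n)) := by
  ext i j
  simp only [Matrix.submatrix_apply, Matrix.mul_apply]
  refine (Finset.sum_of_injOn (fun x : Fin m => (⟨k + x, by omega⟩ : Fin n)) ?_ ?_ ?_ ?_).symm
  · intro x _ y _ hxy
    simp only [Fin.mk.injEq] at hxy
    ext
    omega
  · intro x _
    simp
  · intro x _ hx
    by_cases h1 : x.val < k + i
    · rw [ha (show x < ⟨k + i, by omega⟩ from h1), zero_mul]
    · by_cases h2 : k + j < x.val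
      · rw [hb (show (⟨k + j, by omega⟩ : Fin n) < x from h2), mul_zero]
      · refine absurd ⟨⟨x.val - k, by omega⟩, by simp, ?_⟩ hx
        ext
        simp only
        omega
  · intro x _
    rfl

/-- The surjection `U_n(F) → U_m(F)` that reads off the diagonal block of the (1-based) rows and
columns `k+1, …, k+m`. Restricted to the subgroup of all matrices of `U_n(F)` that differ from
the identity only inside the block (the one generated by the root subgroups at `α_{i,j}`,
`k+1 ≤ i ≤ j < k+m`), it is an isomorphism, and its kernel is generated by
the other root subgroups. -/
def diagBlock (n : ℕ) (F : Type*) [Field F] (k m : ℕ) (h : k + m ≤ n) : U n F →* U m F where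
  toFun g :=
    ⟨{ val := g.1.val.submatrix (fun i : Fin m => (⟨k + i, by omega⟩ : Fin n))
          (fun i : Fin m => (⟨k + i, by omega⟩ : Fin n))
       inv := (g⁻¹).1.val.submatrix (fun i : Fin m => (⟨k + i, by omega⟩ : Fin n))
          (fun i : Fin m => (⟨k + i, by omega⟩ : Fin n))
       val_inv := by
         rw [← diagBlock_mul k m h _ _ g.2.1 (g⁻¹).2.1, ← Units.val_mul, ← Subgroup.coe_mul]
         rw [mul_inv_cancel]
         refine Matrix.submatrix_one _ fun x y hxy => ?_
         simp only [Fin.mk.injEq] at hxy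
         ext
         omega
       inv_val := by
         rw [← diagBlock_mul k m h _ _ (g⁻¹).2.1 g.2.1, ← Units.val_mul, ← Subgroup.coe_mul]
         rw [inv_mul_cancel]
         refine Matrix.submatrix_one _ fun x y hxy => ?_
         simp only [Fin.mk.injEq] at hxy
         ext
         omega },
      fun i j hij => g.2.1 (show (⟨k + j, by omega⟩ : Fin n) < ⟨k + i, by omega⟩ from
        Nat.add_lt_add_left hij k),
      fun i => g.2.2 _⟩
  map_one' := by
    refine Subtype.ext (Units.ext ?_)
    refine Matrix.submatrix_one _ fun x y hxy => ?_
    simp only [Fin.mk.injEq] at hxy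
    ext
    omega
  map_mul' a b := by
    refine Subtype.ext (Units.ext ?_)
    exact diagBlock_mul k m h _ _ a.2.1 b.2.1

/-! ### Positive roots, elementary and basic characters -/

/-- The positive roots `α_{i,j}`, `1 ≤ i ≤ j < n`, given by the pairs `(i, j)`. -/
abbrev PosRoot (n : ℕ) : Type := {p : ℕ × ℕ // 1 ≤ p.1 ∧ p.1 ≤ p.2 ∧ p.2 < n}

/-- The root subgroup `X_α` as a set: for `α = α_{i,j}` the matrices `1 + c e_{i,j+1}`, `c ∈ F`
(in the 0-based indexing of `Fin n`, the entry is `(i-1, j)`). -/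
def rootSubgroup {n : ℕ} (F : Type*) [Field F] (α : PosRoot n) : Set (U n F) :=
  {u | ∃ c : F, u.1.val = 1 + Matrix.single (⟨α.1.1 - 1, by have := α.2; omega⟩ : Fin n)
    (⟨α.1.2, α.2.2.2⟩ : Fin n) c}

/-- `arm(α_{i,j}) = {α_{i,l} : i ≤ l < j}`. -/
def arm {n : ℕ} (α : PosRoot n) : Set (PosRoot n) :=
  {β | β.1.1 = α.1.1 ∧ β.1.2 < α.1.2}

/-- The base group `V_α`, generated by all `X_β`, `β ∉ arm(α)`. -/
def baseGroup {n : ℕ} (F : Type*) [Field F] (α : PosRoot n) : Subgroup (U n F) :=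
  Subgroup.closure (⋃ β ∈ (arm α)ᶜ, rootSubgroup F β)

/-- The linear characters of `V_α` that are nontrivial on `X_α` and trivial on every other
`X_β ⊆ V_α`. -/
def BaseLinearChar {n : ℕ} (F : Type*) [Field F] (α : PosRoot n) : Type _ :=
  {l : baseGroup F α →* ℂˣ // (∃ u : baseGroup F α, u.1 ∈ rootSubgroup F α ∧ l u ≠ 1) ∧
    ∀ β : PosRoot n, β ∉ arm α → β ≠ α →
      ∀ u : baseGroup F α, u.1 ∈ rootSubgroup F β → l u = 1}

/-- The elementary character `λ^U` at `α`. -/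
def elementaryChar {n : ℕ} {F : Type*} [Field F] {α : PosRoot n} (l : BaseLinearChar F α) :
    U n F → ℂ :=
  inducedChar (baseGroup F α) fun u => (l.1 u : ℂ)

/-- The basic character `ξ_{D,φ}`: the (tensor) product of the elementary characters
`λ_α^U`, `α ∈ D`, where `φ = (λ_α)_{α ∈ D}`. -/
def basicChar {n : ℕ} {F : Type*} [Field F] (D : Finset (PosRoot n))
    (φ : ∀ α : D, BaseLinearChar F α.1) : U n F → ℂ :=
  ∏ α : D, elementaryChar (φ α)

/-- The set `{α_{1,n-3}, α_{2,n-2}, α_{3,n-1}}`. -/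
def rootsV (n : ℕ) (hn : 7 ≤ n) : Finset (PosRoot n) :=
  {⟨(1, n - 3), by simp only; omega⟩, ⟨(2, n - 2), by simp only; omega⟩,
    ⟨(3, n - 1), by simp only; omega⟩}

/-- `μ(2m) = m(m-1)` and `μ(2m+1) = m²`. -/
def muDeg (n : ℕ) : ℕ := if Even n then (n / 2) * (n / 2 - 1) else (n / 2) ^ 2

/-- `N_{n,e}(q)`: the number of irreducible characters of `U_n(F)` of degree `q^e`, `q = |F|`. -/
def numIrr (n : ℕ) (F : Type*) [Field F] (e : ℕ) : ℕ :=
  {χ : U n F → ℂ | IsIrrChar χ ∧ χ 1 = (Nat.card F : ℂ) ^ e}.ncard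

/-- The irreducible constituents of `ξ` of degree `d`. -/
def constituentsOfDegree {G : Type*} [Group G] (ξ : G → ℂ) (d : ℕ) : Set (G → ℂ) :=
  {χ ∈ irrConstituents ξ | χ 1 = d}

end

/-! Everything rests on one parametrization. For n = r + m + r let K (`cornerGroup`) consist of the
matrices whose top r rows vanish from column r up to, but not including, the diagonal of the upper
right r × r corner. Nonzero d_0, …, d_{r-1} give a linear character λ_d of K through the diagonal of
that corner, and the first two diagonal blocks map K onto U_r × U_m. A Mackey argument
(`exists_separating`, `multiplicity_in_cornerChar`) shows that λ_d σ η induces irreducibly from K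
for all irreducible σ of U_r and η of U_m, and that the induced character determines (d, σ, η). Its
degree is q^{rm + r(r-1)/2} σ(1) η(1).

For (a), each base group V_α restricts only one row of the matrix. Hence a product of elementary
characters at the three roots is induced from the intersection of the three base groups, and for r =
3, m = n - 6 this intersection is the kernel of K → U_3. The basic character is therefore λ_d^U
times the inflated regular character of U_3 (`inducedChar_baseInf`), and the latter is the sum of q²
linear characters and of q times each of q - 1 characters of degree q (`uThree_regular`).

For (b) and (c), multiplying by η only replaces the trivial character of U_m by η, so irreducibility
and the count (q-1)³ · (q-1) · N are read off from the parametrization. To place the degree, two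
facts about all of U_n are needed. Degrees are powers of q, by Isaacs' theorem on groups 1 + J with
J a nilpotent algebra (`isOneAddRep_degree`); and they are at most q^{μ(n)}, the index of an abelian
pattern subgroup (`IsIrrChar.exists_degree_le`). The exponents μ(n) and μ(n) - 1 do occur, by the
same construction with r = 1 and r = 2, so q^{μ(n)-2} is third. -/

set_option linter.unusedSectionVars false

noncomputable section

/-! ### Characters of finite groups -/

section Characters

variable {G : Type*} [Group G]

/-- `χ` is the character of a finite-dimensional complex representation. -/
def IsChar (χ : G → ℂ) : Prop :=
  ∃ (d : ℕ) (ρ : Representation ℂ G (Fin d → ℂ)), ρ.character = χ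

theorem exists_rep_fin {V : Type*} [AddCommGroup V] [Module ℂ V] [FiniteDimensional ℂ V]
    (ρ : Representation ℂ G V) :
    ∃ (ρ' : Representation ℂ G (Fin (Module.finrank ℂ V) → ℂ)), Nonempty (ρ.Equiv ρ') := by
  let e : V ≃ₗ[ℂ] (Fin (Module.finrank ℂ V) → ℂ) := (Module.finBasis ℂ V).equivFun
  refine ⟨(LinearEquiv.conjRingEquiv e : _ →* _).comp ρ, ⟨.mk e fun g => ?_⟩⟩
  ext v : 1
  simp

theorem isChar_character {V : Type*} [AddCommGroup V] [Module ℂ V] [FiniteDimensional ℂ V]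
    (ρ : Representation ℂ G V) : IsChar ρ.character := by
  obtain ⟨ρ', ⟨e⟩⟩ := exists_rep_fin ρ
  exact ⟨_, ρ', (Representation.char_iso e).symm⟩

theorem IsIrrChar.isChar {χ : G → ℂ} (h : IsIrrChar χ) : IsChar χ := by
  obtain ⟨d, ρ, _, h⟩ := h
  exact ⟨d, ρ, h⟩

theorem IsChar.mul {χ ξ : G → ℂ} (hχ : IsChar χ) (hξ : IsChar ξ) : IsChar (χ * ξ) := by
  obtain ⟨d, ρ, rfl⟩ := hχ
  obtain ⟨e, σ, rfl⟩ := hξ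
  rw [← Representation.char_tensor]
  exact isChar_character _

theorem IsChar.comp {H : Type*} [Group H] {χ : G → ℂ} (hχ : IsChar χ) (f : H →* G) :
    IsChar (χ ∘ f) := by
  obtain ⟨d, ρ, rfl⟩ := hχ
  exact ⟨d, ρ.comp f, rfl⟩

theorem IsChar.conj {χ : G → ℂ} (hχ : IsChar χ) (g x : G) : χ (x⁻¹ * g * x) = χ g := by
  obtain ⟨d, ρ, rfl⟩ := hχ
  simpa using ρ.char_conj g x⁻¹

theorem isChar_monoidHom (l : G →* ℂˣ) : IsChar (fun g => (l g : ℂ)) := by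
  let ρ : Representation ℂ G ℂ :=
    { toFun := fun g => LinearMap.lsmul ℂ ℂ (l g : ℂ)
      map_one' := by ext; simp
      map_mul' := by intro x y; ext; simp }
  have : ρ.character = fun g => (l g : ℂ) := by
    ext g
    simp [Representation.character, ρ, LinearMap.trace_eq_matrix_trace ℂ (Module.Basis.singleton Unit ℂ),
      Matrix.trace, LinearMap.toMatrix_apply]
  rw [← this]
  exact isChar_character ρ

theorem multiplicity_in_eq_sum [Fintype G] (χ ξ : G → ℂ) :
    multiplicity_in χ ξ = (Nat.card G : ℂ)⁻¹ * ∑ g, ξ g * χ g⁻¹ := by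
  rw [multiplicity_in, finsum_eq_sum_of_fintype]

variable [Finite G]

theorem card_ne_zero_complex : (Nat.card G : ℂ) ≠ 0 := by
  exact_mod_cast Nat.card_pos.ne'

theorem multiplicity_in_sum {ι : Type*} (s : Finset ι) (c : ι → ℂ) (χ : G → ℂ) (ξ : ι → G → ℂ) :
    multiplicity_in χ (∑ i ∈ s, c i • ξ i) = ∑ i ∈ s, c i * multiplicity_in χ (ξ i) := by
  cases nonempty_fintype G
  simp only [multiplicity_in_eq_sum, Finset.sum_apply, Pi.smul_apply, smul_eq_mul, Finset.mul_sum,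
    Finset.sum_mul]
  rw [Finset.sum_comm]
  refine Finset.sum_congr rfl fun i _ => Finset.sum_congr rfl fun g _ => by ring

theorem multiplicity_in_irr {χ ξ : G → ℂ} (hχ : IsIrrChar χ) (hξ : IsIrrChar ξ) [Decidable (χ = ξ)] :
    multiplicity_in χ ξ = if χ = ξ then 1 else 0 := by
  cases nonempty_fintype G
  have : Invertible (Nat.card G : ℂ) := invertibleOfNonzero card_ne_zero_complex
  rw [multiplicity_in_eq_sum]
  split_ifs with h
  · subst h
    obtain ⟨d, ρ, hρ, rfl⟩ := hχ
    rw [Representation.char_orthonormal, if_pos ⟨Representation.Equiv.refl ρ⟩]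
  · obtain ⟨d, ρ, hρ, rfl⟩ := hχ
    obtain ⟨e, σ, hσ, rfl⟩ := hξ
    rw [Representation.char_orthonormal, if_neg]
    rintro ⟨f⟩
    exact h (Representation.char_iso f)

/-- Converse of Schur's lemma: by Maschke a subrepresentation has an invariant complement, and the
projection along it is an intertwiner, hence a scalar, so the subrepresentation is 0 or everything.
-/
theorem isIrreducible_of_finrank_eq_one {V : Type*} [AddCommGroup V] [Module ℂ V]
    [FiniteDimensional ℂ V] (ρ : Representation ℂ G V)
    (h : Module.finrank ℂ (ρ.IntertwiningMap ρ) = 1) : ρ.IsIrreducible := by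
  have hnt : Nontrivial V := by
    by_contra hV
    rw [not_nontrivial_iff_subsingleton] at hV
    have : Subsingleton (ρ.IntertwiningMap ρ) :=
      ⟨fun a b => by ext v; exact Subsingleton.elim _ _⟩
    rw [Module.finrank_zero_of_subsingleton] at h
    omega
  have : NeZero (Nat.card G : ℂ) := ⟨card_ne_zero_complex⟩
  have hne : (⊥ : Subrepresentation ρ) ≠ ⊤ := by
    intro hbt
    have := congrArg Subrepresentation.toSubmodule hbt
    exact bot_ne_top (α := Submodule ℂ V) this
  refine { toNontrivial := ⟨⊥, ⊤, hne⟩, eq_bot_or_eq_top := fun W => ?_ }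
  obtain ⟨W', hW'⟩ := exists_isCompl W
  have hc : IsCompl W.toSubmodule W'.toSubmodule := by
    refine ⟨disjoint_iff.2 ?_, codisjoint_iff.2 ?_⟩
    · exact congrArg Subrepresentation.toSubmodule hW'.inf_eq_bot
    · exact congrArg Subrepresentation.toSubmodule hW'.sup_eq_top
  have key : ∀ v, ∃ w ∈ W.toSubmodule, ∃ w' ∈ W'.toSubmodule, w + w' = v := fun v =>
    Submodule.mem_sup.1 (hc.sup_eq_top ▸ Submodule.mem_top : v ∈ W.toSubmodule ⊔ W'.toSubmodule)
  let p : V →ₗ[ℂ] V := W.toSubmodule.subtype ∘ₗ Submodule.projectionOnto _ _ hc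
  have hp1 : ∀ w ∈ W.toSubmodule, p w = w := fun w hw => by
    exact congrArg Subtype.val (Submodule.projectionOnto_apply_left hc ⟨w, hw⟩)
  have hp2 : ∀ w ∈ W'.toSubmodule, p w = 0 := fun w hw => by
    exact congrArg Subtype.val ((Submodule.projectionOnto_apply_eq_zero_iff hc).2 hw)
  let P : ρ.IntertwiningMap ρ := ⟨p, fun g => by
    ext v
    obtain ⟨w, hw, w', hw', rfl⟩ := key v
    simp [hp1 _ hw, hp2 _ hw', hp1 _ (W.apply_mem_toSubmodule g hw),
      hp2 _ (W'.apply_mem_toSubmodule g hw')]⟩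
  have hid : (Representation.IntertwiningMap.id ρ) ≠ 0 := by
    intro h0
    obtain ⟨v, hv⟩ := exists_ne (0 : V)
    apply hv
    have := congrArg (fun f : ρ.IntertwiningMap ρ => f v) h0
    simpa using this
  obtain ⟨c, hc'⟩ := (finrank_eq_one_iff_of_nonzero' _ hid).1 h P
  have hP : ∀ v, p v = c • v := fun v => by
    have := congrArg (fun f : ρ.IntertwiningMap ρ => f v) hc'
    exact this.symm
  by_cases hc0 : c = 0
  · left
    apply Subrepresentation.toSubmodule_injective
    refine (Submodule.eq_bot_iff _).2 fun w hw => ?_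
    rw [← hp1 w hw, hP, hc0, zero_smul]
  · right
    apply Subrepresentation.toSubmodule_injective
    refine (Submodule.eq_top_iff').2 fun v => ?_
    have : p v ∈ W.toSubmodule := by simp [p]
    rw [hP] at this
    exact (Submodule.smul_mem_iff _ hc0).1 this

theorem IsChar.isIrrChar {χ : G → ℂ} (hχ : IsChar χ) (h : multiplicity_in χ χ = 1) :
    IsIrrChar χ := by
  cases nonempty_fintype G
  have : Invertible (Nat.card G : ℂ) := invertibleOfNonzero card_ne_zero_complex
  obtain ⟨d, ρ, rfl⟩ := hχ
  rw [multiplicity_in_eq_sum, Representation.card_inv_mul_sum_char_mul_char_eq_finrank] at h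
  exact ⟨d, ρ, isIrreducible_of_finrank_eq_one ρ (by exact_mod_cast h), rfl⟩

/-! ### Induction -/

open Classical in
/-- The extension by zero of a function on a subgroup. -/
def zeroExt (H : Subgroup G) (f : H → ℂ) (g : G) : ℂ := if h : g ∈ H then f ⟨g, h⟩ else 0

omit [Finite G] in
theorem zeroExt_of_mem {H : Subgroup G} (f : H → ℂ) {g : G} (h : g ∈ H) :
    zeroExt H f g = f ⟨g, h⟩ := dif_pos h

omit [Finite G] in
theorem zeroExt_of_notMem {H : Subgroup G} (f : H → ℂ) {g : G} (h : g ∉ H) :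
    zeroExt H f g = 0 := dif_neg h

omit [Finite G] in
theorem inducedChar_eq_sum [Fintype G] (H : Subgroup G) (f : H → ℂ) (g : G) :
    inducedChar H f g = (Nat.card H : ℂ)⁻¹ * ∑ x, zeroExt H f (x⁻¹ * g * x) := by
  rw [inducedChar, finsum_eq_sum_of_fintype]
  rfl

theorem inducedChar_one (H : Subgroup G) (f : H → ℂ) : inducedChar H f 1 = H.index * f 1 := by
  cases nonempty_fintype G
  have h0 : (Nat.card H : ℂ) ≠ 0 := card_ne_zero_complex
  rw [inducedChar_eq_sum]
  simp only [mul_one, inv_mul_cancel, zeroExt_of_mem f H.one_mem, Finset.sum_const,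
    Finset.card_univ, nsmul_eq_mul, ← Nat.card_eq_fintype_card, ← H.card_mul_index]
  push_cast
  field_simp
  rfl

theorem inducedChar_conj (H : Subgroup G) (f : H → ℂ) (g x : G) :
    inducedChar H f (x⁻¹ * g * x) = inducedChar H f g := by
  cases nonempty_fintype G
  rw [inducedChar_eq_sum, inducedChar_eq_sum]
  congr 1
  refine Fintype.sum_equiv (Equiv.mulLeft x) _ _ fun y => ?_
  simp [mul_assoc]

/-- The representation lives on the functions with f(xh) = l(h)⁻¹ f(x). Averaging over H projects
all functions onto this space, so its trace can be computed in the basis of point masses of G. -/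
theorem isChar_inducedChar (H : Subgroup G) (l : H →* ℂˣ) :
    IsChar (inducedChar H fun h => (l h : ℂ)) := by
  classical
  cases nonempty_fintype G
  let ρ : Representation ℂ G (G → ℂ) :=
    { toFun := fun g => LinearMap.funLeft ℂ ℂ (fun x => g⁻¹ * x)
      map_one' := by ext; simp [LinearMap.funLeft_apply]
      map_mul' := by intro x y; ext; simp [LinearMap.funLeft_apply, mul_assoc] }
  have hρ : ∀ g f x, ρ g f x = f (g⁻¹ * x) := fun _ _ _ => rfl
  let W : Subrepresentation ρ :=
    { toSubmodule :=
        { carrier := {f | ∀ x, ∀ h : H, f (x * h) = (l h : ℂ)⁻¹ * f x}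
          zero_mem' := by simp
          add_mem' := by
            intro a b ha hb x h
            simp only [Pi.add_apply, ha x h, hb x h, mul_add]
          smul_mem' := by
            intro c a ha x h
            simp only [Pi.smul_apply, smul_eq_mul, ha x h]
            ring }
      apply_mem_toSubmodule := by
        intro g f hf x h
        simpa [hρ, mul_assoc] using hf (g⁻¹ * x) h }
  have hW : ∀ f, f ∈ W.toSubmodule ↔ ∀ x, ∀ h : H, f (x * h) = (l h : ℂ)⁻¹ * f x := fun _ => Iff.rfl
  let P : (G → ℂ) →ₗ[ℂ] (G → ℂ) :=
    { toFun := fun f x => (Nat.card H : ℂ)⁻¹ * ∑ h : H, (l h : ℂ) * f (x * h)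
      map_add' := by
        intro a b
        ext x
        simp only [Pi.add_apply, mul_add, Finset.sum_add_distrib]
      map_smul' := by
        intro c a
        ext x
        simp only [Pi.smul_apply, smul_eq_mul, RingHom.id_apply, Finset.mul_sum]
        exact Finset.sum_congr rfl fun _ _ => by ring }
  have hP : ∀ f x, P f x = (Nat.card H : ℂ)⁻¹ * ∑ h : H, (l h : ℂ) * f (x * h) := fun _ _ => rfl
  have hPW : ∀ f, P f ∈ W.toSubmodule := by
    intro f
    rw [hW]
    intro x k
    rw [hP, hP, mul_left_comm]
    congr 1
    rw [Finset.mul_sum]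
    refine Fintype.sum_equiv (Equiv.mulLeft k) (fun h : H => (l h : ℂ) * f (x * k * h))
      (fun h => (l k : ℂ)⁻¹ * ((l h : ℂ) * f (x * h))) fun h => ?_
    simp [mul_assoc]
  have hPid : ∀ f ∈ W.toSubmodule, P f = f := by
    intro f hf
    ext x
    have h0 : (Nat.card H : ℂ) ≠ 0 := card_ne_zero_complex
    have : ∀ h : H, (l h : ℂ) * f (x * h) = f x := fun h => by
      rw [(hW f).1 hf x h, mul_inv_cancel_left₀ (l h).ne_zero]
    rw [hP]
    simp only [this]
    · simp only [Finset.sum_const, Finset.card_univ, nsmul_eq_mul, ← Nat.card_eq_fintype_card]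
      field_simp
  have key : W.toRepresentation.character = inducedChar H fun h => (l h : ℂ) := by
    ext g
    have h1 : W.toRepresentation g =
        (P ∘ₗ ρ g).restrict (p := W.toSubmodule) (q := W.toSubmodule) (fun x _ => hPW _) := by
      ext f : 2
      exact (hPid _ (W.apply_mem_toSubmodule g f.2)).symm
    rw [Representation.character, h1, LinearMap.trace_restrict_eq_of_forall_mem W.toSubmodule (P ∘ₗ ρ g) (fun x => hPW _) (fun x _ => hPW _),
      LinearMap.trace_eq_matrix_trace ℂ (Pi.basisFun ℂ G), inducedChar_eq_sum, Matrix.trace,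
      Finset.mul_sum]
    refine Finset.sum_congr rfl fun x _ => ?_
    rw [Matrix.diag_apply, LinearMap.toMatrix_apply, Pi.basisFun_apply, Pi.basisFun_repr,
      LinearMap.comp_apply, hP]
    congr 1
    by_cases hx : x⁻¹ * g * x ∈ H
    · rw [zeroExt_of_mem _ hx, Finset.sum_eq_single ⟨_, hx⟩]
      · rw [hρ, show g⁻¹ * (x * (x⁻¹ * g * x)) = x by group]
        simp
      · intro h _ hh
        rw [hρ, Pi.single_eq_of_ne, mul_zero]
        intro heq
        apply hh
        ext
        simp only
        rw [← mul_right_inj x, ← mul_right_inj g⁻¹, heq]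
        group
      · simp
    · rw [zeroExt_of_notMem _ hx]
      refine Finset.sum_eq_zero fun h _ => ?_
      rw [hρ, Pi.single_eq_of_ne, mul_zero]
      intro heq
      apply hx
      have : x⁻¹ * g * x = h := by
        rw [← mul_right_inj x, ← mul_right_inj g⁻¹, heq]
        group
      rw [this]
      exact h.2
  rw [← key]
  exact isChar_character _

/-- The product of an induced function with a class function. -/
theorem inducedChar_mul (H : Subgroup G) (f : H → ℂ) (χ : G → ℂ)
    (hχ : ∀ g x, χ (x⁻¹ * g * x) = χ g) :
    inducedChar H f * χ = inducedChar H (fun h => f h * χ h) := by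
  cases nonempty_fintype G
  ext g
  rw [Pi.mul_apply, inducedChar_eq_sum, inducedChar_eq_sum, mul_assoc, Finset.sum_mul]
  congr 1
  refine Finset.sum_congr rfl fun x _ => ?_
  by_cases h : x⁻¹ * g * x ∈ H
  · rw [zeroExt_of_mem _ h, zeroExt_of_mem _ h, hχ]
  · rw [zeroExt_of_notMem _ h, zeroExt_of_notMem _ h, zero_mul]

/-- The scalar product of two induced class functions when the Mackey summands off the trivial
double coset vanish: for `x ∉ K` some `u ∈ K` with `x⁻¹ u x ∈ K` acts on both sides by different
scalars. -/
theorem multiplicity_in_inducedChar (K : Subgroup G) (f f' : K → ℂ)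
    (hf' : ∀ k x : K, f' (x⁻¹ * k * x) = f' k)
    (H : ∀ x ∉ K, ∃ (u v : K) (a b : ℂ), a ≠ b ∧ x⁻¹ * u * x = v ∧ (∀ k, f (k * u) = a * f k) ∧
      ∀ k, f' k = b * f' (v⁻¹ * k)) :
    multiplicity_in (inducedChar K f') (inducedChar K f) =
      (Nat.card K : ℂ)⁻¹ * ∑ᶠ k, f k * f' k⁻¹ := by
  classical
  cases nonempty_fintype G
  have hK : (Nat.card K : ℂ) ≠ 0 := card_ne_zero_complex
  have hG : (Nat.card G : ℂ) ≠ 0 := card_ne_zero_complex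
  rw [finsum_eq_sum_of_fintype]
  -- The Mackey summand at x: for x in K conjugation disappears, and otherwise translation by u
  -- multiplies the sum by two different scalars.
  have step : ∀ x, ∑ g, zeroExt K f g * zeroExt K f' (x⁻¹ * g⁻¹ * x) =
      if x ∈ K then ∑ k, f k * f' k⁻¹ else 0 := by
    intro x
    split_ifs with hx
    · rw [← Finset.sum_subset (Finset.subset_univ (Finset.univ.filter (· ∈ K)))]
      · rw [Finset.sum_subtype (p := (· ∈ K)) _ (by simp)]
        refine Finset.sum_congr rfl fun k _ => ?_
        rw [zeroExt_of_mem f k.2, zeroExt_of_mem f' (K.mul_mem (K.mul_mem (K.inv_mem hx)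
          (K.inv_mem k.2)) hx)]
        exact congrArg _ (hf' k⁻¹ ⟨x, hx⟩)
      · intro g _ hg
        rw [zeroExt_of_notMem f (by simpa using hg), zero_mul]
    · obtain ⟨u, v, a, b, hab, huv, h1, h2⟩ := H x hx
      have e1 : ∀ g, zeroExt K f (g * u) = a * zeroExt K f g := by
        intro g
        by_cases hg : g ∈ K
        · rw [zeroExt_of_mem f hg, zeroExt_of_mem f (K.mul_mem hg u.2)]
          exact h1 ⟨g, hg⟩
        · rw [zeroExt_of_notMem f hg, zeroExt_of_notMem f, mul_zero]
          rwa [K.mul_mem_cancel_right u.2]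
      have e2 : ∀ g, zeroExt K f' g = b * zeroExt K f' ((v : G)⁻¹ * g) := by
        intro g
        by_cases hg : g ∈ K
        · rw [zeroExt_of_mem f' hg, zeroExt_of_mem f' (K.mul_mem (K.inv_mem v.2) hg)]
          exact h2 ⟨g, hg⟩
        · rw [zeroExt_of_notMem f' hg, zeroExt_of_notMem f', mul_zero]
          rwa [K.mul_mem_cancel_left (K.inv_mem v.2)]
      set S := ∑ g, zeroExt K f g * zeroExt K f' (x⁻¹ * g⁻¹ * x) with hS
      have h3 : b * S = a * S := by
        conv_rhs => rw [hS, Finset.mul_sum]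
        rw [hS, Finset.mul_sum]
        refine Fintype.sum_equiv (Equiv.mulRight (u⁻¹ : G)) _ _ fun g => ?_
        have e3 := e1 (g * (u : G)⁻¹)
        rw [inv_mul_cancel_right] at e3
        have e4 := e2 (x⁻¹ * (g * (u : G)⁻¹)⁻¹ * x)
        rw [← huv, show (x⁻¹ * u * x)⁻¹ * (x⁻¹ * (g * (u : G)⁻¹)⁻¹ * x) = x⁻¹ * g⁻¹ * x by
          group] at e4
        rw [Equiv.coe_mulRight, e3, e4]
        ring
      by_contra hne
      exact hab (mul_right_cancel₀ hne h3).symm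
  rw [multiplicity_in_eq_sum]
  have h1 : ∀ y, ∑ x, zeroExt K f (y⁻¹ * x * y) * inducedChar K f' x⁻¹ =
      ∑ g, zeroExt K f g * inducedChar K f' g⁻¹ := by
    intro y
    refine Fintype.sum_equiv (MulAut.conj y⁻¹).toEquiv _ _ fun g => ?_
    have := inducedChar_conj K f' g⁻¹ y
    simp only [MulEquiv.toEquiv_eq_coe, EquivLike.coe_coe, MulAut.conj_apply, inv_inv]
    rw [← this]
    simp [mul_assoc]
  have e : ∑ g, inducedChar K f g * inducedChar K f' g⁻¹ = (Nat.card G : ℂ) *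
      ((Nat.card K : ℂ)⁻¹ * ∑ g, zeroExt K f g * inducedChar K f' g⁻¹) := by
    calc ∑ g, inducedChar K f g * inducedChar K f' g⁻¹
        = ∑ g, ∑ y, (Nat.card K : ℂ)⁻¹ * (zeroExt K f (y⁻¹ * g * y) * inducedChar K f' g⁻¹) := by
          refine Finset.sum_congr rfl fun g _ => ?_
          rw [inducedChar_eq_sum K f, mul_assoc, Finset.sum_mul, Finset.mul_sum]
      _ = ∑ _y : G, (Nat.card K : ℂ)⁻¹ * ∑ g, zeroExt K f g * inducedChar K f' g⁻¹ := by
          rw [Finset.sum_comm]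
          refine Finset.sum_congr rfl fun y _ => ?_
          rw [← Finset.mul_sum, h1]
      _ = _ := by
          rw [Finset.sum_const, Finset.card_univ, nsmul_eq_mul, ← Nat.card_eq_fintype_card]
  rw [e, inv_mul_cancel_left₀ hG]
  congr 1
  calc ∑ g, zeroExt K f g * inducedChar K f' g⁻¹
      = ∑ g, ∑ x, (Nat.card K : ℂ)⁻¹ * (zeroExt K f g * zeroExt K f' (x⁻¹ * g⁻¹ * x)) := by
        refine Finset.sum_congr rfl fun g _ => ?_
        rw [inducedChar_eq_sum K f', mul_left_comm, Finset.mul_sum, Finset.mul_sum]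
    _ = ∑ x, (Nat.card K : ℂ)⁻¹ * if x ∈ K then ∑ k, f k * f' k⁻¹ else 0 := by
        rw [Finset.sum_comm]
        refine Finset.sum_congr rfl fun y _ => ?_
        rw [← Finset.mul_sum, step]
    _ = _ := ?_
  rw [← Finset.mul_sum]
  rw [Finset.sum_ite, Finset.sum_const_zero, add_zero, Finset.sum_const, nsmul_eq_mul,
    ← Fintype.card_subtype, ← Nat.card_eq_fintype_card]
  exact inv_mul_cancel_left₀ hK _

omit [Finite G] in
/-- If `G = V₁ V₂`, then sums of functions invariant under `V₁` and `V₂` multiply. -/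
theorem sum_mul_sum_of_invariant [Fintype G] (V₁ V₂ : Subgroup G)
    (hV : ∀ g, ∃ v ∈ V₁, ∃ w ∈ V₂, g = v * w) (f₁ f₂ : G → ℂ)
    (h₁ : ∀ x, ∀ v ∈ V₁, f₁ (x * v) = f₁ x) (h₂ : ∀ x, ∀ v ∈ V₂, f₂ (x * v) = f₂ x) :
    (∑ x, f₁ x) * ∑ x, f₂ x = Nat.card G * ∑ x, f₁ x * f₂ x := by
  rw [Finset.sum_mul_sum]
  have : ∀ x, ∑ y, f₁ x * f₂ y = ∑ w, f₁ x * f₂ (x * w) := fun x =>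
    (Fintype.sum_equiv (Equiv.mulLeft x) _ _ fun w => rfl).symm
  simp_rw [this]
  rw [Finset.sum_comm]
  have : ∀ w, ∑ x, f₁ x * f₂ (x * w) = ∑ x, f₁ x * f₂ x := by
    intro w
    obtain ⟨v, hv, w, hw, rfl⟩ := hV w
    refine Fintype.sum_equiv (Equiv.mulRight v) _ _ fun x => ?_
    rw [Equiv.coe_mulRight, h₁ x v hv, ← mul_assoc, h₂ _ w hw]
  simp [this]

/-- If `G = V₁ V₂`, then the product of characters induced from `V₁` and `V₂` is induced from
`V₁ ∩ V₂`. -/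
theorem inducedChar_mul_inducedChar (V₁ V₂ : Subgroup G)
    (hV : ∀ g, ∃ v ∈ V₁, ∃ w ∈ V₂, g = v * w) (f₁ : V₁ → ℂ) (f₂ : V₂ → ℂ)
    (h₁ : ∀ k x : V₁, f₁ (x⁻¹ * k * x) = f₁ k) (h₂ : ∀ k x : V₂, f₂ (x⁻¹ * k * x) = f₂ k) :
    inducedChar V₁ f₁ * inducedChar V₂ f₂ = inducedChar (V₁ ⊓ V₂)
      (fun k => f₁ ⟨k, k.2.1⟩ * f₂ ⟨k, k.2.2⟩) := by
  classical
  cases nonempty_fintype G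
  have hinv : ∀ (V : Subgroup G) (f : V → ℂ) (_ : ∀ k x : V, f (x⁻¹ * k * x) = f k) (g x : G),
      ∀ v ∈ V, zeroExt V f ((x * v)⁻¹ * g * (x * v)) = zeroExt V f (x⁻¹ * g * x) := by
    intro V f hf g x v hv
    have e : (x * v)⁻¹ * g * (x * v) = v⁻¹ * (x⁻¹ * g * x) * v := by group
    rw [e]
    by_cases h : x⁻¹ * g * x ∈ V
    · rw [zeroExt_of_mem f h, zeroExt_of_mem f (V.mul_mem (V.mul_mem (V.inv_mem hv) h) hv)]
      exact hf ⟨_, h⟩ ⟨v, hv⟩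
    · rw [zeroExt_of_notMem f h, zeroExt_of_notMem f]
      rwa [V.mul_mem_cancel_right hv, V.mul_mem_cancel_left (V.inv_mem hv)]
  -- The product formula for orders, obtained by applying the sum lemma to the two indicator
  -- functions.
  have hcard : (Nat.card V₁ : ℂ) * Nat.card V₂ = Nat.card G * Nat.card (V₁ ⊓ V₂ : Subgroup G) := by
    have := sum_mul_sum_of_invariant V₁ V₂ hV (fun x => if x ∈ V₁ then 1 else 0)
      (fun x => if x ∈ V₂ then 1 else 0) (fun x v hv => by simp [V₁.mul_mem_cancel_right hv])
      (fun x v hv => by simp [V₂.mul_mem_cancel_right hv])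
    simp only [← ite_and, mul_ite, mul_one, mul_zero, Finset.sum_boole, ← Fintype.card_subtype,
      ← Nat.card_eq_fintype_card] at this
    rw [this, inf_comm]
    rfl
  have hG : (Nat.card G : ℂ) ≠ 0 := card_ne_zero_complex
  have hV1 : (Nat.card V₁ : ℂ) ≠ 0 := card_ne_zero_complex
  have hV2 : (Nat.card V₂ : ℂ) ≠ 0 := card_ne_zero_complex
  have hV12 : (Nat.card (V₁ ⊓ V₂ : Subgroup G) : ℂ) ≠ 0 := card_ne_zero_complex
  ext g
  rw [Pi.mul_apply, inducedChar_eq_sum, inducedChar_eq_sum, inducedChar_eq_sum,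
    mul_mul_mul_comm, sum_mul_sum_of_invariant V₁ V₂ hV _ _ (hinv V₁ f₁ h₁ g) (hinv V₂ f₂ h₂ g),
    ← mul_inv, hcard, ← mul_assoc, mul_inv, mul_comm (Nat.card G : ℂ)⁻¹, mul_assoc _ _⁻¹,
    inv_mul_cancel₀ hG, mul_one]
  congr 1
  refine Finset.sum_congr rfl fun x _ => ?_
  by_cases m1 : x⁻¹ * g * x ∈ V₁
  · by_cases m2 : x⁻¹ * g * x ∈ V₂
    · have m : x⁻¹ * g * x ∈ V₁ ⊓ V₂ := ⟨m1, m2⟩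
      rw [zeroExt_of_mem _ m1, zeroExt_of_mem _ m2, zeroExt_of_mem _ m]
    · have m : x⁻¹ * g * x ∉ V₁ ⊓ V₂ := fun h => m2 h.2
      rw [zeroExt_of_notMem _ m2, zeroExt_of_notMem _ m, mul_zero]
  · have m : x⁻¹ * g * x ∉ V₁ ⊓ V₂ := fun h => m1 h.1
    rw [zeroExt_of_notMem _ m1, zeroExt_of_notMem _ m, zero_mul]

end Characters

/-! ### Common eigenvectors, and degrees bounded by the index of an abelian subgroup -/

section Eigenvectors

variable {V : Type*} [AddCommGroup V] [Module ℂ V] [FiniteDimensional ℂ V]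

/-- Induction on the dimension of W: an operator that is not scalar on W has a proper nonzero
eigenspace there, and the commuting operators preserve it. -/
theorem exists_common_eigenvector_mem (S : Set (V →ₗ[ℂ] V)) (hS : ∀ s ∈ S, ∀ t ∈ S, s * t = t * s) :
    ∀ (k : ℕ) (W : Submodule ℂ V), Module.finrank ℂ W = k → W ≠ ⊥ → (∀ s ∈ S, ∀ w ∈ W, s w ∈ W) →
      ∃ v ∈ W, v ≠ 0 ∧ ∀ s ∈ S, ∃ c : ℂ, s v = c • v := by
  intro k
  induction k using Nat.strong_induction_on with
  | _ k ih =>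
    intro W hk hW hSW
    by_cases h : ∀ s ∈ S, ∃ c : ℂ, ∀ w ∈ W, s w = c • w
    · obtain ⟨v, hv, hv0⟩ := (Submodule.ne_bot_iff W).1 hW
      exact ⟨v, hv, hv0, fun s hs => (h s hs).imp fun c hc => hc v hv⟩
    · push Not at h
      obtain ⟨s, hs, hc⟩ := h
      have : Nontrivial W := Submodule.nontrivial_iff_ne_bot.2 hW
      obtain ⟨c, hcs⟩ := Module.End.exists_eigenvalue (s.restrict (hSW s hs))
      obtain ⟨w, hw⟩ := hcs.exists_hasEigenvector
      have hw1 : s w = c • (w : V) := congrArg Subtype.val hw.apply_eq_smul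
      have hw0 : (w : V) ≠ 0 := fun h0 => hw.2 (Subtype.ext h0)
      let W' : Submodule ℂ V := W ⊓ Module.End.eigenspace s c
      have hlt : W' < W := by
        refine lt_of_le_of_ne inf_le_left fun heq => ?_
        obtain ⟨x, hx, hx'⟩ := hc c
        rw [← heq] at hx
        exact hx' (Module.End.mem_eigenspace_iff.1 hx.2)
      obtain ⟨v, hv, hv'⟩ := ih _ (hk ▸ Submodule.finrank_lt_finrank_of_lt hlt) W' rfl
        ((Submodule.ne_bot_iff _).2 ⟨w, ⟨w.2, Module.End.mem_eigenspace_iff.2 hw1⟩, hw0⟩) (by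
          intro t ht x hx
          refine ⟨hSW t ht x hx.1, Module.End.mem_eigenspace_iff.2 ?_⟩
          have := congrArg (fun f : V →ₗ[ℂ] V => f x) (hS s hs t ht)
          simp only [Module.End.mul_apply] at this
          rw [this, Module.End.mem_eigenspace_iff.1 hx.2, map_smul])
      exact ⟨v, hv.1, hv'⟩

theorem exists_common_eigenvector [Nontrivial V] (S : Set (V →ₗ[ℂ] V))
    (hS : ∀ s ∈ S, ∀ t ∈ S, s * t = t * s) : ∃ v : V, v ≠ 0 ∧ ∀ s ∈ S, ∃ c : ℂ, s v = c • v := by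
  obtain ⟨v, -, h⟩ := exists_common_eigenvector_mem S hS _ ⊤ rfl top_ne_bot (by simp)
  exact ⟨v, h⟩

variable {G : Type*} [Group G] (ρ : Representation ℂ G V)

omit [FiniteDimensional ℂ V] in
theorem Representation.IsIrreducible.eq_top {ρ : Representation ℂ G V} (hρ : ρ.IsIrreducible)
    (W : Submodule ℂ V) (hW : ∀ g, ∀ w ∈ W, ρ g w ∈ W) (hW0 : W ≠ ⊥) : W = ⊤ := by
  rcases hρ.eq_bot_or_eq_top ⟨W, fun g w hw => hW g w hw⟩ with h | h
  · exact absurd (congrArg Subrepresentation.toSubmodule h) hW0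
  · exact congrArg Subrepresentation.toSubmodule h

omit [FiniteDimensional ℂ V] in
theorem Representation.IsIrreducible.nontrivial_space {ρ : Representation ℂ G V}
    (hρ : ρ.IsIrreducible) : Nontrivial V := by
  by_contra h
  rw [not_nontrivial_iff_subsingleton] at h
  obtain ⟨a, b, hab⟩ := hρ.toNontrivial
  refine hab (Subrepresentation.toSubmodule_injective ?_)
  exact Subsingleton.elim _ _

/-- A nonzero subspace invariant under a set of endomorphisms contains a minimal one. -/
theorem exists_minimal_invariant (S : Set (V →ₗ[ℂ] V)) (W : Submodule ℂ V)
    (hSW : ∀ s ∈ S, ∀ w ∈ W, s w ∈ W) (hW : W ≠ ⊥) :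
    ∃ W' ≤ W, W' ≠ ⊥ ∧ (∀ s ∈ S, ∀ w ∈ W', s w ∈ W') ∧
      ∀ X ≤ W', (∀ s ∈ S, ∀ w ∈ X, s w ∈ X) → X = ⊥ ∨ X = W' := by
  obtain ⟨k, hk⟩ : ∃ k, Module.finrank ℂ W = k := ⟨_, rfl⟩
  induction k using Nat.strong_induction_on generalizing W with
  | _ k ih =>
    by_cases h : ∃ X < W, (∀ s ∈ S, ∀ w ∈ X, s w ∈ X) ∧ X ≠ ⊥
    · obtain ⟨X, hX, hSX, hX0⟩ := h
      obtain ⟨W', h1, h2⟩ := ih _ (hk ▸ Submodule.finrank_lt_finrank_of_lt hX) X hSX hX0 rfl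
      exact ⟨W', h1.trans hX.le, h2⟩
    · push Not at h
      refine ⟨W, le_rfl, hW, hSW, fun X hX hSX => ?_⟩
      rcases hX.lt_or_eq with hlt | heq
      · exact Or.inl (h X hlt hSX)
      · exact Or.inr heq

/-- An abelian A has a common eigenvector v; up to scalars its translates depend only on the coset
of A, and they span the irreducible space. -/
theorem Representation.IsIrreducible.finrank_le_index [Finite G] {ρ : Representation ℂ G V}
    (hρ : ρ.IsIrreducible) (A : Subgroup G) (hA : ∀ a ∈ A, ∀ b ∈ A, a * b = b * a) :
    Module.finrank ℂ V ≤ A.index := by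
  have := hρ.nontrivial_space
  obtain ⟨v, hv0, hv⟩ := exists_common_eigenvector (ρ '' A) (by
    rintro _ ⟨a, ha, rfl⟩ _ ⟨b, hb, rfl⟩
    rw [← map_mul, ← map_mul, hA a ha b hb])
  let f : G ⧸ A → V := fun x => ρ x.out v
  have hf : ∀ g, ∃ c : ℂ, ρ g v = c • f g := by
    intro g
    obtain ⟨a, ha⟩ := QuotientGroup.mk_out_eq_mul A g
    obtain ⟨c, hc⟩ := hv _ ⟨_, A.inv_mem a.2, rfl⟩
    refine ⟨c, ?_⟩
    simp only [f]
    rw [← map_smul, ← hc, ← Module.End.mul_apply, ← map_mul, ha, mul_inv_cancel_right]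
  have htop : Submodule.span ℂ (Set.range f) = ⊤ := by
    refine hρ.eq_top _ (fun g w hw => ?_) fun h0 => ?_
    · induction hw using Submodule.span_induction with
      | mem x hx =>
        obtain ⟨y, rfl⟩ := hx
        obtain ⟨c, hc⟩ := hf (g * y.out)
        rw [map_mul, Module.End.mul_apply] at hc
        simp only [f] at hc ⊢
        rw [hc]
        exact Submodule.smul_mem _ _ (Submodule.subset_span ⟨_, rfl⟩)
      | zero => simp
      | add x y _ _ hx hy => rw [map_add]; exact Submodule.add_mem _ hx hy
      | smul c x _ hx => rw [map_smul]; exact Submodule.smul_mem _ _ hx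
    · obtain ⟨c, hc⟩ := hf 1
      rw [map_one, Module.End.one_apply] at hc
      apply hv0
      rw [hc, (Submodule.span_eq_bot.1 h0) (f _) ⟨_, rfl⟩, smul_zero]
  have : Fintype (G ⧸ A) := Fintype.ofFinite _
  have h1 := finrank_range_le_card (R := ℂ) f
  rw [Set.finrank, htop, finrank_top] at h1
  rwa [Subgroup.index, Nat.card_eq_fintype_card]

end Eigenvectors

/-! ### Degrees of algebra groups

Irreducible representations of a group `1 + J`, for a nilpotent algebra `J` over the finite field
`F`, have degree a power of `|F|`. -/

section AlgebraGroups

variable {F R : Type*} [Field F] [Finite F] [Ring R] [Algebra F R]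
variable {V : Type*} [AddCommGroup V] [Module ℂ V]

/-- `s` restricts to a representation of the multiplicative set `1 + J`. -/
structure IsOneAddRep (J : Submodule F R) (s : R → V →ₗ[ℂ] V) : Prop where
  one : s 1 = 1
  mul : ∀ x ∈ J, ∀ y ∈ J, s ((1 + x) * (1 + y)) = s (1 + x) * s (1 + y)

/-- `J` is closed under multiplication and nilpotent. -/
structure IsNilAlgebra (J : Submodule F R) : Prop where
  mul_mem : ∀ x ∈ J, ∀ y ∈ J, x * y ∈ J
  nil : ∃ N, J ^ N = ⊥

/-- A two-sided ideal `B` of `J`. -/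
structure IsIdealIn (B J : Submodule F R) : Prop where
  le : B ≤ J
  mul_left : ∀ x ∈ J, ∀ z ∈ B, x * z ∈ B
  mul_right : ∀ x ∈ J, ∀ z ∈ B, z * x ∈ B

/-- The finite geometric series in -x inverts 1 + x. -/
theorem IsNilAlgebra.exists_inv {J : Submodule F R} (hJ : IsNilAlgebra J) {x : R} (hx : x ∈ J) :
    ∃ y ∈ J, (1 + x) * (1 + y) = 1 ∧ (1 + y) * (1 + x) = 1 := by
  obtain ⟨N, hN⟩ := hJ.nil
  have hpow : (-x) ^ N = 0 := by
    have : (-x) ^ N ∈ J ^ N := Submodule.pow_mem_pow J (J.neg_mem hx) N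
    rwa [hN, Submodule.mem_bot] at this
  have hmem : ∀ k, (-x) ^ (k + 1) ∈ J := by
    intro k
    induction k with
    | zero => simpa using hx
    | succ k ih => rw [pow_succ]; exact hJ.mul_mem _ ih _ (J.neg_mem hx)
  -- The zeroth power of J contains 1, so N = 0 forces the zero ring.
  rcases Nat.eq_zero_or_pos N with rfl | hN0
  · have h1 : (1 : R) = 0 := by simpa using hpow
    have h2 : ∀ r : R, r = 0 := fun r => by rw [← mul_one r, h1, mul_zero]
    exact ⟨0, J.zero_mem, by rw [h2 1, h2 (_ * _)], by rw [h2 1, h2 (_ * _)]⟩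
  obtain ⟨n, rfl⟩ := Nat.exists_eq_add_of_le' hN0
  have e : 1 + ∑ i ∈ Finset.range n, (-x) ^ (i + 1) = ∑ i ∈ Finset.range (n + 1), (-x) ^ i := by
    rw [Finset.sum_range_succ', add_comm, pow_zero]
  refine ⟨∑ i ∈ Finset.range n, (-x) ^ (i + 1), J.sum_mem fun i _ => hmem i, ?_, ?_⟩
  · rw [e, show (1 + x) = 1 - -x by rw [sub_neg_eq_add], mul_neg_geom_sum, hpow, sub_zero]
  · rw [e, show (1 + x) = 1 - -x by rw [sub_neg_eq_add], geom_sum_mul_neg, hpow, sub_zero]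

theorem IsNilAlgebra.mono {J J' : Submodule F R} (hJ : IsNilAlgebra J) (hle : J' ≤ J)
    (hmul : ∀ x ∈ J', ∀ y ∈ J', x * y ∈ J') : IsNilAlgebra J' := by
  obtain ⟨N, hN⟩ := hJ.nil
  exact ⟨hmul, N, le_bot_iff.1 (hN ▸ pow_le_pow_left' hle N)⟩

/-- A proper ideal of a nilpotent algebra is not the whole annihilator of the quotient. -/
theorem IsNilAlgebra.exists_annihilated {J B : Submodule F R} (hJ : IsNilAlgebra J)
    (hB : ¬ J ≤ B) : ∃ b ∈ J, b ∉ B ∧ ∀ x ∈ J, b * x ∈ B ∧ x * b ∈ B := by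
  classical
  have hex : ∃ k, J ^ (k + 1) ≤ B := by
    obtain ⟨N, hN⟩ := hJ.nil
    exact ⟨N, by rw [pow_succ, hN, Submodule.bot_mul]; exact bot_le⟩
  have hle : ∀ k, J ^ (k + 1) ≤ J := by
    intro k
    induction k with
    | zero => simp
    | succ k ih =>
      rw [pow_succ, Submodule.mul_le]
      exact fun m hm n hn => hJ.mul_mem _ (ih hm) _ hn
  -- With m + 2 the least positive exponent whose power of J lies in B, any element of J^(m+1)
  -- outside B works: multiplying it by J lands in J^(m+2).
  obtain ⟨m, hm⟩ : ∃ m, Nat.find hex = m + 1 := by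
    refine Nat.exists_eq_succ_of_ne_zero fun h0 => hB ?_
    have := Nat.find_spec hex
    rwa [h0, zero_add, pow_one] at this
  have h1 := Nat.find_spec hex
  have h2 := Nat.find_min hex (m := m) (by omega)
  rw [hm] at h1
  obtain ⟨b, hb, hbB⟩ := SetLike.not_le_iff_exists.1 h2
  refine ⟨b, hle _ hb, hbB, fun x hx => ⟨h1 ?_, h1 ?_⟩⟩
  · rw [pow_succ]
    exact Submodule.mul_mem_mul hb hx
  · rw [pow_succ']
    exact Submodule.mul_mem_mul hx hb

/-- The normalized character. -/
def normTrace (s : R → V →ₗ[ℂ] V) (u : R) : ℂ := LinearMap.trace ℂ V (s u) / Module.finrank ℂ V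

/-! ### Ideals acting by scalars and the commutator form -/

section Scalars

variable {J B : Submodule F R} {s : R → V →ₗ[ℂ] V}

theorem IsOneAddRep.map_mul (hs : IsOneAddRep J s) {u v : R} (hu : u - 1 ∈ J) (hv : v - 1 ∈ J) :
    s (u * v) = s u * s v := by
  simpa using hs.mul _ hu _ hv

theorem normTrace_mul_comm (hs : IsOneAddRep J s) {u v : R} (hu : u - 1 ∈ J) (hv : v - 1 ∈ J) :
    normTrace s (u * v) = normTrace s (v * u) := by
  rw [normTrace, normTrace, hs.map_mul hu hv, hs.map_mul hv hu, LinearMap.trace_mul_comm]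

theorem mul_sub_one_mem (hJ : IsNilAlgebra J) {u v : R} (hu : u - 1 ∈ J) (hv : v - 1 ∈ J) :
    u * v - 1 ∈ J := by
  have : u * v - 1 = (u - 1) * (v - 1) + (u - 1) + (v - 1) := by noncomm_ring
  rw [this]
  exact J.add_mem (J.add_mem (hJ.mul_mem _ hu _ hv) hu) hv

theorem IsIdealIn.mul_left_unit (hB : IsIdealIn B J) {u z : R} (hu : u - 1 ∈ J) (hz : z ∈ B) :
    u * z ∈ B := by
  have : u * z = (u - 1) * z + z := by noncomm_ring
  rw [this]
  exact B.add_mem (hB.mul_left _ hu _ hz) hz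

theorem IsIdealIn.mul_right_unit (hB : IsIdealIn B J) {u z : R} (hu : u - 1 ∈ J) (hz : z ∈ B) :
    z * u ∈ B := by
  have : z * u = z * (u - 1) + z := by noncomm_ring
  rw [this]
  exact B.add_mem (hB.mul_right _ hu _ hz) hz

theorem IsNilAlgebra.isIdealIn_self (hJ : IsNilAlgebra J) : IsIdealIn J J :=
  ⟨le_rfl, hJ.mul_mem, fun x hx z hz => hJ.mul_mem z hz x hx⟩

/-- The elements 1 + ua and 1 + au are conjugate under the unit u of 1 + J. -/
theorem normTrace_one_add_comm (hJ : IsNilAlgebra J) (hs : IsOneAddRep J s) {u a : R}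
    (hu : u - 1 ∈ J) (ha : a ∈ J) : normTrace s (1 + u * a) = normTrace s (1 + a * u) := by
  obtain ⟨y, hy, h1, h2⟩ := hJ.exists_inv hu
  rw [add_sub_cancel] at h1 h2
  have e1 : 1 + u * a = u * ((1 + a * u) * (1 + y)) := by
    rw [add_mul, mul_assoc a, h1, one_mul, mul_one, mul_add, h1]
  have e2 : 1 + a * u = ((1 + a * u) * (1 + y)) * u := by
    rw [mul_assoc, h2, mul_one]
  rw [e1, normTrace_mul_comm hs hu, ← e2]
  refine mul_sub_one_mem hJ ?_ (by simpa using hy)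
  rw [add_sub_cancel_left]
  exact hJ.isIdealIn_self.mul_right_unit hu ha

variable [FiniteDimensional ℂ V] [Nontrivial V]

/-- Every element of `1 + B` acts as a scalar. -/
def ActsByScalars (B : Submodule F R) (s : R → V →ₗ[ℂ] V) : Prop :=
  ∀ z ∈ B, ∃ c : ℂ, s (1 + z) = c • 1

theorem normTrace_of_eq_smul {u : R} {c : ℂ} (h : s u = c • 1) : normTrace s u = c := by
  have : (Module.finrank ℂ V : ℂ) ≠ 0 := by exact_mod_cast Module.finrank_pos.ne'
  rw [normTrace, h, map_smul, LinearMap.trace_one, smul_eq_mul, mul_div_cancel_right₀ _ this]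

theorem ActsByScalars.eq (hsc : ActsByScalars B s) {z : R} (hz : z ∈ B) :
    s (1 + z) = normTrace s (1 + z) • 1 := by
  obtain ⟨c, hc⟩ := hsc z hz
  rw [normTrace_of_eq_smul hc, hc]

theorem normTrace_of_smul {u v : R} {c : ℂ} (h : s u = c • s v) :
    normTrace s u = c * normTrace s v := by
  rw [normTrace, h, map_smul, smul_eq_mul, mul_div_assoc, normTrace]

theorem ActsByScalars.map_mul_left (hs : IsOneAddRep J s) (hB : IsIdealIn B J)
    (hsc : ActsByScalars B s) {z u : R} (hz : z ∈ B) (hu : u - 1 ∈ J) :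
    s ((1 + z) * u) = normTrace s (1 + z) • s u := by
  rw [hs.map_mul (by simpa using hB.le hz) hu, hsc.eq hz, smul_mul_assoc, one_mul]

theorem ActsByScalars.map_mul_right (hs : IsOneAddRep J s) (hB : IsIdealIn B J)
    (hsc : ActsByScalars B s) {z u : R} (hz : z ∈ B) (hu : u - 1 ∈ J) :
    s (u * (1 + z)) = normTrace s (1 + z) • s u := by
  rw [hs.map_mul hu (by simpa using hB.le hz), hsc.eq hz, mul_smul_comm, mul_one]

theorem ActsByScalars.ne_zero (hJ : IsNilAlgebra J) (hs : IsOneAddRep J s) (hB : IsIdealIn B J)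
    (hsc : ActsByScalars B s) {z : R} (hz : z ∈ B) : normTrace s (1 + z) ≠ 0 := by
  obtain ⟨y, hy, h1, h2⟩ := hJ.exists_inv (hB.le hz)
  intro h0
  have := hs.map_mul (u := 1 + z) (v := 1 + y) (by simpa using hB.le hz) (by simpa using hy)
  rw [h1, hsc.eq hz, h0, zero_smul, zero_mul, hs.one] at this
  exact one_ne_zero this

/-- `λ(1 + zy) = λ(1 + yz)` for `z` in the ideal that acts by scalars. -/
theorem ActsByScalars.comm (hJ : IsNilAlgebra J) (hs : IsOneAddRep J s) (hB : IsIdealIn B J)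
    (hsc : ActsByScalars B s) {z y : R} (hz : z ∈ B) (hy : y ∈ J) :
    normTrace s (1 + z * y) = normTrace s (1 + y * z) := by
  -- Put 1 + t = (1 - z)⁻¹. Then t lies in B, and multiplying 1 + yz and 1 + zy by 1 + t gives 1 +
  -- (1 + y)t and 1 + t(1 + y), which have the same trace since 1 + y is a unit.
  obtain ⟨t, ht, h1, h2⟩ := hJ.exists_inv (J.neg_mem (hB.le hz))
  have e1 : t = z * (1 + t) := by
    have : t - z * (1 + t) = (1 + -z) * (1 + t) - 1 := by noncomm_ring
    rw [h1, sub_self] at this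
    exact sub_eq_zero.1 this
  have e2 : t = (1 + t) * z := by
    have : t - (1 + t) * z = (1 + t) * (1 + -z) - 1 := by noncomm_ring
    rw [h2, sub_self] at this
    exact sub_eq_zero.1 this
  have htB : t ∈ B := by
    rw [e1]
    exact hB.mul_right_unit (by simpa using ht) hz
  have e3 : (1 + y * z) * (1 + t) = 1 + (1 + y) * t := by
    have : (1 + y * z) * (1 + t) = 1 + t + y * (z * (1 + t)) := by noncomm_ring
    rw [this, ← e1]
    noncomm_ring
  have e4 : (1 + t) * (1 + z * y) = 1 + t * (1 + y) := by
    have : (1 + t) * (1 + z * y) = 1 + t + ((1 + t) * z) * y := by noncomm_ring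
    rw [this, ← e2]
    noncomm_ring
  have hyz : 1 + y * z - 1 ∈ J := by simpa using hJ.mul_mem _ hy _ (hB.le hz)
  have hzy : 1 + z * y - 1 ∈ J := by simpa using hJ.mul_mem _ (hB.le hz) _ hy
  have h3 := normTrace_of_smul (hsc.map_mul_right hs hB htB hyz)
  have h4 := normTrace_of_smul (hsc.map_mul_left hs hB htB hzy)
  rw [e3, normTrace_one_add_comm hJ hs (by simpa using hy) ht, ← e4, h4] at h3
  exact mul_left_cancel₀ (hsc.ne_zero hJ hs hB htB) h3

/-- `β` annihilates `J` modulo `B`. -/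
def Annihilates (β : R) (J B : Submodule F R) : Prop :=
  β ∈ J ∧ ∀ x ∈ J, β * x ∈ B ∧ x * β ∈ B

theorem Annihilates.smul {β : R} (hβ : Annihilates β J B) (c : F) : Annihilates (c • β) J B := by
  refine ⟨J.smul_mem c hβ.1, fun x hx => ⟨?_, ?_⟩⟩
  · rw [smul_mul_assoc]
    exact B.smul_mem c (hβ.2 x hx).1
  · rw [mul_smul_comm]
    exact B.smul_mem c (hβ.2 x hx).2

/-- The commutator form `λ(1 + βx) / λ(1 + xβ)`. -/
def commForm (s : R → V →ₗ[ℂ] V) (β x : R) : ℂ :=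
  normTrace s (1 + β * x) / normTrace s (1 + x * β)

theorem commForm_smul (β x : R) (c : F) : commForm s (c • β) x = commForm s β (c • x) := by
  simp [commForm]

variable (hJ : IsNilAlgebra J) (hs : IsOneAddRep J s) (hB : IsIdealIn B J)
  (hsc : ActsByScalars B s) {β : R} (hβ : Annihilates β J B)
include hJ hs hB hsc hβ

/-- The combination x + y + xβy is chosen so that both 1 + β(·) and 1 + (·)β become products inside
1 + B, where the action is by a multiplicative scalar. -/
theorem commForm_circ {x y : R} (hx : x ∈ J) (hy : y ∈ J) :
    commForm s β (x + y + x * β * y) = commForm s β x * commForm s β y := by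
  have e1 : 1 + β * (x + y + x * β * y) = (1 + β * x) * (1 + β * y) := by noncomm_ring
  have e2 : 1 + (x + y + x * β * y) * β = (1 + x * β) * (1 + y * β) := by noncomm_ring
  rw [commForm, e1, e2,
    normTrace_of_smul (hsc.map_mul_left hs hB (hβ.2 x hx).1
      (by simpa using hB.le (hβ.2 y hy).1)),
    normTrace_of_smul (hsc.map_mul_left hs hB (hβ.2 x hx).2
      (by simpa using hB.le (hβ.2 y hy).2)), mul_div_mul_comm]
  rfl

/-- Moving y and then x around cyclically by `ActsByScalars.comm` equates the scalars of 1 + βxy, 1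
+ yβx and 1 + xyβ. -/
theorem commForm_mul {x y : R} (hx : x ∈ J) (hy : y ∈ J) : commForm s β (x * y) = 1 := by
  have h1 := hsc.comm hJ hs hB (hβ.2 x hx).1 hy
  have h2 := hsc.comm hJ hs hB (hβ.2 y hy).2 hx
  rw [mul_assoc] at h1
  rw [mul_assoc, ← h1, ← mul_assoc x] at h2
  have h3 := hsc.ne_zero hJ hs hB (hβ.2 _ (hJ.mul_mem _ hx _ hy)).2
  rw [commForm, h2, div_self h3]

/-- Replacing y by (1 + xβ)⁻¹ y turns the sum x + yz into the combination of `commForm_circ`, whose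
second factor is again a product. -/
theorem commForm_add_mul {x y z : R} (hx : x ∈ J) (hy : y ∈ J) (hz : z ∈ J) :
    commForm s β (x + y * z) = commForm s β x := by
  obtain ⟨p, hp, h1, -⟩ := hJ.exists_inv (hB.le (hβ.2 x hx).2)
  have hw : (1 + p) * y ∈ J := hJ.isIdealIn_self.mul_left_unit (by simpa using hp) hy
  have e : x + y * z = x + ((1 + p) * y) * z + x * β * (((1 + p) * y) * z) := by
    have : x + ((1 + p) * y) * z + x * β * (((1 + p) * y) * z) =
      x + ((1 + x * β) * (1 + p)) * y * z := by noncomm_ring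
    rw [this, h1, one_mul]
  rw [e, commForm_circ hJ hs hB hsc hβ hx (hJ.mul_mem _ hw _ hz),
    commForm_mul hJ hs hB hsc hβ hw hz, mul_one]

theorem commForm_add {x y : R} (hx : x ∈ J) (hy : y ∈ J) :
    commForm s β (x + y) = commForm s β x * commForm s β y := by
  rw [← commForm_circ hJ hs hB hsc hβ hx hy, commForm_add_mul hJ hs hB hsc hβ
    (J.add_mem hx hy) (hB.le (hβ.2 x hx).2) hy]

theorem commForm_ne_zero {x : R} (hx : x ∈ J) : commForm s β x ≠ 0 :=
  div_ne_zero (hsc.ne_zero hJ hs hB (hβ.2 x hx).1) (hsc.ne_zero hJ hs hB (hβ.2 x hx).2)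

/-- `1 + x` and `1 + β` commute up to the scalar `commForm s β x`. -/
theorem commForm_commutator {x : R} (hx : x ∈ J) :
    s (1 + β) * s (1 + x) = commForm s β x • (s (1 + x) * s (1 + β)) := by
  obtain ⟨y, hy, h1, h2⟩ := hJ.exists_inv hx
  have hI := hJ.isIdealIn_self
  have hxu : (1 + x) - 1 ∈ J := by simpa using hx
  have hyu : (1 + y) - 1 ∈ J := by simpa using hy
  -- With a = β(1 + x)⁻¹, both 1 + β and its conjugate 1 + (1 + x)a by 1 + x differ from 1 + a by
  -- factors in 1 + B. Their operators are thus proportional, with ratio the commutator form at vx,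
  -- and vx differs from x by a product.
  set a := β * (1 + y) with ha
  have haJ : a ∈ J := hI.mul_right_unit hyu hβ.1
  have hau : a * (1 + x) = β := by rw [ha, mul_assoc, h2, mul_one]
  obtain ⟨p, hp, h3, h4⟩ := hJ.exists_inv haJ
  have hpu : (1 + p) - 1 ∈ J := by simpa using hp
  have hau1 : (1 + a) - 1 ∈ J := by simpa using haJ
  have hv : (1 + y) * (1 + p) - 1 ∈ J := mul_sub_one_mem hJ hyu hpu
  set v := (1 + y) * (1 + p) with hvdef
  have e0 : β * v = a * (1 + p) := by rw [hvdef, ← mul_assoc]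
  have e0' : a * (1 + p) = (1 + p) * a := by
    have : a * (1 + p) - (1 + p) * a = (1 + a) * (1 + p) - (1 + p) * (1 + a) := by noncomm_ring
    rw [h3, h4, sub_self] at this
    exact sub_eq_zero.1 this
  have e1 : 1 + β = (1 + a) * (1 + β * (v * x)) := by
    rw [← mul_assoc, e0, e0', mul_add, mul_one, ← mul_assoc, ← mul_assoc, h3, one_mul]
    conv_lhs => rw [← hau]
    noncomm_ring
  have e2 : (1 + (x * β) * v) * (1 + a) = 1 + (1 + x) * a := by
    rw [mul_assoc x, e0, add_mul, one_mul, mul_assoc x, mul_assoc a, h4]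
    noncomm_ring
  have hvx : v * x ∈ J := hI.mul_left_unit hv hx
  have hxβ := (hβ.2 x hx).2
  have f1 : s (1 + β) = normTrace s (1 + β * (v * x)) • s (1 + a) := by
    rw [e1]
    exact hsc.map_mul_right hs hB (hβ.2 _ hvx).1 hau1
  have f2 : s (1 + (1 + x) * a) = normTrace s (1 + (x * β) * v) • s (1 + a) := by
    rw [← e2]
    exact hsc.map_mul_left hs hB (hB.mul_right_unit hv hxβ) hau1
  rw [← normTrace_one_add_comm hJ hs hv (hB.le hxβ), ← mul_assoc v x β] at f2
  have e3 : commForm s β (v * x) = commForm s β x := by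
    have : v * x = x + (v - 1) * x := by noncomm_ring
    rw [this]
    exact commForm_add_mul hJ hs hB hsc hβ hx hv hx
  have f3 : s (1 + (1 + x) * a) * s (1 + x) = s (1 + x) * s (1 + β) := by
    rw [← hs.map_mul (by simpa using hI.mul_left_unit hxu haJ) hxu,
      ← hs.map_mul hxu (by simpa using hβ.1)]
    congr 1
    conv_rhs => rw [← hau]
    noncomm_ring
  have n2 := hsc.ne_zero hJ hs hB (hβ.2 _ hvx).2
  rw [← f3, f1, f2, ← e3, commForm, smul_mul_assoc, smul_mul_assoc, smul_smul, div_mul_cancel₀ _ n2]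

end Scalars
end AlgebraGroups

/-! ### Isaacs' theorem: degrees are powers of |F| -/

section AlgebraGroups

variable {F R : Type*} [Field F] [Finite F] [Ring R] [Algebra F R]

/-- If `V` is spanned by independent translates of `W`, one for each element of a finite set, then
its dimension is the multiple of that of `W`. -/
theorem finrank_eq_card_mul {V ι : Type*} [AddCommGroup V] [Module ℂ V] [FiniteDimensional ℂ V]
    [Fintype ι] (W : Submodule ℂ V) (g : ι → V →ₗ[ℂ] V) (hg : ∀ i, Function.Injective (g i))
    (hind : iSupIndep fun i => W.map (g i)) (htop : ⨆ i, W.map (g i) = ⊤) :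
    Module.finrank ℂ V = Fintype.card ι * Module.finrank ℂ W := by
  classical
  have h := DirectSum.isInternal_submodule_of_iSupIndep_of_iSup_eq_top hind htop
  rw [← (LinearEquiv.ofBijective (DirectSum.coeLinearMap fun i => W.map (g i)) h).finrank_eq,
    Module.finrank_directSum]
  rw [Finset.sum_congr rfl fun i _ => (Submodule.equivMapOfInjective (g i) (hg i) W).finrank_eq.symm,
    Finset.sum_const, Finset.card_univ, smul_eq_mul]

/-- Clifford theory by induction on dim J. Take B maximal among the ideals acting by scalars, and b
outside B annihilating J modulo B. The commutator form of b is additive and kills products, so its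
kernel J' is a subalgebra containing all products. The elements 1 + cb split V into eigenspaces
which 1 + J permutes and 1 + J' preserves; V is the direct sum of |J/J'| translates of an
irreducible 1 + J'-module W, and |J/J'| is a power of |F|. -/
theorem isOneAddRep_degree [Finite R] (k : ℕ) : ∀ (J : Submodule F R), Module.finrank F J = k →
    IsNilAlgebra J → ∀ (V : Type) [AddCommGroup V] [Module ℂ V] [FiniteDimensional ℂ V]
      [Nontrivial V] (s : R → V →ₗ[ℂ] V), IsOneAddRep J s →
      (∀ W : Submodule ℂ V, (∀ x ∈ J, ∀ w ∈ W, s (1 + x) w ∈ W) → W = ⊥ ∨ W = ⊤) →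
      ∃ e, Module.finrank ℂ V = Nat.card F ^ e := by
  classical
  induction k using Nat.strong_induction_on with
  | _ k ih =>
  intro J hk hJ V _ _ _ _ s hs hirr
  have hI := hJ.isIdealIn_self
  -- a maximal ideal acting by scalars
  obtain ⟨B, hBmax⟩ := Set.Finite.exists_maximal
    (s := {B : Submodule F R | IsIdealIn B J ∧ ActsByScalars B s}) (Set.toFinite _)
    ⟨⊥, ⟨bot_le, by simp, by simp⟩, fun z hz => ⟨1, by
      rw [(Submodule.mem_bot F).1 hz, add_zero, hs.one, one_smul]⟩⟩
  obtain ⟨hB, hsc⟩ := hBmax.prop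
  by_cases hJB : J ≤ B
  · refine ⟨0, ?_⟩
    obtain ⟨v, hv⟩ := exists_ne (0 : V)
    rw [pow_zero, finrank_eq_one_iff_of_nonzero v hv]
    refine (hirr _ fun x hx w hw => ?_).resolve_left (by simpa using hv)
    rw [hsc.eq (hJB hx)]
    exact Submodule.smul_mem _ _ hw
  obtain ⟨b, hbJ, hbB, hb⟩ := hJ.exists_annihilated hJB
  have hβ : Annihilates b J B := ⟨hbJ, hb⟩
  have hadd : ∀ {x y}, x ∈ J → y ∈ J → commForm s b (x + y) = commForm s b x * commForm s b y :=
    fun hx hy => commForm_add hJ hs hB hsc hβ hx hy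
  have hmul : ∀ {x y}, x ∈ J → y ∈ J → commForm s b (x * y) = 1 :=
    fun hx hy => commForm_mul hJ hs hB hsc hβ hx hy
  have hcomm : ∀ (c : F) {x}, x ∈ J →
      s (1 + c • b) * s (1 + x) = commForm s b (c • x) • (s (1 + x) * s (1 + c • b)) :=
    fun c x hx => by
      rw [← commForm_smul]
      exact commForm_commutator hJ hs hB hsc (hβ.smul c) hx
  have h0 : commForm s b 0 = 1 := by
    have := hmul J.zero_mem J.zero_mem
    rwa [mul_zero] at this
  let J' : Submodule F R :=
    { carrier := {x | x ∈ J ∧ ∀ c : F, commForm s b (c • x) = 1}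
      zero_mem' := ⟨J.zero_mem, fun c => by rw [smul_zero, h0]⟩
      add_mem' := by
        rintro x y ⟨hx, hx'⟩ ⟨hy, hy'⟩
        refine ⟨J.add_mem hx hy, fun c => ?_⟩
        rw [smul_add, hadd (J.smul_mem c hx) (J.smul_mem c hy), hx', hy', one_mul]
      smul_mem' := by
        rintro c x ⟨hx, hx'⟩
        exact ⟨J.smul_mem c hx, fun d => by rw [smul_smul, hx']⟩ }
  have hJ'J : J' ≤ J := fun x hx => hx.1
  have hJ'mul : ∀ {x y}, x ∈ J → y ∈ J → x * y ∈ J' := fun {x y} hx hy =>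
    ⟨hJ.mul_mem _ hx _ hy, fun c => by
      rw [← smul_mul_assoc]
      exact hmul (J.smul_mem c hx) hy⟩
  -- `J'` is a proper subalgebra
  have hne : J' ≠ J := by
    intro heq
    have hbscal : ∀ c : F, ∃ a : ℂ, s (1 + c • b) = a • 1 := by
      intro c
      obtain ⟨a, ha⟩ := Module.End.exists_eigenvalue (s (1 + c • b))
      refine ⟨a, ?_⟩
      have htop := (hirr (Module.End.eigenspace (s (1 + c • b)) a) fun x hx w hw => ?_).resolve_left
        ha
      · ext v
        have : v ∈ Module.End.eigenspace (s (1 + c • b)) a := htop ▸ Submodule.mem_top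
        simpa using Module.End.mem_eigenspace_iff.1 this
      · rw [Module.End.mem_eigenspace_iff] at hw ⊢
        have h1 := hcomm c hx
        rw [← heq] at hx
        rw [hx.2 c, one_smul] at h1
        have := congrArg (fun f : V →ₗ[ℂ] V => f w) h1
        simp only [Module.End.mul_apply] at this
        rw [this, hw, map_smul]
    let B' : Submodule F R := B ⊔ Submodule.span F {b}
    have hB'mem : ∀ y, y ∈ B' ↔ ∃ z ∈ B, ∃ c : F, z + c • b = y := fun y => by
      simp only [B', Submodule.mem_sup, Submodule.mem_span_singleton]
      constructor
      · rintro ⟨z, hz, _, ⟨c, rfl⟩, h⟩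
        exact ⟨z, hz, c, h⟩
      · rintro ⟨z, hz, c, h⟩
        exact ⟨z, hz, _, ⟨c, rfl⟩, h⟩
    have hB' : B' ∈ {B : Submodule F R | IsIdealIn B J ∧ ActsByScalars B s} := by
      refine ⟨⟨sup_le hB.le (by simpa using hbJ), fun x hx y hy => ?_, fun x hx y hy => ?_⟩,
        fun y hy => ?_⟩
      · obtain ⟨z, hz, c, rfl⟩ := (hB'mem y).1 hy
        rw [mul_add]
        exact Submodule.mem_sup_left (B.add_mem (hB.mul_left x hx z hz) ((hβ.smul c).2 x hx).2)
      · obtain ⟨z, hz, c, rfl⟩ := (hB'mem y).1 hy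
        rw [add_mul]
        exact Submodule.mem_sup_left (B.add_mem (hB.mul_right x hx z hz) ((hβ.smul c).2 x hx).1)
      · obtain ⟨z, hz, c, rfl⟩ := (hB'mem y).1 hy
        obtain ⟨p, hp, h1, -⟩ := hJ.exists_inv (hβ.smul c).1
        obtain ⟨a, ha⟩ := hbscal c
        have hw : (1 + p) * z ∈ B := hB.mul_left_unit (by simpa using hp) hz
        have e : 1 + (z + c • b) = (1 + c • b) * (1 + (1 + p) * z) := by
          rw [mul_add (1 + c • b), mul_one, ← mul_assoc, h1, one_mul]
          abel
        refine ⟨normTrace s (1 + (1 + p) * z) * a, ?_⟩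
        rw [e, hsc.map_mul_right hs hB hw (by simpa using (hβ.smul c).1), ha, smul_smul]
    exact hbB (hBmax.le_of_ge hB' le_sup_left
      (Submodule.mem_sup_right (Submodule.mem_span_singleton_self b)))
  have hJ'nil : IsNilAlgebra J' := hJ.mono hJ'J fun x hx y hy => hJ'mul hx.1 hy.1
  have hlt : Module.finrank F J' < k := hk ▸ Submodule.finrank_lt_finrank_of_lt
    (lt_of_le_of_ne hJ'J hne)
  -- a common eigenvector of the operators of `1 + c b`
  obtain ⟨v, hv0, hv⟩ := exists_common_eigenvector (Set.range fun c : F => s (1 + c • b)) (by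
    rintro _ ⟨c, rfl⟩ _ ⟨d, rfl⟩
    simp only
    rw [← hs.mul _ (hβ.smul c).1 _ (hβ.smul d).1, ← hs.mul _ (hβ.smul d).1 _ (hβ.smul c).1]
    congr 1
    simp only [mul_add, add_mul, mul_one, one_mul, smul_mul_smul_comm, mul_comm c d]
    abel)
  choose μ hμ using fun c : F => hv _ ⟨c, rfl⟩
  let E : (F → ℂ) → Submodule ℂ V := fun ν => ⨅ c, Module.End.eigenspace (s (1 + c • b)) (ν c)
  have hE : ∀ ν w, w ∈ E ν ↔ ∀ c, s (1 + c • b) w = ν c • w := fun ν w => by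
    simp only [E, Submodule.mem_iInf, Module.End.mem_eigenspace_iff]
  have hEind : iSupIndep E := by
    refine (Module.End.independent_iInf_maxGenEigenspace_of_forall_mapsTo
      (fun c : F => s (1 + c • b)) fun c d φ => ?_).mono fun ν => ?_
    · refine Module.End.mapsTo_maxGenEigenspace_of_comm ?_ φ
      rw [Commute, SemiconjBy, ← hs.mul _ (hβ.smul d).1 _ (hβ.smul c).1,
        ← hs.mul _ (hβ.smul c).1 _ (hβ.smul d).1]
      congr 1
      simp only [mul_add, add_mul, mul_one, one_mul, smul_mul_smul_comm, mul_comm c d]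
      abel
    · exact iInf_mono fun c => Module.End.genEigenspace_le_maximal _ _ 1
  have hEmap : ∀ x ∈ J, ∀ w ∈ E μ, s (1 + x) w ∈ E fun c => commForm s b (c • x) * μ c := by
    intro x hx w hw
    rw [hE] at hw ⊢
    intro c
    have := congrArg (fun f : V →ₗ[ℂ] V => f w) (hcomm c hx)
    simp only [Module.End.mul_apply, LinearMap.smul_apply] at this
    rw [this, hw, map_smul, smul_smul]
  have hμ0 : ∀ c, μ c ≠ 0 := by
    intro c hc
    obtain ⟨p, hp, -, h2⟩ := hJ.exists_inv (hβ.smul c).1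
    have h3 := congrArg (fun f : V →ₗ[ℂ] V => f v) (hs.mul _ hp _ (hβ.smul c).1)
    simp only [h2, hs.one, Module.End.mul_apply, Module.End.one_apply] at h3
    rw [hμ, hc, zero_smul, map_zero] at h3
    exact hv0 h3
  -- a minimal subspace for the smaller algebra
  obtain ⟨W, hWE, hW0, hWinv, hWmin⟩ := exists_minimal_invariant
    ((fun x => s (1 + x)) '' J') (E μ) (by
      rintro _ ⟨x, hx, rfl⟩ w hw
      have := hEmap x hx.1 w hw
      simpa only [hx.2, one_mul] using this) ((Submodule.ne_bot_iff _).2 ⟨v, (hE _ _).2 hμ, hv0⟩)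
  have hWinv' : ∀ x ∈ J', ∀ w ∈ W, s (1 + x) w ∈ W := fun x hx => hWinv _ ⟨x, hx, rfl⟩
  have hWnt : Nontrivial W := Submodule.nontrivial_iff_ne_bot.2 hW0
  obtain ⟨e, he⟩ : ∃ e, Module.finrank ℂ W = Nat.card F ^ e := by
    -- The value 0 is a filler: only elements of 1 + J' matter, and they preserve W.
    let s' : R → W →ₗ[ℂ] W := fun u =>
      if h : ∀ w ∈ W, s u w ∈ W then (s u).restrict h else 0
    have hs' : ∀ x ∈ J', ∀ w : W, (s' (1 + x) w : V) = s (1 + x) w := by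
      intro x hx w
      simp only [s']
      rw [dif_pos (hWinv' x hx)]
      rfl
    refine ih _ hlt J' rfl hJ'nil W s' ⟨?_, fun x hx y hy => ?_⟩ fun X hX => ?_
    · ext w
      have := hs' 0 J'.zero_mem w
      rwa [add_zero, hs.one] at this
    · ext w
      have hxy : (1 + x) * (1 + y) = 1 + (x + y + x * y) := by noncomm_ring
      rw [hxy, hs' _ (J'.add_mem (J'.add_mem hx hy) (hJ'mul hx.1 hy.1)), ← hxy,
        hs.mul x hx.1 y hy.1, Module.End.mul_apply, Module.End.mul_apply, hs' x hx, hs' y hy]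
    · rcases hWmin (X.map W.subtype) (Submodule.map_subtype_le _ _) (by
        rintro _ ⟨x, hx, rfl⟩ _ ⟨w, hw, rfl⟩
        refine ⟨s' (1 + x) w, hX x hx w hw, ?_⟩
        exact hs' x hx w) with h | h
      · left
        rw [Submodule.eq_bot_iff] at h ⊢
        exact fun x hx => Subtype.ext (h x ⟨x, hx, rfl⟩)
      · right
        refine Submodule.eq_top_iff'.2 fun y => ?_
        obtain ⟨z, hz, hzy⟩ : (y : V) ∈ X.map W.subtype := by
          rw [h]
          exact y.2
        have : z = y := Subtype.ext hzy
        exact this ▸ hz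
  -- the translates of `W`
  let ι := J ⧸ J'.comap J.subtype
  have : Finite ι := Quotient.finite _
  have : Fintype ι := Fintype.ofFinite ι
  let r : ι → J := fun i => i.out
  have hinj : ∀ x ∈ J, Function.Injective (s (1 + x)) := by
    intro x hx
    obtain ⟨p, hp, -, h2⟩ := hJ.exists_inv hx
    have h3 := hs.mul _ hp _ hx
    rw [h2, hs.one] at h3
    intro w w' hww
    have h4 := congrArg (fun f : V →ₗ[ℂ] V => f w) h3
    have h5 := congrArg (fun f : V →ₗ[ℂ] V => f w') h3
    simp only [Module.End.mul_apply, Module.End.one_apply] at h4 h5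
    rw [h4, h5, hww]
  have hdiff : ∀ x ∈ J, ∀ y ∈ J, y - x ∈ J' → ∀ w ∈ W, s (1 + y) w ∈ W.map (s (1 + x)) := by
    intro x hx y hy hxy w hw
    obtain ⟨p, hp, h1, -⟩ := hJ.exists_inv hx
    have ht : (1 + p) * (y - x) ∈ J' := by
      have : (1 + p) * (y - x) = (y - x) + p * (y - x) := by noncomm_ring
      rw [this]
      exact J'.add_mem hxy (hJ'mul hp hxy.1)
    refine ⟨s (1 + (1 + p) * (y - x)) w, hWinv' _ ht w hw, ?_⟩
    rw [← Module.End.mul_apply, ← hs.mul _ hx _ ht.1]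
    congr 2
    rw [mul_add (1 + x), ← mul_assoc, h1]
    noncomm_ring
  have hcard : Fintype.card ι = Nat.card F ^ Module.finrank F ι := by
    rw [← Nat.card_eq_fintype_card, Module.natCard_eq_pow_finrank (K := F)]
  refine ⟨Module.finrank F ι + e, ?_⟩
  rw [pow_add, ← he, ← hcard]
  refine finrank_eq_card_mul W (fun i => s (1 + (r i : R))) (fun i => hinj _ (r i).2) ?_ ?_
  -- Independence: different cosets of J' send W into eigenspaces with different eigenvalue
  -- functions, because the form separates J/J'.
  · refine (hEind.comp (f := fun i : ι => fun c => commForm s b (c • (r i : R)) * μ c) ?_).mono ?_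
    · intro i j hij
      have h1 : ∀ c : F, commForm s b (c • (r i : R)) = commForm s b (c • (r j : R)) := fun c =>
        mul_right_cancel₀ (hμ0 c) (congrFun hij c)
      have h2 : (r i : R) - r j ∈ J' := by
        refine ⟨J.sub_mem (r i).2 (r j).2, fun c => ?_⟩
        have h3 := hadd (J.smul_mem c (J.sub_mem (r i).2 (r j).2)) (J.smul_mem c (r j).2)
        rw [← smul_add, sub_add_cancel, h1] at h3
        exact (mul_eq_right₀ (commForm_ne_zero hJ hs hB hsc hβ (J.smul_mem c (r j).2))).1 h3.symm
      rw [← Submodule.Quotient.mk_out i, ← Submodule.Quotient.mk_out j, Submodule.Quotient.eq]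
      exact h2
    · rintro i _ ⟨w, hw, rfl⟩
      exact hEmap _ (r i).2 w (hWE hw)
  -- Spanning: the sum of the translates is invariant under 1 + J and nonzero. Invariance holds
  -- since a translate of W depends only on the coset modulo J' (`hdiff`).
  · refine (hirr _ fun x hx w hw => ?_).resolve_left fun h => ?_
    · rw [← Submodule.mem_comap]
      refine (iSup_le fun i => ?_ : _ ≤ Submodule.comap (s (1 + x)) _) hw
      rintro _ ⟨w, hw, rfl⟩
      have hxr : (x + r i + x * r i) ∈ J :=
        J.add_mem (J.add_mem hx (r i).2) (hJ.mul_mem _ hx _ (r i).2)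
      let j : ι := Submodule.Quotient.mk ⟨_, hxr⟩
      refine Submodule.mem_iSup_of_mem (p := fun i => W.map (s (1 + (r i : R)))) j ?_
      rw [← Module.End.mul_apply, ← hs.mul _ hx _ (r i).2,
        show (1 + x) * (1 + (r i : R)) = 1 + (x + r i + x * r i) by noncomm_ring]
      refine hdiff _ (r j).2 _ hxr ?_ w hw
      have := (Submodule.Quotient.eq (J'.comap J.subtype)).1
        (Submodule.Quotient.mk_out j).symm
      exact this
    · obtain ⟨w, hw, hw0⟩ := (Submodule.ne_bot_iff _).1 hW0
      rw [iSup_eq_bot] at h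
      have h1 := h (Submodule.Quotient.mk 0)
      have h2 := (Submodule.eq_bot_iff _).1 h1 _ ⟨w, hw, rfl⟩
      exact hw0 (hinj _ (r _).2 (h2.trans (map_zero _).symm))

/-- Degrees of the irreducible representations of a group isomorphic to `1 + J` are powers of
`|F|`. -/
theorem exists_degree_eq_pow [Finite R] {G : Type*} [Group G] (J : Submodule F R)
    (hJ : IsNilAlgebra J) (f : G →* R) (hf : Function.Injective f)
    (hfJ : ∀ u, u ∈ Set.range f ↔ u - 1 ∈ J) {χ : G → ℂ} (hχ : IsIrrChar χ) :
    ∃ e, χ 1 = (Nat.card F : ℂ) ^ e := by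
  classical
  obtain ⟨d, ρ, hρ, rfl⟩ := hχ
  have := hρ.nontrivial_space
  -- The value 0 off the image of G is arbitrary.
  let s : R → (Fin d → ℂ) →ₗ[ℂ] (Fin d → ℂ) := Function.extend f ρ 0
  have hs : ∀ g, s (f g) = ρ g := fun g => hf.extend_apply _ _ _
  have hex : ∀ x ∈ J, ∃ g, f g = 1 + x := fun x hx => (hfJ _).2 (by simpa using hx)
  obtain ⟨e, he⟩ := isOneAddRep_degree _ J rfl hJ (Fin d → ℂ) s ⟨by
      rw [← map_one f, hs, map_one], fun x hx y hy => by
        obtain ⟨g, hg⟩ := hex x hx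
        obtain ⟨h, hh⟩ := hex y hy
        rw [← hg, ← hh, ← map_mul, hs, hs, hs, map_mul]⟩ fun W hW => by
      by_cases hW0 : W = ⊥
      · exact Or.inl hW0
      · refine Or.inr (hρ.eq_top W (fun g w hw => ?_) hW0)
        have := hW (f g - 1) ((hfJ _).1 ⟨g, rfl⟩) w hw
        rwa [add_sub_cancel, hs] at this
  exact ⟨e, by rw [Representation.char_one, he]; push_cast; rfl⟩

end AlgebraGroups

/-! ### Pattern subgroups of `U_n(F)` -/

section Pattern

variable {n : ℕ} {F : Type*} [Field F]

/-- The underlying matrix of an element of `U_n(F)`. -/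
def mat : U n F →* Matrix (Fin n) (Fin n) F := (Units.coeHom _).comp (U n F).subtype

theorem mat_apply (g : U n F) : mat g = g.1.val := rfl

theorem mat_injective : Function.Injective (mat : U n F →* Matrix (Fin n) (Fin n) F) :=
  fun _ _ h => Subtype.ext (Units.ext h)

theorem mat_diag (g : U n F) (i : Fin n) : mat g i i = 1 := g.2.2 i

theorem mat_lower (g : U n F) {i j : Fin n} (h : j < i) : mat g i j = 0 := g.2.1 h

instance [Finite F] : Finite (U n F) := Finite.of_injective _ mat_injective

theorem mat_mul_apply (g h : U n F) (i j : Fin n) :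
    mat (g * h) i j = ∑ k, mat g i k * mat h k j := by
  rw [map_mul, Matrix.mul_apply]

theorem exists_mat_eq (M : Matrix (Fin n) (Fin n) F) (h1 : ∀ i j, j < i → M i j = 0)
    (h2 : ∀ i, M i i = 1) : ∃ g : U n F, mat g = M := by
  have hdet : IsUnit M.det := by
    rw [Matrix.det_of_isUpperTriangular fun i j hij => h1 i j hij]
    simp [h2]
  exact ⟨⟨Matrix.nonsingInvUnit M hdet, fun i j hij => h1 i j hij, h2⟩, rfl⟩

/-- If all intermediate products vanish, an entry of a product is the sum of the entries. -/
theorem mat_mul_apply_of_forall (g h : U n F) {i j : Fin n} (hij : i < j)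
    (H : ∀ k, i < k → k < j → mat g i k * mat h k j = 0) :
    mat (g * h) i j = mat g i j + mat h i j := by
  rw [mat_mul_apply, ← Finset.sum_subset (Finset.subset_univ {i, j}), Finset.sum_pair hij.ne,
    mat_diag, mat_diag, mul_one, one_mul, add_comm]
  intro k _ hk
  simp only [Finset.mem_insert, Finset.mem_singleton, not_or] at hk
  rcases lt_or_gt_of_ne hk.1 with h1 | h1
  · rw [mat_lower g h1, zero_mul]
  · rcases lt_or_gt_of_ne hk.2 with h2 | h2
    · exact H k h1 h2
    · rw [mat_lower h h2, mul_zero]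

/-- A set `Q` of positions such that the matrices vanishing there form a group. -/
def CoClosed (n : ℕ) (Q : ℕ → ℕ → Prop) : Prop :=
  ∀ i j k, i < j → j < k → k < n → Q i k → Q i j ∨ Q j k

variable [Finite F]

variable (n F) in
/-- The pattern subgroup of all matrices that vanish at the positions above the diagonal in `Q`. -/
def zeroGroup (Q : ℕ → ℕ → Prop) (hQ : CoClosed n Q) : Subgroup (U n F) :=
  let S : Submonoid (U n F) :=
    { carrier := {g | ∀ i j : Fin n, i < j → Q i j → mat g i j = 0}
      one_mem' := fun i j hij _ => by rw [map_one, Matrix.one_apply_ne hij.ne]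
      mul_mem' := by
        intro g h hg hh i j hij hq
        rw [mat_mul_apply_of_forall g h hij, hg i j hij hq, hh i j hij hq, add_zero]
        intro k hik hkj
        rcases hQ i k j hik hkj j.2 hq with hk | hk
        · rw [hg i k hik hk, zero_mul]
        · rw [hh k j hkj hk, mul_zero] }
  { S with
    inv_mem' := by
      intro g hg
      -- In a finite group inverses are powers, so closure under products suffices.
      have : g⁻¹ = g ^ (orderOf g - 1) := inv_eq_of_mul_eq_one_right (by
        rw [mul_pow_sub_one (orderOf_pos g).ne', pow_orderOf_eq_one])
      rw [this]
      exact S.pow_mem hg _ }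

theorem mem_zeroGroup {Q : ℕ → ℕ → Prop} {hQ : CoClosed n Q} {g : U n F} :
    g ∈ zeroGroup n F Q hQ ↔ ∀ i j : Fin n, i < j → Q i j → mat g i j = 0 := Iff.rfl

open Classical in
/-- The number of positions above the diagonal in `Q`. -/
def numPos (n : ℕ) (Q : ℕ → ℕ → Prop) : ℕ :=
  ((Finset.univ : Finset (Fin n × Fin n)).filter fun p => p.1 < p.2 ∧ Q p.1 p.2).card

theorem card_zeroGroup (Q : ℕ → ℕ → Prop) (hQ : CoClosed n Q) :
    Nat.card (zeroGroup n F Q hQ) = Nat.card F ^ numPos n fun i j => ¬ Q i j := by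
  classical
  let P := {p : Fin n × Fin n // p.1 < p.2 ∧ ¬ Q p.1 p.2}
  let e : zeroGroup n F Q hQ → (P → F) := fun g p => mat g.1 p.1.1 p.1.2
  have he : Function.Bijective e := by
    constructor
    · intro g h hgh
      refine Subtype.ext (mat_injective (Matrix.ext fun i j => ?_))
      rcases lt_trichotomy i j with hij | rfl | hij
      · by_cases hq : Q i j
        · rw [g.2 i j hij hq, h.2 i j hij hq]
        · exact congrFun hgh ⟨(i, j), hij, hq⟩
      · rw [mat_diag, mat_diag]
      · rw [mat_lower _ hij, mat_lower _ hij]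
    · intro f
      obtain ⟨g, hg⟩ := exists_mat_eq (n := n) (F := F) (fun i j =>
        if h : i < j ∧ ¬ Q i j then f ⟨(i, j), h⟩ else if i = j then 1 else 0)
        (fun i j hij => by simp [hij.not_gt, hij.ne']) (fun i => by simp)
      refine ⟨⟨g, fun i j hij hq => ?_⟩, funext fun p => ?_⟩
      · rw [hg]
        simp [hq, hij.ne]
      · simp only [e, hg]
        rw [dif_pos p.2]
  have hP : Nat.card P = numPos n fun i j => ¬ Q i j := by
    rw [Nat.card_eq_fintype_card, Fintype.card_subtype, numPos]
    congr!
  rw [Nat.card_congr (Equiv.ofBijective e he), Nat.card_fun, hP]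

theorem index_zeroGroup (Q : ℕ → ℕ → Prop) (hQ : CoClosed n Q) :
    (zeroGroup n F Q hQ).index = Nat.card F ^ numPos n Q := by
  classical
  have h0 : CoClosed n fun _ _ => False := fun _ _ _ _ _ _ h => h.elim
  have htop : zeroGroup n F (fun _ _ => False) h0 = ⊤ := eq_top_iff.2 fun g _ i j _ h => h.elim
  have h1 := card_zeroGroup (F := F) _ h0
  rw [htop, Subgroup.card_top, ← (zeroGroup n F Q hQ).card_mul_index, card_zeroGroup] at h1
  have h2 : numPos n (fun _ _ => ¬ False) = numPos n (fun i j => ¬ Q i j) + numPos n Q := by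
    rw [numPos, numPos, numPos, Finset.card_filter, Finset.card_filter, Finset.card_filter,
      ← Finset.sum_add_distrib]
    refine Finset.sum_congr rfl fun p _ => ?_
    by_cases hp : p.1 < p.2 <;> by_cases hq : Q p.1 p.2 <;> simp [hp, hq]
  rw [h2, pow_add] at h1
  exact mul_left_cancel₀ (pow_ne_zero _ Nat.card_pos.ne') h1

theorem numPos_eq_sum_rows (Q : ℕ → ℕ → Prop) [∀ i j, Decidable (Q i j)] :
    numPos n Q = ∑ i ∈ Finset.range n, ((Finset.range n).filter fun j => i < j ∧ Q i j).card := by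
  classical
  rw [numPos, ← Finset.card_sigma]
  refine Finset.card_bij (fun p _ => ⟨p.1, p.2⟩) ?_ ?_ ?_
  · intro p hp
    simpa using hp
  · intro p _ p' _ h
    simp only [Sigma.mk.injEq, heq_eq_eq, Fin.val_inj] at h
    exact Prod.ext h.1 h.2
  · rintro ⟨i, j⟩ h
    simp only [Finset.mem_sigma, Finset.mem_range, Finset.mem_filter] at h
    exact ⟨(⟨i, h.1⟩, ⟨j, h.2.1⟩), by simpa using h.2.2, rfl⟩

theorem numPos_eq_sum_cols (Q : ℕ → ℕ → Prop) [∀ i j, Decidable (Q i j)] :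
    numPos n Q = ∑ j ∈ Finset.range n, ((Finset.range n).filter fun i => i < j ∧ Q i j).card := by
  classical
  rw [numPos, ← Finset.card_sigma]
  refine Finset.card_bij (fun p _ => ⟨p.2, p.1⟩) ?_ ?_ ?_
  · intro p hp
    simpa using hp
  · intro p _ p' _ h
    simp only [Sigma.mk.injEq, heq_eq_eq, Fin.val_inj] at h
    exact Prod.ext h.2 h.1
  · rintro ⟨i, j⟩ h
    simp only [Finset.mem_sigma, Finset.mem_range, Finset.mem_filter] at h
    exact ⟨(⟨j, h.2.1⟩, ⟨i, h.1⟩), by simpa using h.2.2, rfl⟩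

/-- The elementary matrix `1 + c e_{ij}`. -/
theorem exists_mat_eq_single {i j : Fin n} (hij : i < j) (c : F) :
    ∃ g : U n F, mat g = 1 + Matrix.single i j c := by
  refine exists_mat_eq _ (fun a b hab => ?_) fun a => ?_
  · rw [Matrix.add_apply, Matrix.one_apply_ne hab.ne', Matrix.single_apply_of_ne, add_zero]
    rintro ⟨rfl, rfl⟩
    exact hij.not_gt hab
  · rw [Matrix.add_apply, Matrix.one_apply_eq, Matrix.single_apply_of_ne, add_zero]
    rintro ⟨rfl, rfl⟩
    exact hij.ne rfl

/-- A matrix lies in every subgroup containing the root subgroups at its nonzero entries. -/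
theorem mem_of_forall_single_mem (H : Subgroup (U n F)) (g : U n F)
    (hH : ∀ i j, i < j → mat g i j ≠ 0 → ∀ u : U n F, ∀ c, mat u = 1 + Matrix.single i j c → u ∈ H) :
    g ∈ H := by
  classical
  obtain ⟨k, hk⟩ : ∃ k, ((Finset.univ : Finset (Fin n × Fin n)).filter
    fun p => p.1 < p.2 ∧ mat g p.1 p.2 ≠ 0).card = k := ⟨_, rfl⟩
  induction k using Nat.strong_induction_on generalizing g with
  | _ k ih =>
    by_cases h1 : g = 1
    · rw [h1]
      exact H.one_mem
    have hne : ((Finset.univ : Finset (Fin n × Fin n)).filter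
        fun p => p.1 < p.2 ∧ mat g p.1 p.2 ≠ 0).Nonempty := by
      by_contra hemp
      rw [Finset.not_nonempty_iff_eq_empty, Finset.filter_eq_empty_iff] at hemp
      refine h1 (mat_injective (Matrix.ext fun i j => ?_))
      rw [map_one]
      rcases lt_trichotomy i j with hij | rfl | hij
      · rw [Matrix.one_apply_ne hij.ne]
        by_contra h0
        exact hemp (x := (i, j)) (Finset.mem_univ _) ⟨hij, h0⟩
      · rw [mat_diag, Matrix.one_apply_eq]
      · rw [mat_lower _ hij, Matrix.one_apply_ne hij.ne']
    -- Choose a nonzero entry in the last possible column j. Row j then has nothing to the right of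
    -- its diagonal, so one row operation clears this entry and changes no other.
    obtain ⟨⟨i, j⟩, hij, hmax⟩ := Finset.exists_max_image _ (fun p => p.2) hne
    simp only [Finset.mem_filter, Finset.mem_univ, true_and] at hij
    obtain ⟨hij, hij0⟩ := hij
    have hrow : ∀ l, j < l → mat g j l = 0 := by
      intro l hl
      by_contra h0
      have := hmax (j, l) (by simpa using ⟨hl, h0⟩)
      exact absurd hl (not_lt.2 this)
    obtain ⟨u, hu⟩ := exists_mat_eq_single hij (-mat g i j)
    have hug : ∀ a b, mat (u * g) a b = if a = i ∧ b = j then 0 else mat g a b := by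
      intro a b
      rw [map_mul, hu, add_mul, one_mul, Matrix.add_apply]
      by_cases ha : a = i
      · subst ha
        rw [Matrix.single_mul_apply_same]
        by_cases hb : b = j
        · subst hb
          simp [mat_diag]
        · rw [if_neg (by tauto)]
          rcases lt_or_gt_of_ne hb with hb | hb
          · rw [mat_lower _ hb, mul_zero, add_zero]
          · rw [hrow _ hb, mul_zero, add_zero]
      · rw [Matrix.single_mul_apply_of_ne _ _ _ _ _ ha, if_neg (by tauto), add_zero]
    have hmem : u * g ∈ H := by
      refine ih _ ?_ (u * g) (fun a b hab h0 => ?_) rfl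
      · rw [← hk]
        refine Finset.card_lt_card (Finset.ssubset_iff_subset_ne.2 ⟨fun p hp => ?_, fun heq => ?_⟩)
        · simp only [Finset.mem_filter, Finset.mem_univ, true_and, hug] at hp ⊢
          refine ⟨hp.1, fun h0 => hp.2 ?_⟩
          split_ifs
          · rfl
          · exact h0
        · have : (i, j) ∈ ((Finset.univ : Finset (Fin n × Fin n)).filter
            fun p => p.1 < p.2 ∧ mat (u * g) p.1 p.2 ≠ 0) := by
            rw [heq]
            simpa using ⟨hij, hij0⟩
          simp [hug] at this
      · refine hH a b hab fun h1 => h0 ?_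
        rw [hug, h1, ite_self]
    have := H.mul_mem (H.inv_mem (hH i j hij hij0 u _ hu)) hmem
    rwa [inv_mul_cancel_left] at this

end Pattern

/-! ### Degrees of characters of `U_n(F)` -/

section Degrees

variable {n : ℕ} {F : Type*} [Field F] [Finite F]

variable (n F) in
/-- The strictly upper triangular matrices. -/
def strictUpper : Submodule F (Matrix (Fin n) (Fin n) F) where
  carrier := {M | ∀ i j, j ≤ i → M i j = 0}
  zero_mem' := fun _ _ _ => rfl
  add_mem' := fun ha hb i j hij => by rw [Matrix.add_apply, ha i j hij, hb i j hij, add_zero]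
  smul_mem' := fun c a ha i j hij => by rw [Matrix.smul_apply, ha i j hij, smul_zero]

theorem isNilAlgebra_strictUpper : IsNilAlgebra (strictUpper n F) := by
  -- The k-th power is supported on the positions with j ≥ i + k.
  have hpow : ∀ k, ∀ M ∈ strictUpper n F ^ k, ∀ i j : Fin n, j.val < i + k → M i j = 0 := by
    intro k
    induction k with
    | zero =>
      intro M hM i j hij
      rw [pow_zero] at hM
      obtain ⟨c, rfl⟩ := Submodule.mem_one.1 hM
      rw [Matrix.algebraMap_matrix_apply, if_neg]
      rintro rfl
      omega
    | succ k ih =>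
      intro M hM
      rw [pow_succ] at hM
      induction hM using Submodule.mul_induction_on' with
      | mem_mul_mem a ha b hb =>
        intro i j hij
        rw [Matrix.mul_apply]
        refine Finset.sum_eq_zero fun l _ => ?_
        by_cases hl : l.val < i + k
        · rw [ih a ha i l hl, zero_mul]
        · rw [hb l j (Fin.le_def.2 (by omega)), mul_zero]
      | add a _ b _ ha hb =>
        intro i j hij
        rw [Matrix.add_apply, ha i j hij, hb i j hij, add_zero]
  refine ⟨fun a ha b hb i j hij => ?_, n, ?_⟩
  · rw [Matrix.mul_apply]
    refine Finset.sum_eq_zero fun l _ => ?_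
    rcases le_or_gt l i with hl | hl
    · rw [ha i l hl, zero_mul]
    · rw [hb l j (hij.trans hl.le), mul_zero]
  · rw [Submodule.eq_bot_iff]
    intro M hM
    ext i j
    exact hpow n M hM i j (by omega)

theorem IsIrrChar.exists_degree_eq_pow {χ : U n F → ℂ} (hχ : IsIrrChar χ) :
    ∃ e, χ 1 = (Nat.card F : ℂ) ^ e := by
  refine _root_.exists_degree_eq_pow (strictUpper n F) isNilAlgebra_strictUpper mat mat_injective
    (fun M => ⟨?_, fun hM => ?_⟩) hχ
  · rintro ⟨g, rfl⟩ i j hij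
    rcases hij.lt_or_eq with h | rfl
    · rw [Matrix.sub_apply, mat_lower g h, Matrix.one_apply_ne h.ne', sub_zero]
    · rw [Matrix.sub_apply, mat_diag, Matrix.one_apply_eq, sub_self]
  · refine exists_mat_eq M (fun i j hij => ?_) fun i => ?_
    · have := hM i j hij.le
      rwa [Matrix.sub_apply, Matrix.one_apply_ne hij.ne', sub_zero] at this
    · have := hM i i le_rfl
      rwa [Matrix.sub_apply, Matrix.one_apply_eq, sub_eq_zero] at this

theorem coClosed_block (m : ℕ) : CoClosed n fun i j => j < m ∨ m ≤ i := by
  intro i j k hij hjk _ h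
  omega

/-- The recursion matching the case r = 1 of the corner construction, whose index is q^n inside
U_{n+2}. -/
theorem muDeg_add_two (n : ℕ) : muDeg (n + 2) = muDeg n + n := by
  have h2 : (n + 2) / 2 = n / 2 + 1 := by omega
  rw [muDeg, muDeg, h2]
  rcases Nat.even_or_odd' n with ⟨k, rfl | rfl⟩
  · rw [if_pos (Nat.even_iff.2 (by omega)), if_pos (Nat.even_iff.2 (by omega))]
    have : 2 * k / 2 = k := by omega
    rw [this]
    rcases k with _ | k
    · rfl
    · simp only [Nat.add_sub_cancel]
      ring
  · rw [if_neg (Nat.not_even_iff.2 (by omega)), if_neg (Nat.not_even_iff.2 (by omega))]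
    have : (2 * k + 1) / 2 = k := by omega
    rw [this]
    ring

theorem numPos_block : numPos n (fun i j => j < n / 2 ∨ n / 2 ≤ i) = muDeg n := by
  have hcol : ∀ j ∈ Finset.range n, ((Finset.range n).filter
      fun i => i < j ∧ (j < n / 2 ∨ n / 2 ≤ i)).card = if j < n / 2 then j else j - n / 2 := by
    intro j hj
    rw [Finset.mem_range] at hj
    split_ifs with h
    · refine (congrArg Finset.card ?_).trans (Finset.card_range j)
      ext i
      simp only [Finset.mem_filter, Finset.mem_range]
      omega
    · refine (congrArg Finset.card ?_).trans (Nat.card_Ico _ _)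
      ext i
      simp only [Finset.mem_filter, Finset.mem_range, Finset.mem_Ico]
      omega
  rw [numPos_eq_sum_cols, Finset.sum_congr rfl hcol]
  have hsplit : ∀ m k, ∑ j ∈ Finset.range (m + k), (if j < m then j else j - m) =
      ∑ j ∈ Finset.range m, j + ∑ j ∈ Finset.range k, j := by
    intro m k
    rw [Finset.sum_range_add]
    congr 1
    · exact Finset.sum_congr rfl fun j hj => if_pos (Finset.mem_range.1 hj)
    · exact Finset.sum_congr rfl fun j _ => by simp
  have hn : n / 2 + (n - n / 2) = n := by omega
  conv_lhs => rw [← hn]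
  rw [show (n / 2 + (n - n / 2)) / 2 = n / 2 by rw [hn], hsplit]
  have g1 := Finset.sum_range_id_mul_two (n / 2)
  have g2 := Finset.sum_range_id_mul_two (n - n / 2)
  rw [muDeg]
  rcases Nat.even_or_odd' n with ⟨k, rfl | rfl⟩
  · rw [if_pos (by simp)]
    have h1 : 2 * k / 2 = k := by omega
    rw [h1] at g1 g2 ⊢
    rw [show 2 * k - k = k by omega] at g2 ⊢
    omega
  · rw [if_neg (by simp)]
    have h1 : (2 * k + 1) / 2 = k := by omega
    rw [h1] at g1 g2 ⊢
    rw [show 2 * k + 1 - k = k + 1 by omega] at g2 ⊢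
    rcases k with _ | k
    · simp
    · simp only [Nat.add_sub_cancel] at g1 g2
      nlinarith

/-- The matrices supported, off the diagonal, in rows < n/2 and columns ≥ n/2 form an abelian
subgroup of index q^{μ(n)}, which bounds every degree. -/
theorem IsIrrChar.exists_degree_le {χ : U n F → ℂ} (hχ : IsIrrChar χ) :
    ∃ e ≤ muDeg n, χ 1 = (Nat.card F : ℂ) ^ e := by
  obtain ⟨e, he⟩ := hχ.exists_degree_eq_pow
  refine ⟨e, ?_, he⟩
  obtain ⟨d, ρ, hρ, rfl⟩ := hχ
  have h1 := hρ.finrank_le_index (zeroGroup n F _ (coClosed_block (n / 2))) (by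
    have key : ∀ a ∈ zeroGroup n F _ (coClosed_block (n / 2)),
        ∀ b ∈ zeroGroup n F _ (coClosed_block (n / 2)), ∀ i j, i < j →
          mat (a * b) i j = mat a i j + mat b i j := by
      intro a ha b hb i j hij
      refine mat_mul_apply_of_forall a b hij fun k hik hkj => ?_
      by_cases hk : k.val < n / 2
      · rw [ha i k hik (Or.inl hk), zero_mul]
      · rw [hb k j hkj (Or.inr (not_lt.1 hk)), mul_zero]
    intro a ha b hb
    refine mat_injective (Matrix.ext fun i j => ?_)
    rcases lt_trichotomy i j with hij | rfl | hij
    · rw [key a ha b hb i j hij, key b hb a ha i j hij, add_comm]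
    · rw [mat_diag, mat_diag]
    · rw [mat_lower _ hij, mat_lower _ hij])
  rw [index_zeroGroup, numPos_block] at h1
  rw [Representation.char_one] at he
  have h2 : Module.finrank ℂ (Fin d → ℂ) = Nat.card F ^ e := by exact_mod_cast he
  rw [h2] at h1
  exact (Nat.pow_le_pow_iff_right Finite.one_lt_card).1 h1

end Degrees

/-! ### Characters at the roots of a corner of the matrix

For `n = r + m + r`, the characters of `U_n(F)` over the linear characters of the upper right
`r × r` corner that are given by invertible diagonal matrices are parametrized by characters of
`U_r(F)` and `U_m(F)`. -/

section Average

/-- All fibres of a surjective homomorphism have the same size. -/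
theorem average_comp {K Q : Type*} [Group K] [Group Q] [Fintype K] [Fintype Q] (f : K →* Q)
    (hf : Function.Surjective f) (φ : Q → ℂ) :
    (Nat.card K : ℂ)⁻¹ * ∑ k, φ (f k) = (Nat.card Q : ℂ)⁻¹ * ∑ x, φ x := by
  classical
  have h1 : ∀ x, (Finset.univ.filter fun k => f k = x).card =
      (Finset.univ.filter fun k => f k = 1).card := fun x =>
    MonoidHom.card_fiber_eq_of_mem_range f (hf x) (hf 1)
  set c := (Finset.univ.filter fun k => f k = 1).card with hc
  have h2 : ∀ φ : Q → ℂ, ∑ k, φ (f k) = c * ∑ x, φ x := by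
    intro φ
    rw [← Finset.sum_fiberwise (s := Finset.univ) (g := f), Finset.mul_sum]
    refine Finset.sum_congr rfl fun x _ => ?_
    rw [Finset.sum_congr rfl (g := fun _ => φ x) fun k hk => by rw [(Finset.mem_filter.1 hk).2],
      Finset.sum_const, h1, nsmul_eq_mul]
  have h3 := h2 fun _ => 1
  simp only [Finset.sum_const, Finset.card_univ, nsmul_eq_mul, mul_one,
    ← Nat.card_eq_fintype_card] at h3
  have hK : (Nat.card K : ℂ) ≠ 0 := card_ne_zero_complex
  rw [h2, h3] at *
  have hc0 : (c : ℂ) ≠ 0 := left_ne_zero_of_mul hK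
  rw [mul_inv, mul_assoc, mul_left_comm, inv_mul_cancel_left₀ hc0]

end Average

section Corner

variable {n : ℕ} {F : Type*} [Field F] [Finite F]

theorem mat_diagBlock (k m : ℕ) (h : k + m ≤ n) (g : U n F) (i j : Fin m) :
    mat (diagBlock n F k m h g) i j =
      mat g ⟨k + i, by omega⟩ ⟨k + j, by omega⟩ := rfl

theorem diagBlock_eq_one (k m : ℕ) (h : k + m ≤ n) {g : U n F}
    (hg : ∀ i j : Fin n, i < j → j < k + m → k ≤ i.val → mat g i j = 0) :
    diagBlock n F k m h g = 1 := by
  refine mat_injective (Matrix.ext fun i j => ?_)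
  rw [map_one]
  rcases lt_trichotomy i j with hij | rfl | hij
  · rw [mat_diagBlock, Matrix.one_apply_ne hij.ne, hg]
    · exact Fin.lt_def.2 (Nat.add_lt_add_left hij k)
    · simp
    · simp
  · rw [mat_diag, Matrix.one_apply_eq]
  · rw [mat_lower _ hij, Matrix.one_apply_ne hij.ne']

theorem coClosed_corner (r m : ℕ) (n : ℕ) :
    CoClosed n fun i j => i < r ∧ r ≤ j ∧ j < m + r + i := by
  intro i j k hij hjk _ h
  omega

variable (r m : ℕ) (h : r + m + r = n)

variable (F n) in
/-- The matrices whose rows `< r` vanish at the columns from `r` to the diagonal of the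
upper right `r × r` corner. -/
def cornerGroup : Subgroup (U n F) := zeroGroup n F _ (coClosed_corner r m n)

theorem mem_cornerGroup {g : U n F} : g ∈ cornerGroup n F r m ↔
    ∀ i j : Fin n, i.val < r → r ≤ j.val → j < m + r + i → mat g i j = 0 := by
  refine mem_zeroGroup.trans ⟨fun hg i j h1 h2 h3 => hg i j (Fin.lt_def.2 (by omega)) ⟨h1, h2, h3⟩,
    fun hg i j _ hq => hg i j hq.1 hq.2.1 hq.2.2⟩

variable {r m}

/-- The linear form given by the diagonal of the upper right `r × r` corner. -/
def cornerForm (d : Fin r → F) (g : U n F) : F :=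
  ∑ i : Fin r, d i * mat g ⟨i, by omega⟩ ⟨m + r + i, by omega⟩

theorem cornerForm_mul (d : Fin r → F) {g g' : U n F} (hg : g ∈ cornerGroup n F r m)
    (hg' : g' ∈ cornerGroup n F r m) :
    cornerForm h d (g * g') = cornerForm h d g + cornerForm h d g' := by
  rw [mem_cornerGroup] at hg hg'
  rw [cornerForm, cornerForm, cornerForm, ← Finset.sum_add_distrib]
  refine Finset.sum_congr rfl fun i _ => ?_
  have hi := i.2
  rw [mat_mul_apply_of_forall, mul_add]
  · exact Fin.lt_def.2 (by simp only; omega)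
  · intro k hik hkj
    rw [Fin.lt_def] at hik hkj
    simp only at hik hkj
    -- Intermediate index in the top rows: the entry of g' in row k lies left of that row's corner
    -- diagonal, since i < k. Otherwise the entry of g in row i does.
    by_cases hk : k.val < r
    · rw [hg' k _ hk (by simp only; omega) (by simp only; omega), mul_zero]
    · rw [hg _ k (by simp) (not_lt.1 hk) (by simpa using hkj), zero_mul]

variable (ψ : AddChar F ℂ)

/-- The linear character of the corner group given by a linear form. -/
def cornerLin (d : Fin r → F) : cornerGroup n F r m →* ℂ where
  toFun g := ψ (cornerForm h d g)
  map_one' := by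
    have := cornerForm_mul h d (cornerGroup n F r m).one_mem (cornerGroup n F r m).one_mem
    rw [one_mul, left_eq_add] at this
    rw [OneMemClass.coe_one, this, AddChar.map_zero_eq_one]
  map_mul' g g' := by
    rw [Subgroup.coe_mul, cornerForm_mul h d g.2 g'.2, AddChar.map_add_eq_mul]

/-- The character `λ^U σ η`, for `λ` a linear character of the corner group and `σ`, `η` functions on
the first two diagonal blocks. -/
def cornerChar (d : Fin r → F) (σ : U r F → ℂ) (η : U m F → ℂ) : U n F → ℂ :=
  inducedChar (cornerGroup n F r m) (cornerLin h ψ d) * (σ ∘ diagBlock n F 0 r (by omega)) *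
    (η ∘ diagBlock n F r m (by omega))

variable {σ σ' : U r F → ℂ} {η η' : U m F → ℂ} {d d' : Fin r → F}

theorem isChar_cornerChar (hσ : IsChar σ) (hη : IsChar η) : IsChar (cornerChar h ψ d σ η) :=
  ((isChar_inducedChar _ (cornerLin h ψ d).toHomUnits).mul (hσ.comp _)).mul (hη.comp _)

theorem cornerChar_one :
    cornerChar h ψ d σ η 1 = (cornerGroup n F r m).index * σ 1 * η 1 := by
  simp only [cornerChar, Pi.mul_apply, inducedChar_one, Function.comp_apply, map_one, mul_one]

theorem cornerChar_eq_inducedChar (hσ : IsChar σ) (hη : IsChar η) :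
    cornerChar h ψ d σ η = inducedChar (cornerGroup n F r m) fun k => cornerLin h ψ d k *
      σ (diagBlock n F 0 r (by omega) k) * η (diagBlock n F r m (by omega) k) := by
  rw [cornerChar, inducedChar_mul _ _ _ fun g x => (hσ.comp _).conj g x,
    inducedChar_mul _ _ _ fun g x => (hη.comp _).conj g x]
  rfl

theorem exists_blocks (a : U r F) (b : U m F) : ∃ g ∈ cornerGroup n F r m,
    diagBlock n F 0 r (by omega) g = a ∧ diagBlock n F r m (by omega) g = b := by
  obtain ⟨g, hg⟩ := exists_mat_eq (n := n) (F := F) (fun i j =>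
    if h1 : i.val < r ∧ j.val < r then mat a ⟨i, h1.1⟩ ⟨j, h1.2⟩ else
      if h2 : r ≤ i.val ∧ i.val < r + m ∧ r ≤ j.val ∧ j.val < r + m then
        mat b ⟨i - r, by omega⟩ ⟨j - r, by omega⟩ else if i = j then 1 else 0) (by
      intro i j hij
      split_ifs with h1 h2 h3
      · exact mat_lower _ hij
      · exact mat_lower _ (Fin.lt_def.2 (by rw [Fin.lt_def] at hij; simp only; omega))
      · exact absurd h3 hij.ne'
      · rfl) (by
      intro i
      split_ifs with h1 h2 h3
      · exact mat_diag _ _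
      · exact mat_diag _ _
      · rfl
      · exact absurd rfl h3)
  refine ⟨g, (mem_cornerGroup r m).2 fun i j hi hj hij => ?_, ?_, ?_⟩
  · rw [hg]
    simp only
    rw [dif_neg (by omega), dif_neg (by omega), if_neg]
    rintro rfl
    omega
  · refine mat_injective (Matrix.ext fun i j => ?_)
    rw [mat_diagBlock, hg]
    simp
  · refine mat_injective (Matrix.ext fun i j => ?_)
    rw [mat_diagBlock, hg]
    simp

theorem cornerForm_of_single (d : Fin r → F) (i : Fin r) (c : F) {u : U n F}
    (hu : mat u = 1 + Matrix.single ⟨i, by omega⟩ ⟨m + r + i, by omega⟩ c) :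
    cornerForm h d u = d i * c := by
  rw [cornerForm, Finset.sum_eq_single i]
  · rw [hu, Matrix.add_apply, Matrix.one_apply_ne, Matrix.single_apply_same, zero_add]
    simp only [ne_eq, Fin.mk.injEq]
    have := i.2
    omega
  · intro j _ hj
    rw [hu, Matrix.add_apply, Matrix.one_apply_ne, Matrix.single_apply_of_ne, add_zero, mul_zero]
    · simp only [Fin.mk.injEq, not_and]
      intro hij
      exact absurd (Fin.ext hij.symm) hj
    · simp only [ne_eq, Fin.mk.injEq]
      have := j.2
      omega
  · simp

variable {ψ}

/-- The Mackey condition for the corner group. -/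
theorem exists_separating (hψ : ψ.IsPrimitive) (hd' : ∀ i, d' i ≠ 0) {x : U n F}
    (hx : x ∉ cornerGroup n F r m) : ∃ u v : cornerGroup n F r m, x⁻¹ * u * x = v ∧
      cornerLin h ψ d u = 1 ∧ cornerLin h ψ d' v ≠ 1 ∧
      diagBlock n F 0 r (by omega) u = 1 ∧ diagBlock n F r m (by omega) u = 1 := by
  classical
  have hy : x⁻¹ ∉ cornerGroup n F r m := fun h => hx (inv_inv x ▸ Subgroup.inv_mem _ h)
  have hne : ((Finset.univ : Finset (Fin n × Fin n)).filter fun p => p.1.val < r ∧ r ≤ p.2.val ∧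
      p.2 < m + r + p.1 ∧ mat x⁻¹ p.1 p.2 ≠ 0).Nonempty := by
    rw [mem_cornerGroup] at hy
    push Not at hy
    obtain ⟨i, j, h1, h2, h3, h4⟩ := hy
    exact ⟨(i, j), by simpa using ⟨h1, h2, h3, h4⟩⟩
  -- Take a forbidden nonzero entry (i, j) of x⁻¹ in the lowest possible row, and u = 1 + c e_{jl}
  -- with l the corner column of row i. Conjugation gives 1 plus c times column j of x⁻¹ times row l
  -- of x; maximality of i and triangularity of x leave only d'_i (x⁻¹)_{ij} c in the corner form.
  obtain ⟨⟨i, j⟩, hij, hmax⟩ := Finset.exists_max_image _ (fun p => p.1) hne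
  simp only [Finset.mem_filter, Finset.mem_univ, true_and] at hij
  obtain ⟨hi, hj, hij, hij0⟩ := hij
  have hbig : ∀ a : Fin n, i < a → a.val < r → mat x⁻¹ a j = 0 := by
    intro a ha har
    by_contra h0
    rw [Fin.lt_def] at ha
    have := hmax (a, j) (by simpa using ⟨har, hj, by omega, h0⟩)
    rw [Fin.le_def] at this
    simp only at this
    omega
  let l : Fin n := ⟨m + r + i, by omega⟩
  have hjl : j < l := Fin.lt_def.2 hij
  obtain ⟨c, hc⟩ : ∃ c, ψ (d' ⟨i, hi⟩ * mat x⁻¹ i j * c) ≠ 1 :=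
    AddChar.ne_one_iff.1 (hψ (mul_ne_zero (hd' ⟨i, hi⟩) hij0))
  obtain ⟨u, hu⟩ := exists_mat_eq_single hjl c
  have hu' : ∀ a b : Fin n, a ≠ b → ¬ (a = j ∧ b = l) → mat u a b = 0 := by
    intro a b hab habl
    rw [hu, Matrix.add_apply, Matrix.one_apply_ne hab, Matrix.single_apply_of_ne, add_zero]
    rintro ⟨rfl, rfl⟩
    exact habl ⟨rfl, rfl⟩
  have huK : u ∈ cornerGroup n F r m := by
    rw [mem_cornerGroup]
    intro a b ha hb hab
    refine hu' a b (fun h => by rw [h] at ha; omega) ?_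
    rintro ⟨rfl, rfl⟩
    omega
  have hv : ∀ a b : Fin n, mat (x⁻¹ * u * x) a b =
      (if a = b then 1 else 0) + mat x⁻¹ a j * c * mat x l b := by
    intro a b
    rw [map_mul, map_mul, hu, mul_add, mul_one, add_mul, ← map_mul, inv_mul_cancel, map_one,
      Matrix.add_apply, Matrix.one_apply]
    congr 1
    rw [Matrix.mul_apply, Finset.sum_eq_single l]
    · rw [Matrix.mul_single_apply_same]
    · intro k _ hk
      rw [Matrix.mul_single_apply_of_ne _ _ _ _ _ hk, zero_mul]
    · simp
  have hvK : x⁻¹ * u * x ∈ cornerGroup n F r m := by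
    rw [mem_cornerGroup]
    intro a b ha hb hab
    rw [hv, if_neg (fun h => by rw [h] at ha; omega), zero_add]
    rcases le_or_gt a i with hai | hai
    · rw [Fin.le_def] at hai
      rw [mat_lower x (Fin.lt_def.2 (show b.val < m + r + i by omega)), mul_zero]
    · rw [hbig a hai ha, zero_mul, zero_mul]
  refine ⟨⟨u, huK⟩, ⟨_, hvK⟩, rfl, ?_, ?_, ?_, ?_⟩
  · change ψ (cornerForm h d u) = 1
    rw [cornerForm, Finset.sum_eq_zero, AddChar.map_zero_eq_one]
    intro a _
    have ha := a.2
    rw [hu', mul_zero]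
    · simp only [ne_eq, Fin.mk.injEq]
      omega
    · rintro ⟨h1, -⟩
      rw [← h1] at hj
      simp only at hj
      omega
  · change ψ (cornerForm h d' (x⁻¹ * u * x)) ≠ 1
    rw [cornerForm, Finset.sum_eq_single ⟨i, hi⟩]
    · rw [hv, if_neg]
      · simp only [Fin.eta, zero_add]
        change ψ (d' ⟨i, hi⟩ * (mat x⁻¹ i j * c * mat x l l)) ≠ 1
        rwa [mat_diag, mul_one, ← mul_assoc]
      · simp only [Fin.mk.injEq]
        omega
    · intro a _ ha
      have har := a.2
      have ha' : a.val ≠ i.val := fun h => ha (Fin.ext h)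
      rw [hv, if_neg (by simp only [Fin.mk.injEq]; omega), zero_add]
      rcases lt_or_gt_of_ne ha' with hlt | hgt
      · rw [mat_lower x (Fin.lt_def.2 (show m + r + a.val < m + r + i by omega)), mul_zero, mul_zero]
      · rw [hbig ⟨a, by omega⟩ (Fin.lt_def.2 hgt) har, zero_mul, zero_mul, mul_zero]
    · simp
  · refine diagBlock_eq_one _ _ _ fun a b hab hb _ => hu' a b hab.ne ?_
    rintro ⟨rfl, rfl⟩
    rw [Fin.lt_def] at hab
    omega
  · refine diagBlock_eq_one _ _ _ fun a b hab hb _ => hu' a b hab.ne ?_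
    rintro ⟨rfl, rfl⟩
    simp only [l] at hb
    omega

/-- Only the trivial double coset of K contributes. If d = d' the linear characters cancel and the
average over K becomes one over U_r × U_m; otherwise it vanishes by translation along a corner root
subgroup on which the two linear characters differ. -/
theorem multiplicity_in_cornerChar [DecidableEq F] (hψ : ψ.IsPrimitive) (hσ : IsChar σ)
    (hη : IsChar η) (hσ' : IsChar σ') (hη' : IsChar η') (hd' : ∀ i, d' i ≠ 0) :
    multiplicity_in (cornerChar h ψ d' σ' η') (cornerChar h ψ d σ η) =
      if d = d' then multiplicity_in σ' σ * multiplicity_in η' η else 0 := by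
  cases nonempty_fintype (U n F)
  cases nonempty_fintype (U r F)
  cases nonempty_fintype (U m F)
  cases nonempty_fintype (cornerGroup n F r m)
  rw [cornerChar_eq_inducedChar h ψ hσ hη, cornerChar_eq_inducedChar h ψ hσ' hη',
    multiplicity_in_inducedChar, finsum_eq_sum_of_fintype]
  rotate_left
  · intro k x
    have hl : cornerLin h ψ d' (x⁻¹ * k * x) = cornerLin h ψ d' k := by
      rw [mul_assoc, map_mul, map_mul, mul_left_comm, ← map_mul, inv_mul_cancel, map_one, mul_one]
    rw [hl]
    congr 1
    · congr 1
      exact (hσ'.comp (diagBlock n F 0 r (by omega))).conj k.1 x.1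
    · exact (hη'.comp (diagBlock n F r m (by omega))).conj k.1 x.1
  · intro x hx
    obtain ⟨u, v, huv, h1, h2, h3, h4⟩ := exists_separating h (d := d) hψ hd' hx
    refine ⟨u, v, 1, cornerLin h ψ d' v, h2.symm, huv, fun k => ?_, fun k => ?_⟩
    · rw [Subgroup.coe_mul, map_mul, map_mul, map_mul, h1, h3, h4, mul_one, mul_one, mul_one,
        one_mul]
    · have h5 : diagBlock n F 0 r (by omega) (v : U n F) = 1 := by
        rw [← huv, map_mul, map_mul, h3, mul_one, ← map_mul, inv_mul_cancel, map_one]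
      have h6 : diagBlock n F r m (by omega) (v : U n F) = 1 := by
        rw [← huv, map_mul, map_mul, h4, mul_one, ← map_mul, inv_mul_cancel, map_one]
      rw [Subgroup.coe_mul, map_mul (diagBlock n F 0 r _), map_mul (diagBlock n F r m _),
        Subgroup.coe_inv, map_inv, map_inv, h5, h6, inv_one, one_mul, inv_one, one_mul,
        ← mul_assoc, ← mul_assoc, ← map_mul, mul_inv_cancel_left]
  split_ifs with hdd
  · subst hdd
    let π : cornerGroup n F r m →* U r F × U m F :=
      ((diagBlock n F 0 r (by omega)).prod (diagBlock n F r m (by omega))).comp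
        (cornerGroup n F r m).subtype
    have hπ : Function.Surjective π := by
      rintro ⟨a, b⟩
      obtain ⟨g, hg, h1, h2⟩ := exists_blocks h a b
      exact ⟨⟨g, hg⟩, Prod.ext h1 h2⟩
    have := average_comp π hπ fun p => (σ p.1 * σ' p.1⁻¹) * (η p.2 * η' p.2⁻¹)
    rw [multiplicity_in_eq_sum, multiplicity_in_eq_sum, mul_mul_mul_comm, Finset.sum_mul_sum,
      ← Finset.sum_product', ← mul_inv, Finset.univ_product_univ]
    rw [Nat.card_prod] at this
    push_cast at this
    rw [← this]
    congr 1
    refine Finset.sum_congr rfl fun k _ => ?_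
    have h1 : cornerLin h ψ d k * cornerLin h ψ d k⁻¹ = 1 := by
      rw [← map_mul, mul_inv_cancel, map_one]
    have h2 : (π k).1⁻¹ = diagBlock n F 0 r (by omega) (k⁻¹ : cornerGroup n F r m) := by
      rw [Subgroup.coe_inv, map_inv]
      rfl
    have h3 : (π k).2⁻¹ = diagBlock n F r m (by omega) (k⁻¹ : cornerGroup n F r m) := by
      rw [Subgroup.coe_inv, map_inv]
      rfl
    rw [h2, h3]
    change _ = σ (diagBlock n F 0 r _ k) * _ * (η (diagBlock n F r m _ k) * _)
    linear_combination (σ (diagBlock n F 0 r (by omega) k) *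
      η (diagBlock n F r m (by omega) k) *
      σ' (diagBlock n F 0 r (by omega) (k⁻¹ : cornerGroup n F r m)) *
      η' (diagBlock n F r m (by omega) (k⁻¹ : cornerGroup n F r m))) * h1
  · obtain ⟨i, hi⟩ := Function.ne_iff.1 hdd
    obtain ⟨c, hc⟩ : ∃ c, ψ ((d i - d' i) * c) ≠ 1 :=
      AddChar.ne_one_iff.1 (hψ (sub_ne_zero.2 hi))
    have hil : (⟨i, by omega⟩ : Fin n) < ⟨m + r + i, by omega⟩ := Fin.lt_def.2 (by
      have := i.2
      simp only
      omega)
    -- This element is trivial in both diagonal blocks, so only the linear characters see it.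
    obtain ⟨t, ht⟩ := exists_mat_eq_single hil c
    have ht' : ∀ a b : Fin n, a ≠ b → ¬ (a.val = i ∧ b.val = m + r + i) → mat t a b = 0 := by
      intro a b hab habl
      rw [ht, Matrix.add_apply, Matrix.one_apply_ne hab, Matrix.single_apply_of_ne, add_zero]
      rintro ⟨rfl, rfl⟩
      exact habl ⟨rfl, rfl⟩
    have htK : t ∈ cornerGroup n F r m := by
      rw [mem_cornerGroup]
      intro a b ha hb hab
      exact ht' a b (fun h => by rw [h] at ha; omega) (by omega)
    have h3 : diagBlock n F 0 r (by omega) t = 1 :=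
      diagBlock_eq_one _ _ _ fun a b hab hb _ => ht' a b hab.ne (by omega)
    have h4 : diagBlock n F r m (by omega) t = 1 :=
      diagBlock_eq_one _ _ _ fun a b hab hb _ => ht' a b hab.ne (by omega)
    let T : cornerGroup n F r m := ⟨t, htK⟩
    have h5 : cornerLin h ψ d T * cornerLin h ψ d' T⁻¹ = ψ ((d i - d' i) * c) := by
      have e1 : cornerLin h ψ d T = ψ (d i * c) := congrArg ψ (cornerForm_of_single h d i c ht)
      have e2 : cornerLin h ψ d' T = ψ (d' i * c) := congrArg ψ (cornerForm_of_single h d' i c ht)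
      have e3 : cornerLin h ψ d' T * cornerLin h ψ d' T⁻¹ = 1 := by
        rw [← map_mul, mul_inv_cancel, map_one]
      rw [e1, sub_mul, AddChar.map_sub_eq_div, ← e2, eq_div_iff (left_ne_zero_of_mul_eq_one e3),
        mul_assoc, mul_comm _ (cornerLin h ψ d' T), e3, mul_one]
    refine mul_eq_zero_of_right _ ?_
    set f : cornerGroup n F r m → ℂ := fun k => cornerLin h ψ d k *
      σ (diagBlock n F 0 r (by omega) k) * η (diagBlock n F r m (by omega) k) *
      (cornerLin h ψ d' k⁻¹ *
      σ' (diagBlock n F 0 r (by omega) (k⁻¹ : cornerGroup n F r m)) *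
      η' (diagBlock n F r m (by omega) (k⁻¹ : cornerGroup n F r m))) with hf
    have h6 : ∀ k, f (k * T) = ψ ((d i - d' i) * c) * f k := by
      intro k
      rw [← h5]
      simp only [hf, mul_inv_rev, map_mul, Subgroup.coe_mul, Subgroup.coe_inv, map_inv, T, h3, h4, mul_one]

      ring
    have h7 : ∑ k, f k = ψ ((d i - d' i) * c) * ∑ k, f k := by
      rw [Finset.mul_sum]
      refine (Fintype.sum_equiv (Equiv.mulRight T) _ _ fun k => ?_).symm
      rw [Equiv.coe_mulRight, h6]
    by_contra h0
    exact hc ((mul_eq_right₀ h0).1 h7.symm)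

theorem isIrrChar_cornerChar (hψ : ψ.IsPrimitive) (hσ : IsIrrChar σ) (hη : IsIrrChar η)
    (hd : ∀ i, d i ≠ 0) : IsIrrChar (cornerChar h ψ d σ η) := by
  classical
  refine (isChar_cornerChar h ψ hσ.isChar hη.isChar).isIrrChar ?_
  rw [multiplicity_in_cornerChar h hψ hσ.isChar hη.isChar hσ.isChar hη.isChar hd, if_pos rfl,
    multiplicity_in_irr hσ hσ, multiplicity_in_irr hη hη, if_pos rfl, if_pos rfl, one_mul]

theorem cornerChar_injective (hψ : ψ.IsPrimitive) (hσ : IsIrrChar σ) (hη : IsIrrChar η)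
    (hσ' : IsIrrChar σ') (hη' : IsIrrChar η') (hd : ∀ i, d i ≠ 0) (hd' : ∀ i, d' i ≠ 0)
    (heq : cornerChar h ψ d σ η = cornerChar h ψ d' σ' η') : d = d' ∧ σ = σ' ∧ η = η' := by
  classical
  have h1 := multiplicity_in_irr (isIrrChar_cornerChar h hψ hσ' hη' hd')
    (isIrrChar_cornerChar h hψ hσ hη hd)
  rw [multiplicity_in_cornerChar h hψ hσ.isChar hη.isChar hσ'.isChar hη'.isChar hd',
    if_pos heq.symm, multiplicity_in_irr hσ' hσ, multiplicity_in_irr hη' hη] at h1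
  split_ifs at h1 with h2 h3 h4
  · exact ⟨h2, h3.symm, h4.symm⟩
  all_goals simp at h1

-- Row i of the top r rows is constrained in the columns r, …, m + r + i - 1, which are m + i
-- positions.
include h in
theorem numPos_corner :
    numPos n (fun i j => i < r ∧ r ≤ j ∧ j < m + r + i) = ∑ i ∈ Finset.range r, (m + i) := by
  classical
  have hrow : ∀ i ∈ Finset.range n, ((Finset.range n).filter
      fun j => i < j ∧ i < r ∧ r ≤ j ∧ j < m + r + i).card = if i < r then m + i else 0 := by
    intro i _
    split_ifs with hi
    · refine (congrArg Finset.card ?_).trans ((Nat.card_Ico r (m + r + i)).trans (by omega))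
      ext j
      simp only [Finset.mem_filter, Finset.mem_range, Finset.mem_Ico]
      omega
    · refine (congrArg Finset.card ?_).trans Finset.card_empty
      ext j
      simp only [Finset.mem_filter, Finset.mem_range, Finset.notMem_empty, iff_false]
      omega
  rw [numPos_eq_sum_rows, Finset.sum_congr rfl hrow, ← Finset.sum_filter]
  congr 1
  ext i
  simp only [Finset.mem_filter, Finset.mem_range]
  omega

include h in
theorem index_cornerGroup :
    (cornerGroup n F r m).index = Nat.card F ^ ∑ i ∈ Finset.range r, (m + i) := by
  rw [cornerGroup, index_zeroGroup, numPos_corner h]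

end Corner

/-! ### The three highest degrees -/

section Highest

theorem isIrrChar_monoidHom {G : Type*} [Group G] [Finite G] (l : G →* ℂˣ) :
    IsIrrChar (fun g => (l g : ℂ)) := by
  cases nonempty_fintype G
  refine (isChar_monoidHom l).isIrrChar ?_
  rw [multiplicity_in_eq_sum, Finset.sum_congr rfl (g := fun _ => (1 : ℂ)) fun g _ => by
    rw [← Units.val_mul, ← map_mul, mul_inv_cancel, map_one, Units.val_one]]
  simp only [Finset.sum_const, Finset.card_univ, nsmul_eq_mul, mul_one,
    ← Nat.card_eq_fintype_card]
  exact inv_mul_cancel₀ card_ne_zero_complex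

theorem isIrrChar_one {G : Type*} [Group G] [Finite G] : IsIrrChar (1 : G → ℂ) :=
  isIrrChar_monoidHom (1 : G →* ℂˣ)

variable {n : ℕ} {F : Type*} [Field F] [Finite F]

theorem exists_isPrimitive (F : Type*) [Field F] [Finite F] :
    ∃ ψ : AddChar F ℂ, ψ.IsPrimitive :=
  ⟨_, AddChar.FiniteField.primitiveChar_to_Complex_isPrimitive F⟩

-- The corner construction with r = 1, iterated on the middle block, reaches the abelian bound.
variable (F) in
theorem exists_degree_muDeg (n : ℕ) :
    ∃ χ : U n F → ℂ, IsIrrChar χ ∧ χ 1 = (Nat.card F : ℂ) ^ muDeg n := by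
  obtain ⟨ψ, hψ⟩ := exists_isPrimitive F
  induction n using Nat.strong_induction_on with
  | _ n ih =>
    rcases n with _ | _ | n
    · exact ⟨1, isIrrChar_one, by simp [muDeg]⟩
    · exact ⟨1, isIrrChar_one, by simp [muDeg]⟩
    · obtain ⟨η, hη, hη1⟩ := ih n (by omega)
      have h : 1 + n + 1 = n + 2 := by omega
      refine ⟨cornerChar h ψ (fun _ => 1) 1 η,
        isIrrChar_cornerChar h hψ isIrrChar_one hη fun _ => one_ne_zero, ?_⟩
      rw [cornerChar_one, index_cornerGroup h, hη1, muDeg_add_two]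
      simp [pow_add, mul_comm]

-- With r = 2 and σ trivial the corner group has index q^{2m+1}, one power short of the 2m + 2 that
-- separates the maximal exponents for m and m + 4.
variable (F) in
theorem exists_degree_muDeg_sub_one (hn : 4 ≤ n) :
    ∃ χ : U n F → ℂ, IsIrrChar χ ∧ χ 1 = (Nat.card F : ℂ) ^ (muDeg n - 1) := by
  obtain ⟨ψ, hψ⟩ := exists_isPrimitive F
  obtain ⟨m, rfl⟩ := Nat.exists_eq_add_of_le' hn
  obtain ⟨η, hη, hη1⟩ := exists_degree_muDeg F m
  have h : 2 + m + 2 = m + 4 := by omega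
  refine ⟨cornerChar h ψ (fun _ => 1) 1 η,
    isIrrChar_cornerChar h hψ isIrrChar_one hη fun _ => one_ne_zero, ?_⟩
  rw [cornerChar_one, index_cornerGroup h, hη1, muDeg_add_two (m + 2), muDeg_add_two m]
  simp only [Finset.sum_range_succ, Finset.range_zero, Finset.sum_empty, Pi.one_apply, mul_one]
  push_cast
  rw [← pow_add]
  congr 1
  omega

theorem isHighestDegree_iff {χ : U n F → ℂ} :
    IsHighestDegree χ ↔ IsIrrChar χ ∧ χ 1 = (Nat.card F : ℂ) ^ muDeg n := by
  constructor
  · rintro ⟨hχ, d, hd, hmax⟩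
    refine ⟨hχ, ?_⟩
    obtain ⟨ξ, hξ, hξ1⟩ := exists_degree_muDeg F n
    obtain ⟨e, he, he1⟩ := hχ.exists_degree_le
    have h1 := hmax (Nat.card F ^ muDeg n) ⟨ξ, hξ, by rw [hξ1]; push_cast; rfl⟩
    have h2 : d = Nat.card F ^ e := by
      rw [hd] at he1
      exact_mod_cast he1
    rw [h2] at h1
    have h3 := (Nat.pow_le_pow_iff_right Finite.one_lt_card).1 h1
    rw [he1, le_antisymm he h3]
  · rintro ⟨hχ, hχ1⟩
    refine ⟨hχ, Nat.card F ^ muDeg n, by rw [hχ1]; push_cast; rfl, ?_⟩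
    rintro e ⟨ξ, hξ, hξ1⟩
    obtain ⟨k, hk, hk1⟩ := hξ.exists_degree_le
    have h2 : e = Nat.card F ^ k := by
      rw [hξ1] at hk1
      exact_mod_cast hk1
    rw [h2]
    exact Nat.pow_le_pow_right Nat.card_pos hk

/-- Degrees are powers of q with exponent at most μ(n), so only the exponents μ(n) and μ(n) - 1 can
lie above, and both occur. -/
theorem isThirdHighestDegree_of_degree (hn : 4 ≤ n) {χ : U n F → ℂ} (hχ : IsIrrChar χ)
    (h1 : χ 1 = (Nat.card F ^ (muDeg n - 2) : ℕ)) : IsThirdHighestDegree χ := by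
  refine ⟨hχ, _, h1, ?_⟩
  have hq : 1 < Nat.card F := Finite.one_lt_card
  have hmu : 2 ≤ muDeg n := by
    obtain ⟨m, rfl⟩ := Nat.exists_eq_add_of_le' hn
    rw [muDeg_add_two (m + 2)]
    omega
  have hset : {e ∈ charDegrees (U n F) | Nat.card F ^ (muDeg n - 2) < e} =
      {Nat.card F ^ (muDeg n - 1), Nat.card F ^ muDeg n} := by
    ext e
    simp only [Set.mem_ofPred_eq, Set.mem_insert_iff, Set.mem_singleton_iff]
    constructor
    · rintro ⟨⟨ξ, hξ, hξ1⟩, he⟩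
      obtain ⟨k, hk, hk1⟩ := hξ.exists_degree_le
      have h2 : e = Nat.card F ^ k := by
        rw [hξ1] at hk1
        exact_mod_cast hk1
      rw [h2] at he ⊢
      have h3 := (Nat.pow_lt_pow_iff_right hq).1 he
      rcases (show k = muDeg n - 1 ∨ k = muDeg n by omega) with rfl | rfl
      · exact Or.inl rfl
      · exact Or.inr rfl
    · rintro (rfl | rfl)
      · obtain ⟨ξ, hξ, hξ1⟩ := exists_degree_muDeg_sub_one F hn
        exact ⟨⟨ξ, hξ, by rw [hξ1]; push_cast; rfl⟩, Nat.pow_lt_pow_right hq (by omega)⟩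
      · obtain ⟨ξ, hξ, hξ1⟩ := exists_degree_muDeg F n
        exact ⟨⟨ξ, hξ, by rw [hξ1]; push_cast; rfl⟩, Nat.pow_lt_pow_right hq (by omega)⟩
  rw [hset, Set.ncard_pair]
  exact (Nat.pow_lt_pow_right hq (by omega)).ne

end Highest

/-! ### The characters of `U_3(F)` -/

section UThree

variable {F : Type*} [Field F] [Finite F] (ψ : AddChar F ℂ)

theorem mat_mul_zero_one (g h : U 3 F) : mat (g * h) 0 1 = mat g 0 1 + mat h 0 1 :=
  mat_mul_apply_of_forall g h (by decide) fun k h1 h2 => by omega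

theorem mat_mul_one_two (g h : U 3 F) : mat (g * h) 1 2 = mat g 1 2 + mat h 1 2 :=
  mat_mul_apply_of_forall g h (by decide) fun k h1 h2 => by omega

theorem mat_mul_zero_two (g h : U 3 F) :
    mat (g * h) 0 2 = mat g 0 2 + mat g 0 1 * mat h 1 2 + mat h 0 2 := by
  rw [mat_mul_apply, Fin.sum_univ_three, mat_diag, mat_diag]
  ring

theorem uThree_ext {g h : U 3 F} (h1 : mat g 0 1 = mat h 0 1) (h2 : mat g 1 2 = mat h 1 2)
    (h3 : mat g 0 2 = mat h 0 2) : g = h := by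
  refine mat_injective (Matrix.ext fun i j => ?_)
  rcases lt_trichotomy i j with hij | rfl | hij
  · fin_cases i <;> fin_cases j <;> first | assumption | exact absurd hij (by decide)
  · rw [mat_diag, mat_diag]
  · rw [mat_lower _ hij, mat_lower _ hij]

/-- The linear characters of `U_3(F)`. -/
def uThreeLin (p : F × F) : U 3 F →* ℂˣ :=
  MonoidHom.toHomUnits
    { toFun := fun g => ψ (p.1 * mat g 0 1 + p.2 * mat g 1 2)
      map_one' := by simp
      map_mul' := fun g h => by
        rw [mat_mul_zero_one, mat_mul_one_two, ← AddChar.map_add_eq_mul]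
        congr 1
        ring }

theorem uThreeLin_apply (p : F × F) (g : U 3 F) :
    (uThreeLin ψ p g : ℂ) = ψ (p.1 * mat g 0 1 + p.2 * mat g 1 2) := rfl

/-- The characters of degree `q` of `U_3(F)`. -/
def uThreeChar (c : F) : U 3 F → ℂ := cornerChar (show 1 + 1 + 1 = 3 from rfl) ψ (fun _ => c) 1 1

theorem inducedChar_mul_central {G : Type*} [Group G] [Finite G] (K : Subgroup G) (f : K → ℂ)
    (z : K) (hz : ∀ g : G, g * z = z * g) (a : ℂ) (hf : ∀ k, f (k * z) = a * f k) (g : G) :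
    inducedChar K f (g * z) = a * inducedChar K f g := by
  cases nonempty_fintype G
  rw [inducedChar_eq_sum, inducedChar_eq_sum, mul_left_comm]
  congr 1
  rw [Finset.mul_sum]
  refine Finset.sum_congr rfl fun x _ => ?_
  have e : x⁻¹ * (g * z) * x = x⁻¹ * g * x * z := by
    rw [mul_assoc (x⁻¹ * g), hz x]
    group
  rw [e]
  by_cases h : x⁻¹ * g * x ∈ K
  · rw [zeroExt_of_mem f h, zeroExt_of_mem f (K.mul_mem h z.2)]
    exact hf ⟨_, h⟩
  · rw [zeroExt_of_notMem f h, zeroExt_of_notMem f, mul_zero]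
    rwa [K.mul_mem_cancel_right z.2]

theorem uThreeChar_mul_central (c s : F) {z : U 3 F} (hz : mat z = 1 + Matrix.single 0 2 s)
    (g : U 3 F) : uThreeChar ψ c (g * z) = ψ (c * s) * uThreeChar ψ c g := by
  have z1 : mat z 0 1 = 0 := by simp [hz]
  have z2 : mat z 1 2 = 0 := by simp [hz]
  have hzK : z ∈ cornerGroup 3 F 1 1 := by
    rw [mem_cornerGroup]
    intro i j hi hj hij
    obtain rfl : i = 0 := Fin.ext (by simpa using hi)
    obtain rfl : j = 1 := Fin.ext (by simp at hij hj ⊢; omega)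
    exact z1
  have e : uThreeChar ψ c = inducedChar (cornerGroup 3 F 1 1)
      (cornerLin (show 1 + 1 + 1 = 3 from rfl) ψ fun _ => c) := by
    ext g
    simp [uThreeChar, cornerChar]
  rw [e]
  refine inducedChar_mul_central _ _ ⟨z, hzK⟩ (fun g => ?_) _ (fun k => ?_) g
  · apply uThree_ext
    · simp only [mat_mul_zero_one, z1]
      ring
    · simp only [mat_mul_one_two, z2]
      ring
    · simp only [mat_mul_zero_two, z1, z2]
      ring
  · rw [map_mul, mul_comm]
    congr 1
    refine congrArg ψ ?_
    exact cornerForm_of_single (show 1 + 1 + 1 = 3 from rfl) (fun _ => c) 0 s hz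

theorem uThreeChar_one (c : F) : uThreeChar ψ c 1 = Nat.card F := by
  rw [uThreeChar, cornerChar_one, index_cornerGroup (show 1 + 1 + 1 = 3 from rfl)]
  simp

theorem uThreeChar_conj (c : F) (g x : U 3 F) : uThreeChar ψ c (x⁻¹ * g * x) = uThreeChar ψ c g :=
  (isChar_cornerChar _ ψ isIrrChar_one.isChar isIrrChar_one.isChar).conj g x

variable {ψ}

/-- On the centre the character is its degree times a linear character. A noncentral g is conjugate
to gz with z central and ψ(cs) ≠ 1, so the value there is 0. -/
theorem uThreeChar_apply [DecidableEq F] (hψ : ψ.IsPrimitive) {c : F} (hc : c ≠ 0) (g : U 3 F) :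
    uThreeChar ψ c g =
      if mat g 0 1 = 0 ∧ mat g 1 2 = 0 then Nat.card F * ψ (c * mat g 0 2) else 0 := by
  split_ifs with h
  · obtain ⟨z, hz⟩ := exists_mat_eq_single (show (0 : Fin 3) < 2 by decide) (mat g 0 2)
    have : g = 1 * z := by
      rw [one_mul]
      apply uThree_ext <;> simp [hz, h.1, h.2]
    conv_lhs => rw [this]
    rw [uThreeChar_mul_central ψ c _ hz, uThreeChar_one, mul_comm]
  · have key : ∃ (s : F) (z t : U 3 F), ψ (c * s) ≠ 1 ∧ mat z = 1 + Matrix.single 0 2 s ∧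
        g * t = t * (g * z) := by
      by_cases h1 : mat g 0 1 = 0
      · have h2 : mat g 1 2 ≠ 0 := fun h2 => h ⟨h1, h2⟩
        obtain ⟨p, hp⟩ := AddChar.ne_one_iff.1 (hψ (mul_ne_zero hc (neg_ne_zero.2 h2)))
        obtain ⟨z, hz⟩ := exists_mat_eq_single (show (0 : Fin 3) < 2 by decide) (-(p * mat g 1 2))
        obtain ⟨t, ht⟩ := exists_mat_eq_single (show (0 : Fin 3) < 1 by decide) p
        refine ⟨_, z, t, ?_, hz, ?_⟩
        · rw [AddChar.mulShift_apply] at hp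
          rwa [show c * -(p * mat g 1 2) = c * -mat g 1 2 * p by ring]
        · apply uThree_ext
          · simp [mat_mul_zero_one, hz, ht, add_comm]
          · simp [mat_mul_one_two, hz, ht]
          · simp [mat_mul_zero_two, mat_mul_one_two, hz, ht, h1]
      · obtain ⟨p, hp⟩ := AddChar.ne_one_iff.1 (hψ (mul_ne_zero hc h1))
        obtain ⟨z, hz⟩ := exists_mat_eq_single (show (0 : Fin 3) < 2 by decide) (mat g 0 1 * p)
        obtain ⟨t, ht⟩ := exists_mat_eq_single (show (1 : Fin 3) < 2 by decide) p
        refine ⟨_, z, t, ?_, hz, ?_⟩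
        · rwa [AddChar.mulShift_apply, mul_assoc] at hp
        · apply uThree_ext
          · simp [mat_mul_zero_one, hz, ht]
          · simp [mat_mul_one_two, hz, ht, add_comm]
          · simp [mat_mul_zero_two, mat_mul_one_two, hz, ht]
    obtain ⟨s, z, t, hs, hz, ht⟩ := key
    have e : t⁻¹ * g * t = g * z := by rw [mul_assoc, ht, inv_mul_cancel_left]
    have h1 := uThreeChar_conj ψ c g t
    rw [e, uThreeChar_mul_central ψ c s hz] at h1
    by_contra h0
    exact hs ((mul_eq_right₀ h0).1 h1)

/-- The decomposition of the regular character of `U_3(F)`. -/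
theorem uThree_regular [Fintype F] [Fintype Fˣ] [DecidableEq F] (hψ : ψ.IsPrimitive) (g : U 3 F)
    [Decidable (g = 1)] :
    ∑ p : F × F, (uThreeLin ψ p g : ℂ) + Nat.card F * ∑ c : Fˣ, uThreeChar ψ (c : F) g =
      if g = 1 then (Nat.card F : ℂ) ^ 3 else 0 := by
  -- Orthogonality of additive characters in both superdiagonal entries; the sum over units below is
  -- the full sum over F without its term 1 at c = 0.
  have hlin : ∑ p : F × F, (uThreeLin ψ p g : ℂ) =
      if mat g 0 1 = 0 ∧ mat g 1 2 = 0 then (Nat.card F : ℂ) ^ 2 else 0 := by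
    simp only [uThreeLin_apply, AddChar.map_add_eq_mul, Fintype.sum_prod_type, ← Finset.mul_sum,
      ← Finset.sum_mul, AddChar.sum_mulShift _ hψ, Nat.card_eq_fintype_card]
    by_cases h1 : mat g 0 1 = 0 <;> by_cases h2 : mat g 1 2 = 0 <;> simp [h1, h2, sq]
  have hunits : ∑ c : Fˣ, ψ (c * mat g 0 2) = (if mat g 0 2 = 0 then (Nat.card F : ℂ) else 0) - 1 := by
    have h1 := AddChar.sum_mulShift (mat g 0 2) hψ
    rw [← Finset.add_sum_erase _ _ (Finset.mem_univ (0 : F)), zero_mul,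
      AddChar.map_zero_eq_one] at h1
    rw [eq_sub_iff_add_eq', Nat.card_eq_fintype_card]
    push_cast at h1
    rw [← h1]
    congr 1
    refine Finset.sum_bij (fun c _ => (c : F)) (fun c _ => by simp) (fun a _ b _ h => Units.ext h)
      (fun b hb => ⟨Units.mk0 b (Finset.ne_of_mem_erase hb), Finset.mem_univ _, rfl⟩)
      fun c _ => rfl
  have hg : g = 1 ↔ (mat g 0 1 = 0 ∧ mat g 1 2 = 0) ∧ mat g 0 2 = 0 := by
    constructor
    · rintro rfl
      simp
    · rintro ⟨⟨h1, h2⟩, h3⟩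
      apply uThree_ext <;> simp [*]
  rw [hlin, Finset.sum_congr rfl fun (c : Fˣ) _ => uThreeChar_apply hψ c.ne_zero g]
  by_cases h1 : mat g 0 1 = 0 ∧ mat g 1 2 = 0
  · simp only [if_pos h1, ← Finset.mul_sum, hunits]
    by_cases h2 : mat g 0 2 = 0
    · rw [if_pos h2, if_pos (hg.2 ⟨h1, h2⟩)]
      ring
    · rw [if_neg h2, if_neg fun h => h2 (hg.1 h).2]
      ring
  · rw [if_neg fun h => h1 (hg.1 h).1]
    simp [if_neg h1]

theorem isIrrChar_uThreeLin (p : F × F) : IsIrrChar fun g => (uThreeLin ψ p g : ℂ) :=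
  isIrrChar_monoidHom _

theorem isIrrChar_uThreeChar (hψ : ψ.IsPrimitive) (c : Fˣ) : IsIrrChar (uThreeChar ψ (c : F)) :=
  isIrrChar_cornerChar _ hψ isIrrChar_one isIrrChar_one fun _ => c.ne_zero

theorem uThreeLin_injective (hψ : ψ.IsPrimitive) :
    Function.Injective fun (p : F × F) (g : U 3 F) => (uThreeLin ψ p g : ℂ) := by
  have hinj := AddChar.to_mulShift_inj_of_isPrimitive hψ
  intro p p' h
  have key : ∀ (i j : Fin 3), i < j → ∀ c : F, ∃ u : U 3 F, mat u = 1 + Matrix.single i j c :=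
    fun i j hij c => exists_mat_eq_single hij c
  apply Prod.ext
  · refine hinj (DFunLike.ext _ _ fun c => ?_)
    obtain ⟨u, hu⟩ := key 0 1 (by decide) c
    have := congrFun h u
    simpa [uThreeLin_apply, hu, AddChar.mulShift_apply] using this
  · refine hinj (DFunLike.ext _ _ fun c => ?_)
    obtain ⟨u, hu⟩ := key 1 2 (by decide) c
    have := congrFun h u
    simpa [uThreeLin_apply, hu, AddChar.mulShift_apply] using this

theorem uThreeChar_injective (hψ : ψ.IsPrimitive) :
    Function.Injective fun c : Fˣ => uThreeChar ψ (c : F) := by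
  intro c c' h
  have := (cornerChar_injective _ hψ isIrrChar_one isIrrChar_one isIrrChar_one isIrrChar_one
    (fun _ => c.ne_zero) (fun _ => c'.ne_zero) h).1
  exact Units.ext (congrFun this 0)

end UThree

/-! ### Decompositions with constituents of two degrees -/

section Decomposition

variable {G : Type*} [Group G] [Finite G] {I J : Type*} [Fintype I] [Fintype J]

/-- The multiplicity is counted over indices, so that injectivity of the families and disjointness
of their degrees can be brought in separately afterwards. -/
theorem multiplicity_in_of_decomposition {L : I → G → ℂ} {H : J → G → ℂ} {ξ : G → ℂ} {q : ℂ}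
    (hL : ∀ i, IsIrrChar (L i)) (hH : ∀ j, IsIrrChar (H j)) (hξ : ξ = ∑ i, L i + q • ∑ j, H j)
    [DecidableEq (G → ℂ)] {χ : G → ℂ} (hχ : IsIrrChar χ) :
    multiplicity_in χ ξ = (∑ i, if χ = L i then 1 else 0) + q * ∑ j, if χ = H j then 1 else 0 := by
  have h : ξ = ∑ k : I ⊕ J, (Sum.elim (fun _ => 1) (fun _ => q) k : ℂ) • (Sum.elim L H k) := by
    rw [hξ, Fintype.sum_sum_type, Finset.smul_sum]
    simp
  rw [h, multiplicity_in_sum, Fintype.sum_sum_type, Finset.mul_sum]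
  simp only [Sum.elim_inl, Sum.elim_inr, one_mul]
  congr 1
  · exact Finset.sum_congr rfl fun i _ => multiplicity_in_irr hχ (hL i)
  · exact Finset.sum_congr rfl fun j _ => by rw [multiplicity_in_irr hχ (hH j)]

variable {L : I → G → ℂ} {H : J → G → ℂ} {ξ : G → ℂ} {q : ℂ} {a b : ℕ}
  (hL : ∀ i, IsIrrChar (L i)) (hH : ∀ j, IsIrrChar (H j)) (hξ : ξ = ∑ i, L i + q • ∑ j, H j)
  (hLi : Function.Injective L) (hHi : Function.Injective H) (ha : ∀ i, L i 1 = a)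
  (hb : ∀ j, H j 1 = b) (hab : a ≠ b) (hq : q ≠ 0)

include hL hH hξ hLi ha hb hab in
theorem multiplicity_in_left (i : I) : multiplicity_in (L i) ξ = 1 := by
  classical
  have h : ∀ j, L i ≠ H j := fun j h => hab (by
    have := ha i
    rw [h, hb j] at this
    exact_mod_cast this.symm)
  rw [multiplicity_in_of_decomposition hL hH hξ (hL i)]
  simp [h, hLi.eq_iff]

include hL hH hξ hHi ha hb hab in
theorem multiplicity_in_right (j : J) : multiplicity_in (H j) ξ = q := by
  classical
  have h : ∀ i, H j ≠ L i := fun i h => hab (by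
    have := ha i
    rw [← h, hb j] at this
    exact_mod_cast this.symm)
  rw [multiplicity_in_of_decomposition hL hH hξ (hH j)]
  simp [h, hHi.eq_iff]

include hL hH hξ in
theorem mem_range_of_mem_irrConstituents {χ : G → ℂ} (hχ : χ ∈ irrConstituents ξ) :
    χ ∈ Set.range L ∨ χ ∈ Set.range H := by
  classical
  by_contra h
  push Not at h
  refine hχ.2 ?_
  rw [multiplicity_in_of_decomposition hL hH hξ hχ.1]
  have h1 : ∀ i, χ ≠ L i := fun i hi => h.1 ⟨i, hi.symm⟩
  have h2 : ∀ j, χ ≠ H j := fun j hj => h.2 ⟨j, hj.symm⟩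
  simp [h1, h2]

include hL hH hξ hLi ha hb hab in
theorem constituentsOfDegree_left : constituentsOfDegree ξ a = Set.range L := by
  ext χ
  constructor
  · rintro ⟨hχ, h1⟩
    rcases mem_range_of_mem_irrConstituents hL hH hξ hχ with h | ⟨j, rfl⟩
    · exact h
    · rw [hb j] at h1
      exact absurd (by exact_mod_cast h1.symm) hab
  · rintro ⟨i, rfl⟩
    refine ⟨⟨hL i, ?_⟩, ha i⟩
    rw [multiplicity_in_left hL hH hξ hLi ha hb hab]
    exact one_ne_zero

include hL hH hξ hHi ha hb hab hq in
theorem constituentsOfDegree_right : constituentsOfDegree ξ b = Set.range H := by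
  ext χ
  constructor
  · rintro ⟨hχ, h1⟩
    rcases mem_range_of_mem_irrConstituents hL hH hξ hχ with ⟨i, rfl⟩ | h
    · rw [ha i] at h1
      exact absurd (by exact_mod_cast h1) hab
    · exact h
  · rintro ⟨j, rfl⟩
    refine ⟨⟨hH j, ?_⟩, hb j⟩
    rw [multiplicity_in_right hL hH hξ hHi ha hb hab]
    exact hq

theorem finsum_mem_range_eq_sum {L : I → G → ℂ} (hLi : Function.Injective L) :
    ∑ᶠ χ ∈ Set.range L, χ = ∑ i, L i := by
  rw [finsum_mem_range hLi, finsum_eq_sum_of_fintype]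

end Decomposition

/-! ### Elementary characters -/

section Elementary

variable {n : ℕ} {F : Type*} [Field F] [Finite F] (α : PosRoot n)

theorem coClosed_arm : CoClosed n fun a b => a = α.1.1 - 1 ∧ b < α.1.2 := by
  intro i j k hij hjk _ h
  omega

/-- The root α_{i,j} sits at the 0-based entry (i - 1, j), so its arm is the part of row i - 1
between the diagonal and column j. Root subgroups at the remaining positions generate the full
pattern group. -/
theorem baseGroup_eq_zeroGroup : baseGroup F α = zeroGroup n F _ (coClosed_arm α) := by
  apply le_antisymm
  · rw [baseGroup, Subgroup.closure_le]
    intro u hu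
    simp only [Set.mem_iUnion] at hu
    obtain ⟨β, hβ, c, hc⟩ := hu
    refine mem_zeroGroup.2 fun a b hab hq => ?_
    rw [mat_apply, hc, Matrix.add_apply, Matrix.one_apply_ne hab.ne, zero_add,
      Matrix.single_apply_of_ne]
    rintro ⟨rfl, rfl⟩
    have h1 := α.2
    have h2 := β.2
    simp only at hq
    exact hβ ⟨by omega, by omega⟩
  · intro g hg
    refine mem_of_forall_single_mem _ g fun i j hij h u c hu => Subgroup.subset_closure ?_
    have hij' := Fin.lt_def.1 hij
    simp only [Set.mem_iUnion]
    refine ⟨⟨(i + 1, j), by simp only; omega⟩, fun hβ => h (hg i j hij ?_), c, hu⟩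
    have h1 := hβ.1
    have h2 := hβ.2
    simp only at h1 h2
    omega

/-- The entry of a matrix at the position of the root `α`. -/
def rootEntry (u : U n F) : F :=
  mat u ⟨α.1.1 - 1, by have := α.2; omega⟩ ⟨α.1.2, α.2.2.2⟩

variable {α}

theorem mem_baseGroup {u : U n F} : u ∈ baseGroup F α ↔
    ∀ i j : Fin n, i < j → i.val = α.1.1 - 1 → j.val < α.1.2 → mat u i j = 0 := by
  rw [baseGroup_eq_zeroGroup, mem_zeroGroup]
  exact ⟨fun h i j hij h1 h2 => h i j hij ⟨h1, h2⟩, fun h i j hij hq => h i j hij hq.1 hq.2⟩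

theorem rootEntry_mul {u v : U n F} (hu : u ∈ baseGroup F α) :
    rootEntry α (u * v) = rootEntry α u + rootEntry α v := by
  have h1 := α.2
  refine mat_mul_apply_of_forall u v (Fin.lt_def.2 (by simp only; omega)) fun k h2 h3 => ?_
  rw [mem_baseGroup.1 hu _ k h2 rfl (Fin.lt_def.1 h3), zero_mul]

theorem rootEntry_conj {u x : U n F} (hu : u ∈ baseGroup F α) (hx : x ∈ baseGroup F α) :
    rootEntry α (x⁻¹ * u * x) = rootEntry α u := by
  have h1 := rootEntry_mul (v := x⁻¹ * u * x) hx
  rw [show x * (x⁻¹ * u * x) = u * x by group, rootEntry_mul hu, add_comm] at h1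
  exact (add_left_cancel h1).symm

theorem rootEntry_one : rootEntry α (1 : U n F) = 0 := by
  have := rootEntry_mul (v := 1) (baseGroup F α).one_mem
  rwa [one_mul, left_eq_add] at this

variable (α) in
theorem exists_rootEntry_eq (c : F) :
    ∃ u : U n F, u ∈ rootSubgroup F α ∧ rootEntry α u = c ∧
      mat u = 1 + Matrix.single ⟨α.1.1 - 1, by have := α.2; omega⟩ ⟨α.1.2, α.2.2.2⟩ c := by
  have h1 := α.2
  have h2 : (⟨α.1.1 - 1, by omega⟩ : Fin n) < ⟨α.1.2, α.2.2.2⟩ :=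
    Fin.lt_def.2 (by simp only; omega)
  obtain ⟨u, hu⟩ := exists_mat_eq_single h2 c
  refine ⟨u, ⟨c, hu⟩, ?_, hu⟩
  rw [rootEntry, hu, Matrix.add_apply, Matrix.one_apply_ne h2.ne, Matrix.single_apply_same, zero_add]

theorem rootEntry_eq_zero {β : PosRoot n} (h : β ≠ α) {u : U n F} (hu : u ∈ rootSubgroup F β) :
    rootEntry α u = 0 := by
  obtain ⟨c, hc⟩ := hu
  have h1 := α.2
  have h2 := β.2
  have h3 : (⟨α.1.1 - 1, by omega⟩ : Fin n) < ⟨α.1.2, α.2.2.2⟩ :=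
    Fin.lt_def.2 (by simp only; omega)
  rw [rootEntry, mat_apply, hc, Matrix.add_apply, Matrix.one_apply_ne h3.ne, zero_add,
    Matrix.single_apply_of_ne]
  simp only [Fin.mk.injEq]
  rintro ⟨h4, h5⟩
  exact h (Subtype.ext (Prod.ext (by omega) h5))

theorem rootSubgroup_subset_baseGroup {β : PosRoot n} (hβ : β ∉ arm α) :
    rootSubgroup F β ⊆ baseGroup F α := fun _ hu =>
  Subgroup.subset_closure (Set.mem_biUnion (Set.mem_compl hβ) hu)

theorem self_notMem_arm : α ∉ arm α := fun h => lt_irrefl _ h.2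

variable {ψ : AddChar F ℂ}

variable (ψ α) in
/-- The linear character of `V_α` with values `ψ(d u_α)`. -/
def baseLin (d : F) : baseGroup F α →* ℂˣ :=
  MonoidHom.toHomUnits
    { toFun := fun u => ψ (d * rootEntry α u.1)
      map_one' := by rw [OneMemClass.coe_one, rootEntry_one, mul_zero, AddChar.map_zero_eq_one]
      map_mul' := fun u v => by
        rw [Subgroup.coe_mul, rootEntry_mul u.2, mul_add, AddChar.map_add_eq_mul] }

theorem baseLin_apply (d : F) (u : baseGroup F α) :
    (baseLin α ψ d u : ℂ) = ψ (d * rootEntry α u.1) := rfl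

variable (α) in
theorem exists_baseLinearChar_eq (hψ : ψ.IsPrimitive) {d : F} (hd : d ≠ 0) :
    ∃ l : BaseLinearChar F α, l.1 = baseLin α ψ d := by
  refine ⟨⟨baseLin α ψ d, ?_, ?_⟩, rfl⟩
  · obtain ⟨c, hc⟩ := AddChar.ne_one_iff.1 (hψ hd)
    obtain ⟨u, hu, hu1, -⟩ := exists_rootEntry_eq α c
    refine ⟨⟨u, rootSubgroup_subset_baseGroup self_notMem_arm hu⟩, hu, fun h => hc ?_⟩
    have := congrArg (fun z : ℂˣ => (z : ℂ)) h
    rwa [baseLin_apply, hu1] at this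
  · intro β _ hβ u hu
    apply Units.ext
    rw [baseLin_apply, rootEntry_eq_zero hβ hu, mul_zero, AddChar.map_zero_eq_one, Units.val_one]

/-- The shifts of a primitive character are distinct, and F has exactly |F| additive characters. -/
theorem exists_mulShift_eq (hψ : ψ.IsPrimitive) (χ : AddChar F ℂ) : ∃ d, ψ.mulShift d = χ := by
  cases nonempty_fintype F
  have h := (Fintype.bijective_iff_injective_and_card fun d => ψ.mulShift d).2
    ⟨AddChar.to_mulShift_inj_of_isPrimitive hψ, AddChar.card_eq.symm⟩
  exact h.2 χ

/-- Since V_α is generated by root subgroups, such a character is determined on X_α ≅ F, where it is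
an additive character c ↦ ψ(dc); nontriviality on X_α forces d ≠ 0. -/
theorem BaseLinearChar.exists_eq (hψ : ψ.IsPrimitive) (l : BaseLinearChar F α) :
    ∃ d, d ≠ 0 ∧ l.1 = baseLin α ψ d := by
  choose x hx hx1 hx2 using exists_rootEntry_eq (F := F) α
  have hxV : ∀ c, x c ∈ baseGroup F α := fun c =>
    rootSubgroup_subset_baseGroup self_notMem_arm (hx c)
  have hij : (⟨α.1.2, α.2.2.2⟩ : Fin n) ≠ ⟨α.1.1 - 1, by have := α.2; omega⟩ := fun h => by
    have h1 := α.2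
    have h2 := congrArg Fin.val h
    simp only at h2
    omega
  have hadd : ∀ c c', x (c + c') = x c * x c' := fun c c' => mat_injective (by
    rw [map_mul, hx2, hx2, hx2, mul_add, add_mul, add_mul,
      Matrix.single_mul_single_of_ne _ _ _ _ hij]
    simp [Matrix.single_add, add_assoc])
  let χ : AddChar F ℂ :=
    { toFun := fun c => (l.1 ⟨x c, hxV c⟩ : ℂ)
      map_zero_eq_one' := by
        have : (⟨x 0, hxV 0⟩ : baseGroup F α) = 1 :=
          Subtype.ext (mat_injective (by simp [hx2]))
        rw [this, map_one, Units.val_one]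
      map_add_eq_mul' := fun c c' => by
        rw [← Units.val_mul, ← map_mul]
        congr 2
        exact Subtype.ext (hadd c c') }
  obtain ⟨d, hd⟩ := exists_mulShift_eq hψ χ
  have hχ : ∀ c, (l.1 ⟨x c, hxV c⟩ : ℂ) = ψ (d * c) := fun c => by
    rw [← AddChar.mulShift_apply, hd]
    rfl
  have hroot : ∀ u (hu : u ∈ rootSubgroup F α) (huV : u ∈ baseGroup F α),
      (l.1 ⟨u, huV⟩ : ℂ) = ψ (d * rootEntry α u) := by
    rintro u ⟨c, hc⟩ huV
    obtain rfl : u = x c := mat_injective ((mat_apply u).trans (hc.trans (hx2 c).symm))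
    rw [hχ, hx1]
  have key : l.1 = baseLin α ψ d := by
    ext ⟨u, hu⟩
    rw [baseLin_apply]
    simp only
    induction hu using Subgroup.closure_induction with
    | mem u hu =>
      simp only [Set.mem_iUnion] at hu
      obtain ⟨β, hβ, hu⟩ := hu
      by_cases h : β = α
      · exact hroot u (h ▸ hu) _
      · rw [l.2.2 β hβ h _ hu, rootEntry_eq_zero h hu, mul_zero, AddChar.map_zero_eq_one,
          Units.val_one]
    | one =>
      rw [rootEntry_one, mul_zero, AddChar.map_zero_eq_one]
      exact congrArg Units.val (map_one l.1)
    | mul u v hu hv h1 h2 =>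
      rw [rootEntry_mul hu, mul_add, AddChar.map_add_eq_mul, ← h1, ← h2, ← Units.val_mul, ← map_mul]
      rfl
    | inv u hu h1 =>
      have h2 := rootEntry_mul (v := u⁻¹) hu
      rw [mul_inv_cancel, rootEntry_one] at h2
      rw [← neg_eq_of_add_eq_zero_right h2.symm, mul_neg, AddChar.map_neg_eq_inv, ← h1,
        ← Units.val_inv_eq_inv_val, ← map_inv]
      rfl
  refine ⟨d, ?_, key⟩
  rintro rfl
  obtain ⟨u, -, hu⟩ := l.2.1
  refine hu (Units.ext ?_)
  rw [key, baseLin_apply, zero_mul, AddChar.map_zero_eq_one, Units.val_one]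

end Elementary

/-! ### The basic characters at the three roots -/

section Basic

variable {n : ℕ} {F : Type*} [Field F] [Finite F]

/-- Each base group constrains one row only, so this factorization writes U as a product of base
groups at different rows, as `inducedChar_mul_inducedChar` requires. -/
theorem exists_mul_eq_rows (k : ℕ) (g : U n F) : ∃ v w : U n F, g = v * w ∧
    (∀ i j : Fin n, i.val < k → mat v i j = (1 : Matrix (Fin n) (Fin n) F) i j) ∧
    ∀ i j : Fin n, k ≤ i.val → mat w i j = (1 : Matrix (Fin n) (Fin n) F) i j := by
  obtain ⟨w, hw⟩ := exists_mat_eq (n := n) (F := F)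
    (fun i j => if i.val < k then mat g i j else (1 : Matrix (Fin n) (Fin n) F) i j)
    (fun i j hij => by
      rw [mat_lower g hij, Matrix.one_apply_ne hij.ne', ite_self])
    (fun i => by rw [mat_diag, Matrix.one_apply_eq, ite_self])
  replace hw : ∀ i j, mat w i j = if i.val < k then mat g i j else
      (1 : Matrix (Fin n) (Fin n) F) i j := fun i j =>
    congrFun (congrFun hw i) j
  refine ⟨g * w⁻¹, w, by group, fun i j hi => ?_, fun i j hi => by rw [hw, if_neg hi.not_gt]⟩
  rw [mat_mul_apply, ← map_one mat, ← mul_inv_cancel w, mat_mul_apply]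
  refine Finset.sum_congr rfl fun l _ => ?_
  rw [hw, if_pos hi]

/-- The root `α_{i+1,n-3+i}`. -/
def cornerRoot (n : ℕ) (hn : 7 ≤ n) (i : Fin 3) : PosRoot n :=
  ⟨(i + 1, n - 6 + 3 + i), by simp only; omega⟩

theorem cornerRoot_mem (hn : 7 ≤ n) (i : Fin 3) : cornerRoot n hn i ∈ rootsV n hn := by
  simp only [rootsV, Finset.mem_insert, Finset.mem_singleton, cornerRoot, Subtype.mk.injEq,
    Prod.mk.injEq]
  fin_cases i <;> simp <;> omega

theorem bijective_cornerRoot (hn : 7 ≤ n) : Function.Bijective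
    fun i : Fin 3 => (⟨cornerRoot n hn i, cornerRoot_mem hn i⟩ : rootsV n hn) := by
  constructor
  · intro i j hij
    simp only [cornerRoot, Subtype.mk.injEq, Prod.mk.injEq] at hij
    exact Fin.ext (by omega)
  · rintro ⟨α, hα⟩
    simp only [rootsV, Finset.mem_insert, Finset.mem_singleton] at hα
    rcases hα with rfl | rfl | rfl
    · exact ⟨0, Subtype.ext (Subtype.ext (Prod.ext (by simp [cornerRoot])
        (by simp [cornerRoot]; omega)))⟩
    · exact ⟨1, Subtype.ext (Subtype.ext (Prod.ext (by simp [cornerRoot])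
        (by simp [cornerRoot]; omega)))⟩
    · exact ⟨2, Subtype.ext (Subtype.ext (Prod.ext (by simp [cornerRoot])
        (by simp [cornerRoot]; omega)))⟩

theorem basicChar_rootsV (hn : 7 ≤ n) (φ : ∀ α : rootsV n hn, BaseLinearChar F α.1) :
    basicChar (rootsV n hn) φ =
      ∏ i, elementaryChar (φ ⟨cornerRoot n hn i, cornerRoot_mem hn i⟩) :=
  (Function.Bijective.prod_comp (bijective_cornerRoot hn) fun α => elementaryChar (φ α)).symm

theorem mem_baseGroup_cornerRoot (hn : 7 ≤ n) {i : Fin 3} {u : U n F} :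
    u ∈ baseGroup F (cornerRoot n hn i) ↔
      ∀ a b : Fin n, a < b → a.val = i → b.val < n - 6 + 3 + i → mat u a b = 0 :=
  mem_baseGroup

theorem mem_baseGroup_cornerRoot_of_row (hn : 7 ≤ n) {i : Fin 3} {u : U n F}
    (hu : ∀ a b : Fin n, a.val = i → mat u a b = (1 : Matrix (Fin n) (Fin n) F) a b) :
    u ∈ baseGroup F (cornerRoot n hn i) :=
  (mem_baseGroup_cornerRoot hn).2 fun a b hab ha _ => by
    rw [hu a b ha, Matrix.one_apply_ne hab.ne]

variable (F) in
/-- The intersection of the base groups at the three roots. -/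
def baseInf (n : ℕ) (hn : 7 ≤ n) : Subgroup (U n F) :=
  (baseGroup F (cornerRoot n hn 0) ⊓ baseGroup F (cornerRoot n hn 1)) ⊓
    baseGroup F (cornerRoot n hn 2)

/-- The three arms fill the positions forbidden in the corner group together with those above the
diagonal in the first 3 × 3 block. The intersection is thus the kernel of the corner group acting
through U_3. -/
theorem mem_baseInf (hn : 7 ≤ n) {u : U n F} : u ∈ baseInf F n hn ↔
    u ∈ cornerGroup n F 3 (n - 6) ∧ diagBlock n F 0 3 (by omega) u = 1 := by
  have h1 : u ∈ baseInf F n hn ↔ ∀ i, u ∈ baseGroup F (cornerRoot n hn i) := by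
    rw [Fin.forall_fin_succ, Fin.forall_fin_two, baseInf, Subgroup.mem_inf, Subgroup.mem_inf,
      and_assoc]
    rfl
  simp only [h1, mem_baseGroup_cornerRoot, mem_cornerGroup]
  constructor
  · intro h
    refine ⟨fun i j hi hj hij => h ⟨i, hi⟩ i j (Fin.lt_def.2 (by omega)) rfl hij,
      diagBlock_eq_one _ _ _ fun i j hij hj _ => ?_⟩
    have := Fin.lt_def.1 hij
    exact h ⟨i, by omega⟩ i j hij rfl (by simp only; omega)
  · rintro ⟨h2, h3⟩ i a b hab ha hb
    have hab' := Fin.lt_def.1 hab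
    by_cases hb3 : b.val < 3
    · have h4 := congrArg (fun g => mat g ⟨a, by omega⟩ ⟨b, hb3⟩) h3
      simp only [mat_diagBlock, map_one] at h4
      rw [Matrix.one_apply_ne (by simpa [Fin.ext_iff] using hab'.ne)] at h4
      simpa using h4
    · exact h2 a b (by omega) (by omega) (by omega)

theorem basicChar_eq_inducedChar (hn : 7 ≤ n) (ψ : AddChar F ℂ) (d : Fin 3 → F)
    (φ : ∀ α : rootsV n hn, BaseLinearChar F α.1)
    (hφ : ∀ i, (φ ⟨cornerRoot n hn i, cornerRoot_mem hn i⟩).1 = baseLin (cornerRoot n hn i) ψ (d i)) :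
    basicChar (rootsV n hn) φ = inducedChar (baseInf F n hn) fun u =>
      ψ (cornerForm (show 3 + (n - 6) + 3 = n by omega) d u.1) := by
  rw [basicChar_rootsV, Fin.prod_univ_three]
  simp only [elementaryChar, hφ]
  rw [inducedChar_mul_inducedChar, inducedChar_mul_inducedChar]
  · refine congrArg (inducedChar (baseInf F n hn)) (funext fun u => ?_)
    simp only [baseLin_apply, cornerForm, Fin.sum_univ_three, AddChar.map_add_eq_mul]
    rfl
  · intro g
    obtain ⟨v, w, hg, hv, hw⟩ := exists_mul_eq_rows 2 g
    exact ⟨v, ⟨mem_baseGroup_cornerRoot_of_row hn fun a b ha => hv a b (by simp [ha]),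
      mem_baseGroup_cornerRoot_of_row hn fun a b ha => hv a b (by simp [ha])⟩, w,
      mem_baseGroup_cornerRoot_of_row hn fun a b ha => hw a b (by simp [ha]), hg⟩
  · intro k x
    simp only [baseLin_apply, Subgroup.coe_mul, Subgroup.coe_inv, rootEntry_conj k.2.1 x.2.1,
      rootEntry_conj k.2.2 x.2.2]
  · intro k x
    simp [mul_comm]
  · intro g
    obtain ⟨v, w, hg, hv, hw⟩ := exists_mul_eq_rows 1 g
    exact ⟨v, mem_baseGroup_cornerRoot_of_row hn fun a b ha => hv a b (by simp [ha]), w,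
      mem_baseGroup_cornerRoot_of_row hn fun a b ha => hw a b (by simp [ha]), hg⟩
  · intro k x
    simp [mul_comm]
  · intro k x
    simp [mul_comm]

theorem card_uThree : Nat.card (U 3 F) = Nat.card F ^ 3 := by
  have h0 : CoClosed 3 fun _ _ => False := fun _ _ _ _ _ _ h => h.elim
  have htop : zeroGroup 3 F (fun _ _ => False) h0 = ⊤ := eq_top_iff.2 fun g _ i j _ h => h.elim
  have h1 := card_zeroGroup (F := F) _ h0
  rw [htop, Subgroup.card_top, numPos_eq_sum_rows] at h1
  exact h1

theorem card_cornerGroup_eq (hn : 7 ≤ n) :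
    Nat.card (cornerGroup n F 3 (n - 6)) = Nat.card (baseInf F n hn) * Nat.card F ^ 3 := by
  let A := (diagBlock n F 0 3 (by omega)).comp (cornerGroup n F 3 (n - 6)).subtype
  have hA : Function.Surjective A := fun a => by
    obtain ⟨g, hg, h1, -⟩ := exists_blocks (show 3 + (n - 6) + 3 = n by omega) a 1
    exact ⟨⟨g, hg⟩, h1⟩
  have hker : A.ker = (baseInf F n hn).subgroupOf (cornerGroup n F 3 (n - 6)) := by
    ext u
    rw [MonoidHom.mem_ker, Subgroup.mem_subgroupOf, mem_baseInf]
    exact ⟨fun h => ⟨u.2, h⟩, fun h => h.2⟩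
  rw [← card_uThree, ← A.ker.card_mul_index, Subgroup.index_ker, MonoidHom.range_eq_top.2 hA,
    Subgroup.card_top, hker,
    Nat.card_congr (Subgroup.subgroupOfEquivOfLe fun u hu => ((mem_baseInf hn).1 hu).1).toEquiv]

variable {ψ : AddChar F ℂ}

/-- Inducing from the kernel of K → U_3 multiplies λ_d^U by the inflated regular character of U_3.
The common factor is visible pointwise, because being trivial in the U_3 block is invariant under
conjugation. -/
theorem inducedChar_baseInf (hn : 7 ≤ n) (hψ : ψ.IsPrimitive) [Fintype F] [Fintype Fˣ]
    (d : Fin 3 → F) (h : 3 + (n - 6) + 3 = n) :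
    (inducedChar (baseInf F n hn) fun u => ψ (cornerForm h d u.1)) =
      ∑ p : F × F, cornerChar h ψ d (fun g => (uThreeLin ψ p g : ℂ)) 1 +
        (Nat.card F : ℂ) • ∑ c : Fˣ, cornerChar h ψ d (uThreeChar ψ (c : F)) 1 := by
  classical
  cases nonempty_fintype (U n F)
  set A := diagBlock n F 0 3 (by omega) with hA
  ext g
  have hR : (∑ p : F × F, cornerChar h ψ d (fun g => (uThreeLin ψ p g : ℂ)) 1 +
        (Nat.card F : ℂ) • ∑ c : Fˣ, cornerChar h ψ d (uThreeChar ψ (c : F)) 1) g =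
      inducedChar (cornerGroup n F 3 (n - 6)) (cornerLin h ψ d) g *
        if A g = 1 then (Nat.card F : ℂ) ^ 3 else 0 := by
    rw [← uThree_regular hψ (A g)]
    simp only [cornerChar, Pi.add_apply, Pi.smul_apply, Finset.sum_apply, Pi.mul_apply,
      Function.comp_apply, Pi.one_apply, mul_one, smul_eq_mul, Finset.mul_sum, mul_add]
    congr 1
    exact Finset.sum_congr rfl fun c _ => by ring
  have hconj : ∀ x, A (x⁻¹ * g * x) = 1 ↔ A g = 1 := fun x => by
    rw [map_mul, map_mul, map_inv, mul_assoc, inv_mul_eq_one, eq_comm, mul_eq_right]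
  have hz : ∀ x, zeroExt (baseInf F n hn) (fun u => ψ (cornerForm h d u.1)) (x⁻¹ * g * x) =
      zeroExt (cornerGroup n F 3 (n - 6)) (cornerLin h ψ d) (x⁻¹ * g * x) *
        if A g = 1 then 1 else 0 := by
    intro x
    rw [← if_congr (hconj x) rfl rfl]
    by_cases hx : x⁻¹ * g * x ∈ baseInf F n hn
    · have hx' := (mem_baseInf hn).1 hx
      rw [zeroExt_of_mem _ hx, zeroExt_of_mem _ hx'.1, if_pos hx'.2, mul_one]
      rfl
    · rw [zeroExt_of_notMem _ hx]
      by_cases hx1 : x⁻¹ * g * x ∈ cornerGroup n F 3 (n - 6)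
      · rw [if_neg fun h2 => hx ((mem_baseInf hn).2 ⟨hx1, h2⟩), mul_zero]
      · rw [zeroExt_of_notMem _ hx1, zero_mul]
  have hcard : (Nat.card (cornerGroup n F 3 (n - 6)) : ℂ) =
      Nat.card (baseInf F n hn) * (Nat.card F : ℂ) ^ 3 := by
    exact_mod_cast card_cornerGroup_eq hn
  have hF : (Nat.card F : ℂ) ≠ 0 := Nat.cast_ne_zero.2 Nat.card_pos.ne'
  rw [hR, inducedChar_eq_sum, inducedChar_eq_sum, Finset.sum_congr rfl fun x _ => hz x,
    ← Finset.sum_mul, hcard]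
  split_ifs
  · field_simp
  · simp only [mul_zero]

end Basic

/-! ### The constituents and the proof of the theorem -/

section Main

variable {n : ℕ} {F : Type*} [Field F] [Finite F] {ψ : AddChar F ℂ}

variable (ψ) in
/-- The constituents of the smaller degree of the basic character given by `d`. -/
def smallConstituent (h : 3 + (n - 6) + 3 = n) (d : Fin 3 → Fˣ) (p : F × F) : U n F → ℂ :=
  cornerChar h ψ (fun i => d i) (fun g => (uThreeLin ψ p g : ℂ)) 1

variable (ψ) in
/-- The constituents of the larger degree of the basic character given by `d`. -/
def largeConstituent (h : 3 + (n - 6) + 3 = n) (d : Fin 3 → Fˣ) (c : Fˣ) : U n F → ℂ :=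
  cornerChar h ψ (fun i => d i) (uThreeChar ψ (c : F)) 1

theorem isIrrChar_smallConstituent (hψ : ψ.IsPrimitive) (h : 3 + (n - 6) + 3 = n)
    (d : Fin 3 → Fˣ) (p : F × F) : IsIrrChar (smallConstituent ψ h d p) :=
  isIrrChar_cornerChar h hψ (isIrrChar_uThreeLin p) isIrrChar_one fun i => (d i).ne_zero

theorem isIrrChar_largeConstituent (hψ : ψ.IsPrimitive) (h : 3 + (n - 6) + 3 = n)
    (d : Fin 3 → Fˣ) (c : Fˣ) : IsIrrChar (largeConstituent ψ h d c) :=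
  isIrrChar_cornerChar h hψ (isIrrChar_uThreeChar hψ c) isIrrChar_one fun i => (d i).ne_zero

theorem smallConstituent_injective (hψ : ψ.IsPrimitive) (h : 3 + (n - 6) + 3 = n)
    (d : Fin 3 → Fˣ) : Function.Injective (smallConstituent ψ h d) := fun p p' hp =>
  uThreeLin_injective hψ (cornerChar_injective h hψ (isIrrChar_uThreeLin p) isIrrChar_one
    (isIrrChar_uThreeLin p') isIrrChar_one (fun i => (d i).ne_zero) (fun i => (d i).ne_zero) hp).2.1

theorem largeConstituent_injective (hψ : ψ.IsPrimitive) (h : 3 + (n - 6) + 3 = n)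
    (d : Fin 3 → Fˣ) : Function.Injective (largeConstituent ψ h d) := fun c c' hc =>
  uThreeChar_injective hψ (cornerChar_injective h hψ (isIrrChar_uThreeChar hψ c) isIrrChar_one
    (isIrrChar_uThreeChar hψ c') isIrrChar_one (fun i => (d i).ne_zero) (fun i => (d i).ne_zero)
    hc).2.1

theorem index_cornerGroup_three (h : 3 + (n - 6) + 3 = n) :
    (cornerGroup n F 3 (n - 6)).index = Nat.card F ^ (3 * n - 15) := by
  rw [index_cornerGroup h]
  simp only [Finset.sum_range_succ, Finset.range_zero, Finset.sum_empty]
  congr 1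
  omega

theorem smallConstituent_one (h : 3 + (n - 6) + 3 = n) (d : Fin 3 → Fˣ) (p : F × F) :
    smallConstituent ψ h d p 1 = (Nat.card F ^ (3 * n - 15) : ℕ) := by
  rw [smallConstituent, cornerChar_one, index_cornerGroup_three h, map_one, Units.val_one,
    Pi.one_apply, mul_one, mul_one]

theorem largeConstituent_one (h : 3 + (n - 6) + 3 = n) (d : Fin 3 → Fˣ) (c : Fˣ) :
    largeConstituent ψ h d c 1 = (Nat.card F ^ (3 * n - 14) : ℕ) := by
  rw [largeConstituent, cornerChar_one, index_cornerGroup_three h, uThreeChar_one,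
    Pi.one_apply, mul_one, ← Nat.cast_mul, ← pow_succ]
  congr 2
  omega

theorem largeConstituent_mul (h : 3 + (n - 6) + 3 = n) (d : Fin 3 → Fˣ) (c : Fˣ)
    (η : U (n - 6) F → ℂ) :
    largeConstituent ψ h d c * (η ∘ diagBlock n F 3 (n - 6) (by omega)) =
      cornerChar h ψ (fun i => d i) (uThreeChar ψ (c : F)) η := by
  ext g
  simp [largeConstituent, cornerChar]

theorem exists_basicChar_eq (hn : 7 ≤ n) (h : 3 + (n - 6) + 3 = n) (hψ : ψ.IsPrimitive)
    [Fintype F] [Fintype Fˣ] (φ : ∀ α : rootsV n hn, BaseLinearChar F α.1) :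
    ∃ d : Fin 3 → Fˣ, basicChar (rootsV n hn) φ = ∑ p, smallConstituent ψ h d p +
      (Nat.card F : ℂ) • ∑ c, largeConstituent ψ h d c := by
  choose d hd hφ using fun i => (φ ⟨cornerRoot n hn i, cornerRoot_mem hn i⟩).exists_eq hψ
  refine ⟨fun i => Units.mk0 (d i) (hd i), ?_⟩
  rw [basicChar_eq_inducedChar hn ψ d φ hφ, inducedChar_baseInf hn hψ d h]
  rfl

/-- Needed for the count: every choice of nonzero corner coefficients comes from some basic
character. -/
theorem exists_eq_basicChar (hn : 7 ≤ n) (h : 3 + (n - 6) + 3 = n) (hψ : ψ.IsPrimitive)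
    [Fintype F] [Fintype Fˣ] (d : Fin 3 → Fˣ) :
    ∃ φ : ∀ α : rootsV n hn, BaseLinearChar F α.1,
      basicChar (rootsV n hn) φ = ∑ p, smallConstituent ψ h d p +
        (Nat.card F : ℂ) • ∑ c, largeConstituent ψ h d c := by
  let e := Equiv.ofBijective _ (bijective_cornerRoot hn)
  choose φ hφ using fun α : rootsV n hn =>
    exists_baseLinearChar_eq α.1 hψ (d (e.symm α)).ne_zero
  refine ⟨φ, ?_⟩
  rw [basicChar_eq_inducedChar hn ψ (fun i => d i) φ, inducedChar_baseInf hn hψ _ h]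
  · rfl
  · intro i
    have he : e.symm ⟨cornerRoot n hn i, cornerRoot_mem hn i⟩ = i := e.symm_apply_apply i
    rw [hφ, he]

theorem muDeg_sub_two (hn : 7 ≤ n) : muDeg n - 2 = 3 * n - 14 + muDeg (n - 6) := by
  obtain ⟨m, rfl⟩ := Nat.exists_eq_add_of_le' hn
  -- Three recursion steps add (n-6) + (n-4) + (n-2) = 3n - 12 to μ(n-6).
  rw [show m + 7 = m + 7 - 6 + 2 + 2 + 2 by omega, muDeg_add_two, muDeg_add_two, muDeg_add_two,
    show m + 7 - 6 + 2 + 2 + 2 - 6 = m + 7 - 6 by omega]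
  omega

end Main

theorem mainTheorem9 {F : Type*} [Field F] [Finite F] (q : ℕ) (hq : q = Nat.card F)
    (n : ℕ) (hn : 7 ≤ n) :
    -- the decomposition of every basic character at the three roots
    (∀ φ : ∀ α : rootsV n hn, BaseLinearChar F α.1,
      (∀ χ ∈ irrConstituents (basicChar (rootsV n hn) φ),
        χ 1 = (q ^ (3 * n - 15) : ℕ) ∨ χ 1 = (q ^ (3 * n - 14) : ℕ)) ∧
      (constituentsOfDegree (basicChar (rootsV n hn) φ) (q ^ (3 * n - 15))).ncard = q ^ 2 ∧
      (∀ χ ∈ constituentsOfDegree (basicChar (rootsV n hn) φ) (q ^ (3 * n - 15)),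
        multiplicity_in χ (basicChar (rootsV n hn) φ) = 1) ∧
      (constituentsOfDegree (basicChar (rootsV n hn) φ) (q ^ (3 * n - 14))).ncard = q - 1 ∧
      (∀ χ ∈ constituentsOfDegree (basicChar (rootsV n hn) φ) (q ^ (3 * n - 14)),
        multiplicity_in χ (basicChar (rootsV n hn) φ) = q) ∧
      basicChar (rootsV n hn) φ =
        (∑ᶠ χ ∈ constituentsOfDegree (basicChar (rootsV n hn) φ) (q ^ (3 * n - 15)), χ) +
        (q : ℂ) •
          ∑ᶠ χ ∈ constituentsOfDegree (basicChar (rootsV n hn) φ) (q ^ (3 * n - 14)), χ) ∧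
    -- tensoring with inflated highest degree characters of `U_{n-6}(q)`
    (∀ φ : ∀ α : rootsV n hn, BaseLinearChar F α.1,
      ∀ χ ∈ constituentsOfDegree (basicChar (rootsV n hn) φ) (q ^ (3 * n - 14)),
      ∀ η : U (n - 6) F → ℂ, IsHighestDegree η →
        IsThirdHighestDegree (χ * (η ∘ diagBlock n F 3 (n - 6) (by omega))) ∧
        (χ * (η ∘ diagBlock n F 3 (n - 6) (by omega))) 1 = (q ^ (muDeg n - 2) : ℕ)) ∧
    -- the number of characters obtained
    {ψ : U n F → ℂ | ∃ φ : ∀ α : rootsV n hn, BaseLinearChar F α.1,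
      ∃ χ ∈ constituentsOfDegree (basicChar (rootsV n hn) φ) (q ^ (3 * n - 14)),
      ∃ η : U (n - 6) F → ℂ, IsHighestDegree η ∧
        ψ = χ * (η ∘ diagBlock n F 3 (n - 6) (by omega))}.ncard =
      (q - 1) ^ 4 * numIrr (n - 6) F (muDeg (n - 6)) := by
  classical
  cases nonempty_fintype F
  subst hq
  -- One fixed primitive character turns linear characters of root subgroups into coefficients in F,
  -- for all φ at once.
  obtain ⟨ψ, hψ⟩ := exists_isPrimitive F
  have h : 3 + (n - 6) + 3 = n := by omega
  have hab : Nat.card F ^ (3 * n - 15) ≠ Nat.card F ^ (3 * n - 14) :=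
    (Nat.pow_lt_pow_right Finite.one_lt_card (by omega)).ne
  have hF : (Nat.card F : ℂ) ≠ 0 := Nat.cast_ne_zero.2 Nat.card_pos.ne'
  have hunits : Nat.card Fˣ = Nat.card F - 1 := Nat.card_units F
  have left : ∀ (d : Fin 3 → Fˣ) (ξ : U n F → ℂ), ξ = ∑ p, smallConstituent ψ h d p +
      (Nat.card F : ℂ) • ∑ c, largeConstituent ψ h d c →
      constituentsOfDegree ξ (Nat.card F ^ (3 * n - 15)) =
        Set.range (smallConstituent ψ h d) := fun d ξ hξ =>
    constituentsOfDegree_left (isIrrChar_smallConstituent hψ h d)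
      (isIrrChar_largeConstituent hψ h d) hξ (smallConstituent_injective hψ h d)
      (smallConstituent_one h d) (largeConstituent_one h d) hab
  have right : ∀ (d : Fin 3 → Fˣ) (ξ : U n F → ℂ), ξ = ∑ p, smallConstituent ψ h d p +
      (Nat.card F : ℂ) • ∑ c, largeConstituent ψ h d c →
      constituentsOfDegree ξ (Nat.card F ^ (3 * n - 14)) =
        Set.range (largeConstituent ψ h d) := fun d ξ hξ =>
    constituentsOfDegree_right (isIrrChar_smallConstituent hψ h d)
      (isIrrChar_largeConstituent hψ h d) hξ (largeConstituent_injective hψ h d)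
      (smallConstituent_one h d) (largeConstituent_one h d) hab hF
  refine ⟨fun φ => ?_, fun φ χ hχ η hη => ?_, ?_⟩
  · obtain ⟨d, hξ⟩ := exists_basicChar_eq hn h hψ φ
    rw [left d _ hξ, right d _ hξ]
    refine ⟨fun χ hχ => ?_, ?_, ?_, ?_, ?_, ?_⟩
    · rcases mem_range_of_mem_irrConstituents (isIrrChar_smallConstituent hψ h d)
        (isIrrChar_largeConstituent hψ h d) hξ hχ with ⟨p, rfl⟩ | ⟨c, rfl⟩
      · exact Or.inl (smallConstituent_one h d p)
      · exact Or.inr (largeConstituent_one h d c)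
    · rw [Set.ncard_range_of_injective (smallConstituent_injective hψ h d), Nat.card_prod, sq]
    · rintro _ ⟨p, rfl⟩
      exact multiplicity_in_left (isIrrChar_smallConstituent hψ h d)
        (isIrrChar_largeConstituent hψ h d) hξ (smallConstituent_injective hψ h d)
        (smallConstituent_one h d) (largeConstituent_one h d) hab p
    · rw [Set.ncard_range_of_injective (largeConstituent_injective hψ h d), hunits]
    · rintro _ ⟨c, rfl⟩
      exact multiplicity_in_right (isIrrChar_smallConstituent hψ h d)
        (isIrrChar_largeConstituent hψ h d) hξ (largeConstituent_injective hψ h d)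
        (smallConstituent_one h d) (largeConstituent_one h d) hab c
    · rw [finsum_mem_range_eq_sum (smallConstituent_injective hψ h d),
        finsum_mem_range_eq_sum (largeConstituent_injective hψ h d)]
      exact hξ
  · obtain ⟨d, hξ⟩ := exists_basicChar_eq hn h hψ φ
    rw [right d _ hξ] at hχ
    obtain ⟨c, rfl⟩ := hχ
    rw [isHighestDegree_iff] at hη
    have hdeg : (largeConstituent ψ h d c * (η ∘ diagBlock n F 3 (n - 6) (by omega))) 1 =
        (Nat.card F ^ (muDeg n - 2) : ℕ) := by
      rw [Pi.mul_apply, Function.comp_apply, map_one, largeConstituent_one, hη.2,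
        muDeg_sub_two hn, pow_add]
      push_cast
      rfl
    refine ⟨isThirdHighestDegree_of_degree (by omega) ?_ hdeg, hdeg⟩
    rw [largeConstituent_mul]
    exact isIrrChar_cornerChar h hψ (isIrrChar_uThreeChar hψ c) hη.1 fun i => (d i).ne_zero
  · let Y := {η : U (n - 6) F → ℂ // IsIrrChar η ∧ η 1 = (Nat.card F : ℂ) ^ muDeg (n - 6)}
    -- The characters to be counted are the injective image of the triples (d, c, η): three corner
    -- coefficients, a central coefficient for U_3, and a highest degree character of the middle
    -- block.
    let f : (Fin 3 → Fˣ) × Fˣ × Y → U n F → ℂ := fun x =>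
      cornerChar h ψ (fun i => x.1 i) (uThreeChar ψ (x.2.1 : F)) x.2.2.1
    have hf : Function.Injective f := by
      rintro ⟨d, c, η, hη⟩ ⟨d', c', η', hη'⟩ heq
      obtain ⟨h1, h2, h3⟩ := cornerChar_injective h hψ (isIrrChar_uThreeChar hψ c) hη.1
        (isIrrChar_uThreeChar hψ c') hη'.1 (fun i => (d i).ne_zero) (fun i => (d' i).ne_zero) heq
      obtain rfl : d = d' := funext fun i => Units.ext (congrFun h1 i)
      obtain rfl : c = c' := uThreeChar_injective hψ h2
      subst h3
      rfl
    trans (Set.range f).ncard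
    · congr 1
      ext χ
      constructor
      · rintro ⟨φ, χ', hχ', η, hη, rfl⟩
        obtain ⟨d, hξ⟩ := exists_basicChar_eq hn h hψ φ
        rw [right d _ hξ] at hχ'
        obtain ⟨c, rfl⟩ := hχ'
        exact ⟨⟨d, c, η, isHighestDegree_iff.1 hη⟩, (largeConstituent_mul h d c η).symm⟩
      · rintro ⟨⟨d, c, η, hη⟩, rfl⟩
        obtain ⟨φ, hξ⟩ := exists_eq_basicChar hn h hψ d
        exact ⟨φ, _, (right d _ hξ).symm ▸ ⟨c, rfl⟩, η, isHighestDegree_iff.2 hη,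
          (largeConstituent_mul h d c η).symm⟩
    · rw [Set.ncard_range_of_injective hf, Nat.card_prod, Nat.card_prod, Nat.card_fun, hunits, Nat.card_fin,
        ← mul_assoc, ← pow_succ]
      congr 1

end
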